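/- Let $s_1,s_2$ be positive even integers, $d_1,d_2\in\mathbb R$, and let $(\epsilon_t)_{t\in\mathbb Z}$ be i.i.d. $N(0,\sigma_\epsilon^2)$. Let $\nu_t=\frac{\Theta(B)}{\Phi(B)}\epsilon_t$ be a covariance stationary ARMA process: $\Phi,\Theta$ are real polynomials, $\Phi(z)\neq0$ for $|z|=1$, $\nu$ is covariance stationary and $\Phi(B)\nu_t=\Theta(B)\epsilon_t$ almost surely for all $t$, where $B$ is the backward shift. Write $(1-z^{s_1})^{\mp d_1}(1-z^{s_2})^{\mp d_2}=\sum_{k\ge0}\psi^{\mp}_kz^k$ (product of binomial series). A process $X$ is a solution of $$X_t=(1-B^{s_1})^{-d_1}(1-B^{s_2})^{-d_2}\nu_t$$ if $X_t=\sum_{k\ge0}\psi^-_k\nu_{t-k}$ in mean square for every $t$. Put $\lambda_{ij}=2\pi j/s_i$ ($i=1,2$, $0\le j\le s_i/2$), let $\Lambda_i=\{\lambda_{ij}:0\le j\le s_i/2\}$ and $\Lambda=\Lambda_1\cup\Lambda_2\subset[0,\pi]$ (distinct frequencies). For $\lambda\in\Lambda$ let $\delta_\lambda=\sum_{i:\,\lambda\in\Lambda_i}d_i$,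 and let $d_\lambda=\delta_\lambda$ if $0<\lambda<\pi$, $d_\lambda=\delta_\lambda/2$ if $\lambda\in\{0,\pi\}$. Let $(d_{ij})$ be any array of real numbers with $\sum_{(i,j):\lambda_{ij}=\lambda}d_{ij}=d_\lambda$ for all $\lambda\in\Lambda$. (a) If $|d_1+d_2|<1/2$, $|d_1|<1/2$ and $|d_2|<1/2$, then a solution $X$ exists, and every solution is stationary (covariance stationary and strictly stationary) and invertible: $\nu_t=\sum_{k\ge0}\psi^+_kX_{t-k}$ in mean square for every $t$; and if moreover $\Theta(z)\ne0$ for $|z|\le1$, then $\epsilon_t=\sum_{k\ge0}c_kX_{t-k}$ in mean square for every $t$, where $\sum_kc_kz^k$ is the power series of $\Phi(z)\Theta(z)^{-1}(1-z^{s_1})^{d_1}(1-z^{s_2})^{d_2}$. (b) $\nu$ has the spectral density $\frac{\sigma_\epsilon^2}{2\pi}\left|\Theta(e^{-i\lambda})/\Phi(e^{-i\lambda})\right|^2$ on $(-\pi,\pi]$. If $f_\nu$ is a spectral density of $\nu$, then every solution $X$ has the spectral density $$f(\lambda)=f_\nu(\lambda)\prod_{i=1}^2\prod_{j=0}^{s_i/2}\left|2\sin\tfrac{\lambda-\lambda_{ij}}2\;2\sin\tfrac{\lambda+\lambda_{ij}}2\right|^{-2d_{ij}}=f_\nu(\lambda)\left|2\sin\tfrac{\lambda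 s_1}2\right|^{-2d_1}\left|2\sin\tfrac{\lambda s_2}2\right|^{-2d_2},$$ the two expressions being equal at every $\lambda$ with $\sin\frac{\lambda s_1}2\ne0\ne\sin\frac{\lambda s_2}2$. (c) Assume that $\Theta(z)\ne0$ for $|z|=1$ and that $\max_{\lambda\in\Lambda}d_\lambda>0$. Then for every solution $X$ the autocovariance $\gamma(h)=\mathbb E(X_hX_0)$ satisfies $$\gamma(h)=\sum_{\lambda\in\Lambda}a_\lambda\,h^{2\delta_\lambda-1}\bigl(\cos h\lambda+o(1)\bigr)\qquad(h\to\infty),$$ where $a_\lambda=a'_\lambda$ if $\lambda\in\{0,\pi\}$, $a_\lambda=2a'_\lambda$ if $0<\lambda<\pi$, $$a'_\lambda=\left|\frac{\Theta(e^{-i\lambda})}{\Phi(e^{-i\lambda})}\right|^2\frac{\sigma_\epsilon^2}{\pi}\,\Gamma(1-2\delta_\lambda)\sin(\delta_\lambda\pi)\,D_\lambda^2,$$ and $D_\lambda=|2\sin\lambda|^{-d_\lambda}\prod_{\mu\in\Lambda\setminus\{\lambda\}}|2(\cos\lambda-\cos\mu)|^{-d_\mu}$ if $0<\lambda<\pi$,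 $D_\lambda=\prod_{\mu\in\Lambda\setminus\{\lambda\}}|2(\cos\lambda-\cos\mu)|^{-d_\mu}$ if $\lambda\in\{0,\pi\}$. -/

import Mathlib

open MeasureTheory ProbabilityTheory Filter Topology

noncomputable section

namespace SeasonalFractional

/-! ### Processes -/

section Processes

variable {Ω : Type*} [MeasurableSpace Ω]

/-- A family of independent `N(0, v)` random variables indexed by `ℤ`. -/
structure IsGaussianNoise (P : Measure Ω) (v : NNReal) (e : ℤ → Ω → ℝ) : Prop where
  indep : iIndepFun e P
  law : ∀ t, HasLaw (e t) (gaussianReal 0 v) P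

/-- Covariance (weak) stationarity. -/
structure IsCovStationary (P : Measure Ω) (X : ℤ → Ω → ℝ) : Prop where
  memLp : ∀ t, MemLp (X t) 2 P
  mean_eq : ∀ t, ∫ ω, X t ω ∂P = ∫ ω, X 0 ω ∂P
  cov_eq : ∀ t h, covariance (X (t + h)) (X t) P = covariance (X h) (X 0) P

/-- Strict stationarity: the finite-dimensional distributions are invariant under time shifts. -/
def IsStrictlyStationary (P : Measure Ω) (X : ℤ → Ω → ℝ) : Prop :=
  ∀ (n : ℕ) (t : Fin n → ℤ) (h : ℤ),
    IdentDistrib (fun ω i => X (t i) ω) (fun ω i => X (t i + h) ω) P P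

/-- `(p(B) Y)_t = ∑ k, p_k Y_{t-k}` for a polynomial `p`. -/
def polyFilter (p : Polynomial ℝ) (Y : ℤ → Ω → ℝ) (t : ℤ) (ω : Ω) : ℝ :=
  ∑ k ∈ Finset.range (p.natDegree + 1), p.coeff k * Y (t - k) ω

/-- `ν` is a covariance stationary ARMA process `Φ(B) ν = Θ(B) e`, where `Φ` has no zero on the
unit circle. -/
structure IsStationaryARMA (P : Measure Ω) (Φ Θ : Polynomial ℝ) (e ν : ℤ → Ω → ℝ) : Prop where
  ar_ne_zero : ∀ z : ℂ, ‖z‖ = 1 → Polynomial.aeval z Φ ≠ 0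
  stationary : IsCovStationary P ν
  eqn : ∀ t, polyFilter Φ ν t =ᵐ[P] polyFilter Θ e t

/-- `X_t = ∑ k ≥ 0, c_k Y_{t-k}` for all `t`, the series converging in mean square, where `c_k`
are the coefficients of the power series `c`. In symbols, `X = c(B) Y`. -/
def IsFilterOutput (P : Measure Ω) (c : PowerSeries ℝ) (Y X : ℤ → Ω → ℝ) : Prop :=
  ∀ t : ℤ, MemLp (X t) 2 P ∧
    Tendsto (fun n : ℕ => eLpNorm
      (fun ω => X t ω - ∑ k ∈ Finset.range n, PowerSeries.coeff k c * Y (t - k) ω) 2 P)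
      atTop (𝓝 0)

/-- `f` is a spectral density of `X`: it is nonnegative and integrable on `(-π, π]`, and
`cov (X_{t+h}, X_t) = ∫_{-π}^{π} e^{ihx} f(x) dx`. -/
structure IsSpectralDensity (P : Measure Ω) (X : ℤ → Ω → ℝ) (f : ℝ → ℝ) : Prop where
  nonneg : ∀ᵐ x ∂(volume.restrict (Set.Ioc (-Real.pi) Real.pi)), 0 ≤ f x
  integrable : IntegrableOn f (Set.Ioc (-Real.pi) Real.pi)
  cov_eq : ∀ t h : ℤ, (covariance (X (t + h)) (X t) P : ℂ) =
    ∫ x in (-Real.pi)..Real.pi, Complex.exp (Complex.I * h * x) * f x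

end Processes

/-! ### The seasonal fractional filter -/

/-- Coefficient of `z ^ k` in the binomial series of `(1 - z) ^ d`. -/
def fracCoeff (d : ℝ) (k : ℕ) : ℝ :=
  ∏ j ∈ Finset.range k, ((j : ℝ) - d) / ((j : ℝ) + 1)

/-- The usual expression of the coefficients through the Gamma function. -/
theorem fracCoeff_eq_Gamma (d : ℝ) (hd : ∀ n : ℕ, d ≠ n) (k : ℕ) :
    fracCoeff d k = Real.Gamma (k - d) / (Real.Gamma (k + 1) * Real.Gamma (-d)) := by
  have h0 : Real.Gamma (-d) ≠ 0 :=
    Real.Gamma_ne_zero fun m h => hd m (by linarith)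
  induction k with
  | zero => simp [fracCoeff, h0]
  | succ k ih =>
    have h1 : (k : ℝ) - d ≠ 0 := fun h => hd k (by linarith)
    have h2 : (k : ℝ) + 1 ≠ 0 := by positivity
    have h3 : Real.Gamma ((k : ℝ) + 1) ≠ 0 := (Real.Gamma_pos_of_pos (by positivity)).ne'
    have e1 : Real.Gamma (((k + 1 : ℕ) : ℝ) - d) = (k - d) * Real.Gamma (k - d) := by
      rw [← Real.Gamma_add_one h1]; congr 1; push_cast; ring
    have e2 : Real.Gamma (((k + 1 : ℕ) : ℝ) + 1) = (k + 1) * Real.Gamma (k + 1) := by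
      rw [← Real.Gamma_add_one h2]; congr 1; push_cast; ring
    have e3 : fracCoeff d (k + 1) = fracCoeff d k * (((k : ℝ) - d) / ((k : ℝ) + 1)) := by
      rw [fracCoeff, Finset.prod_range_succ, ← fracCoeff]
    rw [e3, ih, e1, e2]
    field_simp

/-- The power series of `(1 - z ^ s) ^ d`, for `s ≥ 1`. -/
def seasonalSeries (s : ℕ) (d : ℝ) : PowerSeries ℝ :=
  PowerSeries.mk fun n => if s ∣ n then fracCoeff d (n / s) else 0

/-- The power series of `(1 - z ^ s₁) ^ d₁ * (1 - z ^ s₂) ^ d₂`. -/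
def nablaSeries (s : Fin 2 → ℕ) (d : Fin 2 → ℝ) : PowerSeries ℝ :=
  ∏ i, seasonalSeries (s i) (d i)

/-! ### Seasonal frequencies and memory parameters -/

/-- `freq s j = 2 π j / s`. -/
def freq (s j : ℕ) : ℝ := 2 * Real.pi * j / s

/-- The seasonal frequencies `2 π j / s`, `0 ≤ j ≤ s / 2`, of one period `s`. -/
def periodFreqs (s : ℕ) : Finset ℝ :=
  (Finset.range (s / 2 + 1)).image (freq s)

/-- The distinct seasonal frequencies of the two periods. -/
def seasonalFreqs (s : Fin 2 → ℕ) : Finset ℝ :=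
  Finset.univ.biUnion fun i => periodFreqs (s i)

/-- The sum of those `d i` for which `μ` is a seasonal frequency of the period `s i`. -/
def memoryOrder (s : Fin 2 → ℕ) (d : Fin 2 → ℝ) (μ : ℝ) : ℝ :=
  ∑ i, if μ ∈ periodFreqs (s i) then d i else 0

/-- The exponent `d_μ` of the factor `(1 - B e^{iμ})(1 - B e^{-iμ})` of
`(1 - B ^ s₁) ^ d₁ * (1 - B ^ s₂) ^ d₂`: at `μ = 0, π` the two factors coincide, and the exponent
is half of the memory order. -/
def memoryParam (s : Fin 2 → ℕ) (d : Fin 2 → ℝ) (μ : ℝ) : ℝ :=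
  if μ = 0 ∨ μ = Real.pi then memoryOrder s d μ / 2 else memoryOrder s d μ

/-- The array `D i j` of exponents attached to the frequencies `freq (s i) j`, `0 ≤ j ≤ s i / 2`,
splits the memory parameters: if `μ` is a frequency of one period only, the entry at `μ` is `d_μ`,
and if it is common to both periods, the two entries at `μ` sum to `d_μ`. -/
def IsMemoryArray (s : Fin 2 → ℕ) (d : Fin 2 → ℝ) (D : Fin 2 → ℕ → ℝ) : Prop :=
  ∀ μ ∈ seasonalFreqs s,
    (∑ i, ∑ j ∈ Finset.range (s i / 2 + 1), if freq (s i) j = μ then D i j else 0) =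
      memoryParam s d μ

/-! ### Spectral densities and asymptotic constants -/

/-- `|Θ(e^{-ix}) / Φ(e^{-ix})|²`. -/
def armaGain (Φ Θ : Polynomial ℝ) (x : ℝ) : ℝ :=
  ‖Polynomial.aeval (Complex.exp (-(Complex.I * x))) Θ /
    Polynomial.aeval (Complex.exp (-(Complex.I * x))) Φ‖ ^ 2

/-- `∏ i, |2 sin (x s_i / 2)| ^ (-2 d_i)`. -/
def sineFactor (s : Fin 2 → ℕ) (d : Fin 2 → ℝ) (x : ℝ) : ℝ :=
  ∏ i, |2 * Real.sin (x * s i / 2)| ^ (-2 * d i)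

/-- `∏ i, ∏ j, |2 sin ((x - λ_ij) / 2) * 2 sin ((x + λ_ij) / 2)| ^ (-2 D_ij)`. -/
def freqFactor (s : Fin 2 → ℕ) (D : Fin 2 → ℕ → ℝ) (x : ℝ) : ℝ :=
  ∏ i, ∏ j ∈ Finset.range (s i / 2 + 1),
    |(2 * Real.sin ((x - freq (s i) j) / 2)) * (2 * Real.sin ((x + freq (s i) j) / 2))| ^
      (-2 * D i j)

/-- The constant `D_μ`. -/
def asympD (s : Fin 2 → ℕ) (d : Fin 2 → ℝ) (μ : ℝ) : ℝ :=
  (if μ = 0 ∨ μ = Real.pi then 1 else |2 * Real.sin μ| ^ (-memoryParam s d μ)) *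
    ∏ κ ∈ (seasonalFreqs s).erase μ,
      |2 * (Real.cos μ - Real.cos κ)| ^ (-memoryParam s d κ)

/-- The constant `a_μ` (`v` is the variance of the innovations). -/
def asympCoeff (s : Fin 2 → ℕ) (d : Fin 2 → ℝ) (Φ Θ : Polynomial ℝ) (v : NNReal) (μ : ℝ) : ℝ :=
  (if μ = 0 ∨ μ = Real.pi then 1 else 2) *
    (armaGain Φ Θ μ * (v / Real.pi) * Real.Gamma (1 - 2 * memoryOrder s d μ) *
      Real.sin (memoryOrder s d μ * Real.pi) * asympD s d μ ^ 2)

end SeasonalFractional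

end

open SeasonalFractional

/-!
# Seasonal fractional ARMA processes with two periods

The whole argument takes place in the frequency domain. A white noise `e` of variance `v` defines a
linear map `U` from `L²` of the circle of frequencies to `L²(P)` with `U(e^{itx}) = e_t`, which is
`√v` times an isometry (`IsSpectralIsometry`). A process of the form `X_t = U(e^{itx} G(x))` is said
to have the transfer function `G` (`HasTransfer`). Such a process is stationary, in both senses,
with the spectral density `v / (2π) |G|²`, and `X = c(B) Y` in mean square if and only if the
partial sums of `c(e^{-ix})`, times the transfer function of `Y`, converge in `L²` of the circle to
the transfer function of `X`. A bounded solution of `Φ(B) D = 0` vanishes when `Φ` has no zero on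
the unit circle, so the ARMA process has the transfer function `Θ / Φ` at `z = e^{-ix}`.

*Existence and inversion.* The series of `(1 - z ^ s₁) ^ d₁ * (1 - z ^ s₂) ^ d₂` determines its
boundary function in `L²`, whatever the exponents are (`isBoundaryFunction_cseas_mul`): for
nonnegative exponents the series converges absolutely, and an exponent can be lowered by one because
division by `1 - z ^ s` is unique among sequences that tend to zero at `-∞`. Hence a solution can
only have the transfer function `(1 - z ^ s₁) ^ (-d₁) * (1 - z ^ s₂) ^ (-d₂) * Θ / Φ`, and it exists
if that function is reached in `L²`. Inversion is `tendsto_partialEval_inverse`; if the exponents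
have opposite signs, it combines dominated convergence for the unbounded factor with absolute
summability of the other one.

*Spectral densities.* The spectral density is unique almost everywhere, and the two expressions for
the spectral factor agree by the factorisation of `1 - z ^ s` over the roots of unity
(`freqFactor_eq_sineFactor`).

*Autocovariances.* The autocovariance is `v` times a Fourier coefficient of the squared modulus of
the transfer function, a function with finitely many power singularities on the circle. The
coefficients of a single singularity `|1 - e^{-ix}| ^ (-2δ)` satisfy a first order recursion and
start from a beta integral, so Euler's limit formula gives their asymptotics (`tendsto_singCoeff`).
A partition of unity by polynomials in `z` that vanish doubly at all singularities but one
separates the singularities (`tendsto_cf_prod_singularity_sub`); the cofactors have absolutely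
convergent Fourier series with weight `1 + |n|`, so they only contribute their value at the
singularity (`IsWeightedSeries.tendsto_cf_mul`). Integrability of the spectral density forces the
memory orders to be less than `1 / 2`.
-/

namespace SeasonalFractional

/-! ### Binomial coefficients of `(1 - z) ^ d` -/

section FracCoeff

variable {d : ℝ} {k n : ℕ}

@[simp]
theorem fracCoeff_zero (d : ℝ) : fracCoeff d 0 = 1 := by simp [fracCoeff]

theorem fracCoeff_succ (d : ℝ) (k : ℕ) :
    fracCoeff d (k + 1) = fracCoeff d k * (((k : ℝ) - d) / ((k : ℝ) + 1)) := by
  rw [fracCoeff, Finset.prod_range_succ, ← fracCoeff]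

theorem fracCoeff_add_one_succ (d : ℝ) (k : ℕ) :
    fracCoeff (d + 1) (k + 1) = -(d + 1) / (k + 1) * fracCoeff d k := by
  induction k with
  | zero => rw [fracCoeff_succ]; simp
  | succ k ih =>
    rw [fracCoeff_succ, ih, fracCoeff_succ d k]
    have h2 : (k : ℝ) + 1 ≠ 0 := by positivity
    have h3 : (k : ℝ) + 1 + 1 ≠ 0 := by positivity
    push_cast
    field_simp
    ring

theorem fracCoeff_add_one_succ' (d : ℝ) (k : ℕ) :
    fracCoeff (d + 1) (k + 1) = fracCoeff d (k + 1) - fracCoeff d k := by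
  rw [fracCoeff_add_one_succ, fracCoeff_succ]
  have h2 : (k : ℝ) + 1 ≠ 0 := by positivity
  field_simp
  ring

/-- The partial sums of the binomial series of `(1 - z) ^ (d + 1)` at `z = 1`. -/
theorem sum_fracCoeff_add_one (d : ℝ) (n : ℕ) :
    ∑ k ∈ Finset.range (n + 1), fracCoeff (d + 1) k = fracCoeff d n := by
  induction n with
  | zero => simp
  | succ n ih => rw [Finset.sum_range_succ, ih, fracCoeff_add_one_succ']; ring

/-- Telescoping form of the coefficients of `(1 - z) ^ (d + 1)`. -/
theorem abs_fracCoeff_add_one_succ (hd : -1 ≤ d) (hk : d ≤ k) :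
    |fracCoeff (d + 1) (k + 1)| = |fracCoeff d k| - |fracCoeff d (k + 1)| := by
  have hpos : (0 : ℝ) < (k : ℝ) + 1 := by positivity
  rw [fracCoeff_add_one_succ, fracCoeff_succ, abs_mul, abs_mul, abs_div, abs_div, abs_neg,
    abs_of_nonneg (by linarith : 0 ≤ d + 1), abs_of_nonneg (sub_nonneg.2 hk), abs_of_pos hpos]
  field_simp
  ring

theorem sum_abs_fracCoeff_le (hd : -1 ≤ d) {K : ℕ} (hK : d ≤ K) (n : ℕ) :
    ∑ k ∈ Finset.range n, |fracCoeff (d + 1) (k + K + 1)| ≤ |fracCoeff d K| := by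
  have h : ∀ n, ∑ k ∈ Finset.range n, |fracCoeff (d + 1) (k + K + 1)|
      = |fracCoeff d K| - |fracCoeff d (n + K)| := by
    intro n
    induction n with
    | zero => simp
    | succ n ih =>
      rw [Finset.sum_range_succ, ih, abs_fracCoeff_add_one_succ hd (by push_cast; linarith [n.cast_nonneg (α := ℝ)])]
      rw [show n + 1 + K = n + K + 1 by ring]; ring
  rw [h]
  linarith [abs_nonneg (fracCoeff d (n + K))]

/-- The binomial series of `(1 - z) ^ d`, `d ≥ 0`, converges absolutely on the closed disc. -/
theorem summable_abs_fracCoeff (hd : 0 ≤ d) : Summable fun k => |fracCoeff d k| := by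
  obtain ⟨K, hK⟩ := exists_nat_ge (d - 1)
  refine (summable_nat_add_iff (K + 1)).1 ?_
  refine summable_of_sum_range_le (c := |fracCoeff (d - 1) K|) (fun _ => abs_nonneg _) fun n => ?_
  have := sum_abs_fracCoeff_le (d := d - 1) (by linarith) hK n
  simpa [add_assoc] using this

theorem tsum_abs_fracCoeff_le (hd : -1 ≤ d) {K : ℕ} (hK : d ≤ K) :
    ∑' k, |fracCoeff (d + 1) (k + K + 1)| ≤ |fracCoeff d K| :=
  Real.tsum_le_of_sum_range_le (fun _ => abs_nonneg _) (sum_abs_fracCoeff_le hd hK)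

theorem fracCoeff_neg_nonneg {a : ℝ} (ha : 0 ≤ a) (k : ℕ) : 0 ≤ fracCoeff (-a) k := by
  refine Finset.prod_nonneg fun j _ => ?_
  have := j.cast_nonneg (α := ℝ)
  have : 0 ≤ (j : ℝ) - -a := by linarith
  positivity

/-- Growth of the partial sums of the binomial series of `(1 - z) ^ (-a)` at `z = 1`. -/
theorem fracCoeff_neg_sub_one_le {a : ℝ} (ha : 0 ≤ a) (hn : n ≠ 0) :
    fracCoeff (-a - 1) n ≤ Real.exp a * (n : ℝ) ^ a := by
  have hn' : (0 : ℝ) < n := by positivity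
  calc fracCoeff (-a - 1) n = ∏ j ∈ Finset.range n, ((j : ℝ) - (-a - 1)) / ((j : ℝ) + 1) := rfl
    _ ≤ ∏ j ∈ Finset.range n, Real.exp (a * ((j : ℝ) + 1)⁻¹) := by
        refine Finset.prod_le_prod (fun j _ => ?_) fun j _ => ?_
        · have := j.cast_nonneg (α := ℝ)
          have : 0 ≤ (j : ℝ) - (-a - 1) := by linarith
          positivity
        · refine le_trans (le_of_eq ?_) (Real.add_one_le_exp _)
          have : (j : ℝ) + 1 ≠ 0 := by positivity
          field_simp
          ring
    _ = Real.exp (a * (harmonic n : ℝ)) := by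
        rw [← Real.exp_sum, ← Finset.mul_sum, harmonic]
        push_cast
        rfl
    _ ≤ Real.exp (a * (1 + Real.log n)) :=
        Real.exp_le_exp.2 (mul_le_mul_of_nonneg_left (harmonic_le_one_add_log n) ha)
    _ = Real.exp a * (n : ℝ) ^ a := by
        rw [mul_add, mul_one, Real.exp_add, Real.rpow_def_of_pos hn', mul_comm a (Real.log n)]

theorem fracCoeff_neg_le {a : ℝ} (ha : 0 ≤ a) (hn : n ≠ 0) :
    fracCoeff (-a) n ≤ a * Real.exp a * (n : ℝ) ^ (a - 1) := by
  obtain ⟨m, rfl⟩ := Nat.exists_eq_succ_of_ne_zero hn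
  have hm : (0 : ℝ) < ((m + 1 : ℕ) : ℝ) := by positivity
  have h := fracCoeff_add_one_succ (-a - 1) m
  rw [sub_add_cancel] at h
  have h1 : fracCoeff (-a - 1) m ≤ fracCoeff (-a - 1) (m + 1) := by
    rw [fracCoeff_succ]
    refine le_mul_of_one_le_right ?_ ?_
    · have := fracCoeff_neg_nonneg (a := a + 1) (by linarith) m
      rwa [neg_add'] at this
    · rw [one_le_div (by positivity)]
      linarith
  rw [Nat.succ_eq_add_one, h, Real.rpow_sub_one hm.ne']
  have h2 := fracCoeff_neg_sub_one_le ha (Nat.succ_ne_zero m)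
  have : -(-a) / ((m : ℝ) + 1) * fracCoeff (-a - 1) m ≤
      a / ((m : ℝ) + 1) * (Real.exp a * ((m + 1 : ℕ) : ℝ) ^ a) := by
    rw [neg_neg]
    gcongr
    exact h1.trans h2
  refine this.trans (le_of_eq ?_)
  push_cast
  ring

theorem tendsto_fracCoeff_neg {a : ℝ} (ha : 0 ≤ a) (ha1 : a < 1) :
    Tendsto (fracCoeff (-a)) atTop (𝓝 0) := by
  have h : Tendsto (fun n : ℕ => a * Real.exp a * (n : ℝ) ^ (-(1 - a))) atTop (𝓝 0) := by
    simpa using ((tendsto_rpow_neg_atTop (by linarith : 0 < 1 - a)).comp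
      tendsto_natCast_atTop_atTop).const_mul (a * Real.exp a)
  refine tendsto_of_tendsto_of_tendsto_of_le_of_le' tendsto_const_nhds h
    (Eventually.of_forall fun n => fracCoeff_neg_nonneg ha n) ?_
  filter_upwards [eventually_ne_atTop 0] with n hn
  simpa using fracCoeff_neg_le ha hn

theorem fracCoeff_eq_choose (d : ℝ) (k : ℕ) : fracCoeff d k = (-1) ^ k * Ring.choose d k := by
  induction k with
  | zero => simp
  | succ k ih =>
    rw [fracCoeff_succ, ih, Ring.choose_eq_smul, Ring.choose_eq_smul,
      descPochhammer_succ_right, Polynomial.smeval_mul, Nat.factorial_succ]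
    have h1 : (k : ℝ) + 1 ≠ 0 := by positivity
    have h2 : (k.factorial : ℝ) ≠ 0 := by positivity
    simp [Polynomial.smeval_natCast]
    field_simp
    ring

/-- Newton's binomial theorem in the open disc. -/
theorem hasSum_fracCoeff_mul_pow (d : ℝ) {w : ℂ} (hw : ‖w‖ < 1) :
    HasSum (fun k : ℕ => (fracCoeff d k : ℂ) * w ^ k) ((1 - w) ^ (d : ℂ)) := by
  have hmem : -w ∈ Metric.eball (0 : ℂ) 1 := by
    rw [Metric.mem_eball, edist_zero_right, enorm_neg, ← ofReal_norm]
    exact ENNReal.ofReal_lt_one.2 hw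
  have h := (Complex.one_add_cpow_hasFPowerSeriesOnBall_zero (a := (d : ℂ))).hasSum hmem
  have e : (fun k : ℕ => (fracCoeff d k : ℂ) * w ^ k) =
      fun k => binomialSeries ℂ (d : ℂ) k fun _ => -w := by
    funext k
    rw [fracCoeff_eq_choose, binomialSeries_apply, List.ofFn_const, List.prod_replicate, neg_pow w]
    push_cast
    rw [smul_eq_mul]
    ring
  rw [e, sub_eq_add_neg]
  simpa only [zero_add] using h

end FracCoeff

/-! ### Boundary values of binomial series -/

section Boundary

theorem one_sub_mem_slitPlane {w : ℂ} (hw : ‖w‖ ≤ 1) (hw1 : w ≠ 1) : 1 - w ∈ Complex.slitPlane := by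
  refine Or.inl ?_
  rw [Complex.sub_re, Complex.one_re, sub_pos]
  refine lt_of_le_of_ne ((Complex.re_le_norm w).trans hw) fun h => hw1 ?_
  have h1 : ‖w‖ ^ 2 ≤ 1 := by nlinarith [norm_nonneg w]
  rw [Complex.sq_norm, Complex.normSq_apply, h] at h1
  have h2 : w.im = 0 := by nlinarith
  exact Complex.ext (by simpa using h) (by simpa using h2)

/-- Newton's binomial theorem on the boundary of the disc, for a nonnegative exponent. -/
theorem hasSum_fracCoeff_mul_pow_boundary {d : ℝ} (hd : 0 ≤ d) {w : ℂ} (hw : ‖w‖ ≤ 1)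
    (hw1 : w ≠ 1) :
    HasSum (fun k : ℕ => (fracCoeff d k : ℂ) * w ^ k) ((1 - w) ^ (d : ℂ)) := by
  have hs := summable_abs_fracCoeff hd
  have hb : ∀ r : ℝ, r ∈ Set.Icc (0 : ℝ) 1 → ∀ k : ℕ,
      ‖(fracCoeff d k : ℂ) * (r * w) ^ k‖ ≤ |fracCoeff d k| := by
    intro r hr k
    rw [norm_mul, Complex.norm_real, Real.norm_eq_abs, norm_pow, norm_mul, Complex.norm_real,
      Real.norm_eq_abs, abs_of_nonneg hr.1]
    exact mul_le_of_le_one_right (abs_nonneg _)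
      (pow_le_one₀ (by have := hr.1; positivity) (mul_le_one₀ hr.2 (norm_nonneg _) hw))
  have hsum : Summable (fun k : ℕ => (fracCoeff d k : ℂ) * w ^ k) :=
    Summable.of_norm_bounded hs fun k => by simpa using hb 1 ⟨zero_le_one, le_rfl⟩ k
  have hIco : ∀ᶠ r : ℝ in 𝓝[<] 1, r ∈ Set.Ico (0 : ℝ) 1 :=
    Ico_mem_nhdsLT zero_lt_one
  have hlim1 : Tendsto (fun r : ℝ => ∑' k : ℕ, (fracCoeff d k : ℂ) * (r * w) ^ k) (𝓝[<] 1)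
      (𝓝 (∑' k : ℕ, (fracCoeff d k : ℂ) * w ^ k)) := by
    refine tendsto_tsum_of_dominated_convergence hs (fun k => ?_) ?_
    · have : Continuous fun r : ℝ => (fracCoeff d k : ℂ) * (r * w) ^ k := by fun_prop
      simpa using (this.tendsto 1).mono_left nhdsWithin_le_nhds
    · filter_upwards [hIco] with r hr k using hb r ⟨hr.1, hr.2.le⟩ k
  have hlim2 : Tendsto (fun r : ℝ => ∑' k : ℕ, (fracCoeff d k : ℂ) * (r * w) ^ k) (𝓝[<] 1)
      (𝓝 ((1 - w) ^ (d : ℂ))) := by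
    have hc : ContinuousAt (fun r : ℝ => (1 - (r : ℂ) * w) ^ (d : ℂ)) 1 := by
      refine ContinuousAt.cpow (by fun_prop) continuousAt_const ?_
      simpa using one_sub_mem_slitPlane hw hw1
    have h := hc.tendsto.mono_left (nhdsWithin_le_nhds (s := Set.Iio 1))
    simp only [Complex.ofReal_one, one_mul] at h
    refine h.congr' ?_
    filter_upwards [hIco] with r hr
    refine (hasSum_fracCoeff_mul_pow d ?_).tsum_eq.symm
    rw [norm_mul, Complex.norm_real, Real.norm_eq_abs, abs_of_nonneg hr.1]
    calc r * ‖w‖ ≤ r * 1 := mul_le_mul_of_nonneg_left hw hr.1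
      _ < 1 := by linarith [hr.2]
  exact (tendsto_nhds_unique hlim1 hlim2) ▸ hsum.hasSum

theorem one_sub_mul_sum_fracCoeff (d : ℝ) (w : ℂ) (n : ℕ) :
    (1 - w) * ∑ k ∈ Finset.range (n + 1), (fracCoeff d k : ℂ) * w ^ k =
      ∑ k ∈ Finset.range (n + 1), (fracCoeff (d + 1) k : ℂ) * w ^ k -
        fracCoeff d n * w ^ (n + 1) := by
  induction n with
  | zero => simp
  | succ n ih =>
    rw [Finset.sum_range_succ, mul_add, ih, Finset.sum_range_succ _ (n + 1),
      fracCoeff_add_one_succ']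
    push_cast
    ring

variable {a : ℝ} {w : ℂ}

theorem cpow_one_sub_eq (hw1 : w ≠ 1) (d : ℝ) :
    (1 - w) ^ ((d + 1 : ℝ) : ℂ) = (1 - w) * (1 - w) ^ (d : ℂ) := by
  have h0 : 1 - w ≠ 0 := sub_ne_zero.2 (Ne.symm hw1)
  push_cast
  rw [Complex.cpow_add _ _ h0, Complex.cpow_one, mul_comm]

/-- The binomial series of `(1 - w) ^ (-a)`, `0 ≤ a < 1`, converges on the unit circle except at
`w = 1`. -/
theorem tendsto_sum_fracCoeff_neg (ha : 0 ≤ a) (ha1 : a < 1) (hw : ‖w‖ ≤ 1) (hw1 : w ≠ 1) :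
    Tendsto (fun n => ∑ k ∈ Finset.range n, (fracCoeff (-a) k : ℂ) * w ^ k) atTop
      (𝓝 ((1 - w) ^ ((-a : ℝ) : ℂ))) := by
  have h0 : 1 - w ≠ 0 := sub_ne_zero.2 (Ne.symm hw1)
  refine (tendsto_add_atTop_iff_nat 1).1 ?_
  have h1 := ((hasSum_fracCoeff_mul_pow_boundary (d := -a + 1) (by linarith) hw
    hw1).tendsto_sum_nat).comp (tendsto_add_atTop_nat 1)
  have h2 : Tendsto (fun n : ℕ => (fracCoeff (-a) n : ℂ) * w ^ (n + 1)) atTop (𝓝 0) := by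
    refine squeeze_zero_norm (fun n => ?_) (tendsto_fracCoeff_neg ha ha1)
    rw [norm_mul, Complex.norm_real, Real.norm_of_nonneg (fracCoeff_neg_nonneg ha n), norm_pow]
    exact mul_le_of_le_one_right (fracCoeff_neg_nonneg ha n) (pow_le_one₀ (norm_nonneg _) hw)
  have h3 := (h1.sub h2).const_mul (1 - w)⁻¹
  rw [sub_zero, cpow_one_sub_eq hw1, inv_mul_cancel_left₀ h0] at h3
  refine h3.congr fun n => ?_
  simp only [Function.comp_apply]
  rw [← one_sub_mul_sum_fracCoeff, inv_mul_cancel_left₀ h0]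

/-- The partial sums of the binomial series of `(1 - w) ^ (-a)`, `0 ≤ a < 1`, are bounded by a
multiple of the modulus of its sum, uniformly on the unit circle. -/
theorem exists_norm_sum_fracCoeff_neg_le (ha : 0 ≤ a) (ha1 : a < 1) :
    ∃ C : ℝ, 0 ≤ C ∧ ∀ w : ℂ, ‖w‖ = 1 → w ≠ 1 → ∀ n : ℕ,
      ‖∑ k ∈ Finset.range n, (fracCoeff (-a) k : ℂ) * w ^ k‖ ≤ C * ‖1 - w‖ ^ (-a) := by
  refine ⟨Real.exp a * 3 ^ a + (1 + 2 * (a * Real.exp a)), by positivity, fun w hw hw1 n => ?_⟩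
  have h0 : 1 - w ≠ 0 := sub_ne_zero.2 (Ne.symm hw1)
  set ρ := ‖1 - w‖ with hρ
  have hρ0 : 0 < ρ := norm_pos_iff.2 h0
  have hρ2 : ρ ≤ 2 := by
    refine (norm_sub_le _ _).trans ?_
    rw [hw, norm_one]; norm_num
  have hpow : 0 < ρ ^ (-a) := Real.rpow_pos_of_pos hρ0 _
  have hterm : ∀ k, ‖(fracCoeff (-a) k : ℂ) * w ^ k‖ = fracCoeff (-a) k := fun k => by
    rw [norm_mul, Complex.norm_real, Real.norm_of_nonneg (fracCoeff_neg_nonneg ha k), norm_pow, hw,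
      one_pow, mul_one]
  have hE := Real.exp_pos a
  have h3 : (0 : ℝ) < 3 ^ a := by positivity
  cases n with
  | zero =>
    rw [Finset.sum_range_zero, norm_zero]; positivity
  | succ m =>
  rcases Nat.eq_zero_or_pos m with rfl | hm
  · -- a single term: `1 ≤ 3 ^ a * ρ ^ (-a)`
    have h1 : ρ ^ a ≤ 3 ^ a := Real.rpow_le_rpow hρ0.le (by linarith) ha
    have h2 : (1 : ℝ) ≤ 3 ^ a * ρ ^ (-a) := by
      rw [Real.rpow_neg hρ0.le, ← div_eq_mul_inv, one_le_div (by positivity)]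
      exact h1
    have h3 : (1 : ℝ) ≤ Real.exp a := Real.one_le_exp ha
    rw [zero_add, Finset.sum_range_one, hterm, fracCoeff_zero]
    calc (1 : ℝ) ≤ 3 ^ a * ρ ^ (-a) := h2
      _ ≤ Real.exp a * (3 ^ a * ρ ^ (-a)) := le_mul_of_one_le_left (by positivity) h3
      _ ≤ _ := by nlinarith [mul_nonneg (mul_nonneg ha hE.le) hpow.le]
  have hm0 : (0 : ℝ) < m := by exact_mod_cast hm
  rcases le_or_gt ((m : ℝ) * ρ) 1 with hmρ | hmρ
  · -- few terms: sum the moduli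
    have h1 : ‖∑ k ∈ Finset.range (m + 1), (fracCoeff (-a) k : ℂ) * w ^ k‖ ≤
        fracCoeff (-a - 1) m := by
      refine (norm_sum_le _ _).trans (le_of_eq ?_)
      rw [← sum_fracCoeff_add_one, sub_add_cancel]
      exact Finset.sum_congr rfl fun k _ => hterm k
    have h2 : (m : ℝ) ^ a ≤ ρ ^ (-a) := by
      rw [Real.rpow_neg hρ0.le, ← Real.inv_rpow hρ0.le]
      refine Real.rpow_le_rpow hm0.le ?_ ha
      rw [← one_div, le_div_iff₀ hρ0]; exact hmρ
    have h4 : (1 : ℝ) ≤ 3 ^ a := Real.one_le_rpow (by norm_num) ha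
    refine h1.trans ((fracCoeff_neg_sub_one_le ha hm.ne').trans ?_)
    calc Real.exp a * (m : ℝ) ^ a ≤ Real.exp a * ρ ^ (-a) := by gcongr
      _ ≤ (Real.exp a * 3 ^ a) * ρ ^ (-a) := by
          gcongr; exact le_mul_of_one_le_right hE.le h4
      _ ≤ _ := by nlinarith [mul_nonneg (mul_nonneg ha hE.le) hpow.le]
  · -- many terms: compare with the absolutely convergent series of `(1 - w) ^ (1 - a)`
    have hb : fracCoeff (-a) m ≤ a * Real.exp a * ρ ^ (1 - a) := by
      refine (fracCoeff_neg_le ha hm.ne').trans ?_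
      refine mul_le_mul_of_nonneg_left ?_ (by positivity)
      rw [show a - 1 = -(1 - a) by ring, Real.rpow_neg hm0.le, ← Real.inv_rpow hm0.le]
      refine Real.rpow_le_rpow (by positivity) ?_ (by linarith)
      rw [← one_div, div_le_iff₀ hm0, mul_comm]; exact hmρ.le
    have hS := hasSum_fracCoeff_mul_pow_boundary (d := -a + 1) (by linarith) hw.le hw1
    have htail : ‖∑ k ∈ Finset.range (m + 1), (fracCoeff (-a + 1) k : ℂ) * w ^ k -
        (1 - w) ^ ((-a + 1 : ℝ) : ℂ)‖ ≤ fracCoeff (-a) m := by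
      rw [norm_sub_rev, ← hS.tsum_eq, ← hS.summable.sum_add_tsum_nat_add (m + 1), add_sub_cancel_left]
      have hsum := (summable_nat_add_iff (m + 1)).2 (summable_abs_fracCoeff
        (by linarith : (0 : ℝ) ≤ -a + 1))
      have h := tsum_abs_fracCoeff_le (d := -a) (K := m) (by linarith) (by linarith)
      rw [abs_of_nonneg (fracCoeff_neg_nonneg ha m)] at h
      refine (tsum_of_norm_bounded hsum.hasSum fun k => ?_).trans (by simpa [add_assoc] using h)
      rw [norm_mul, Complex.norm_real, Real.norm_eq_abs, norm_pow, hw, one_pow, mul_one]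
    have hmain : ρ * ‖∑ k ∈ Finset.range (m + 1), (fracCoeff (-a) k : ℂ) * w ^ k‖ ≤
        ρ ^ (1 - a) + 2 * (a * Real.exp a * ρ ^ (1 - a)) := by
      rw [hρ, ← norm_mul, one_sub_mul_sum_fracCoeff]
      have e1 : ‖(1 - w) ^ ((-a + 1 : ℝ) : ℂ)‖ = ρ ^ (1 - a) := by
        rw [Complex.norm_cpow_real, neg_add_eq_sub]
      have e2 : ‖(fracCoeff (-a) m : ℂ) * w ^ (m + 1)‖ = fracCoeff (-a) m := by
        rw [norm_mul, Complex.norm_real, Real.norm_of_nonneg (fracCoeff_neg_nonneg ha m), norm_pow,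
          hw, one_pow, mul_one]
      refine (norm_sub_le _ _).trans ?_
      rw [e2]
      have e3 := norm_le_norm_add_norm_sub' (∑ k ∈ Finset.range (m + 1),
        (fracCoeff (-a + 1) k : ℂ) * w ^ k) ((1 - w) ^ ((-a + 1 : ℝ) : ℂ))
      rw [e1] at e3
      linarith
    have e4 : ρ ^ (1 - a) = ρ * ρ ^ (-a) := by
      rw [sub_eq_add_neg, Real.rpow_add hρ0, Real.rpow_one]
    rw [e4] at hmain
    have h5 : ‖∑ k ∈ Finset.range (m + 1), (fracCoeff (-a) k : ℂ) * w ^ k‖ ≤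
        (1 + 2 * (a * Real.exp a)) * ρ ^ (-a) := by
      refine le_of_mul_le_mul_left ?_ hρ0
      refine hmain.trans (le_of_eq ?_)
      ring
    refine h5.trans ?_
    refine mul_le_mul_of_nonneg_right ?_ hpow.le
    linarith [mul_pos hE h3]

end Boundary

/-! ### Absolutely summable power series on the closed disc -/

section AbsSummable

open PowerSeries

/-- The coefficients of the power series are absolutely summable. -/
def AbsSummable (c : PowerSeries ℂ) : Prop :=
  Summable fun k => ‖coeff k c‖

/-- The sum of a power series at a point. -/
noncomputable def seriesEval (c : PowerSeries ℂ) (w : ℂ) : ℂ :=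
  ∑' k, coeff k c * w ^ k

/-- The partial sums of a power series at a point. -/
noncomputable def partialEval (c : PowerSeries ℂ) (n : ℕ) (w : ℂ) : ℂ :=
  ∑ k ∈ Finset.range n, coeff k c * w ^ k

variable {c c' : PowerSeries ℂ} {w : ℂ}

theorem AbsSummable.summable_norm (hc : AbsSummable c) (hw : ‖w‖ ≤ 1) :
    Summable fun k => ‖coeff k c * w ^ k‖ := by
  refine Summable.of_nonneg_of_le (fun _ => norm_nonneg _) (fun k => ?_) hc
  rw [norm_mul, norm_pow]
  exact mul_le_of_le_one_right (norm_nonneg _) (pow_le_one₀ (norm_nonneg _) hw)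

theorem AbsSummable.hasSum (hc : AbsSummable c) (hw : ‖w‖ ≤ 1) :
    HasSum (fun k => coeff k c * w ^ k) (seriesEval c w) :=
  (hc.summable_norm hw).of_norm.hasSum

theorem AbsSummable.mul (hc : AbsSummable c) (hc' : AbsSummable c') : AbsSummable (c * c') := by
  have h := summable_norm_sum_mul_antidiagonal_of_summable_norm hc hc'
  simpa only [AbsSummable, coeff_mul] using h

theorem seriesEval_mul (hc : AbsSummable c) (hc' : AbsSummable c') (hw : ‖w‖ ≤ 1) :
    seriesEval (c * c') w = seriesEval c w * seriesEval c' w := by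
  rw [seriesEval, seriesEval, seriesEval, tsum_mul_tsum_eq_tsum_sum_antidiagonal_of_summable_norm
    (hc.summable_norm hw) (hc'.summable_norm hw)]
  refine tsum_congr fun n => ?_
  rw [coeff_mul, Finset.sum_mul]
  refine Finset.sum_congr rfl fun p hp => ?_
  rw [← Finset.HasAntidiagonal.mem_antidiagonal.1 hp, pow_add]
  ring

theorem absSummable_polynomial (p : Polynomial ℂ) : AbsSummable (p : PowerSeries ℂ) := by
  refine summable_of_ne_finset_zero (s := p.support) fun k hk => ?_
  rw [Polynomial.coeff_coe, Polynomial.notMem_support_iff.1 hk, norm_zero]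

theorem seriesEval_polynomial (p : Polynomial ℂ) (w : ℂ) :
    seriesEval (p : PowerSeries ℂ) w = p.eval w := by
  rw [seriesEval, Polynomial.eval_eq_sum, Polynomial.sum]
  simp only [Polynomial.coeff_coe]
  refine tsum_eq_sum fun k hk => ?_
  rw [Polynomial.notMem_support_iff.1 hk, zero_mul]

theorem absSummable_inv_X_sub_C {r : ℂ} (hr : 1 < ‖r‖) :
    AbsSummable (((Polynomial.X - Polynomial.C r : Polynomial ℂ) : PowerSeries ℂ)⁻¹) := by
  have hr0 : r ≠ 0 := norm_pos_iff.1 (by linarith)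
  have h : ((Polynomial.X - Polynomial.C r : Polynomial ℂ) : PowerSeries ℂ)⁻¹ =
      PowerSeries.mk fun k => -(r⁻¹) ^ (k + 1) := by
    rw [PowerSeries.inv_eq_iff_mul_eq_one (by simp [hr0])]
    ext k
    rw [Polynomial.coe_sub, Polynomial.coe_X, Polynomial.coe_C, mul_sub, map_sub,
      PowerSeries.coeff_mul_C]
    cases k with
    | zero => simp [hr0]
    | succ k =>
      rw [PowerSeries.coeff_succ_mul_X]
      simp [pow_succ, hr0]
      ring
  rw [AbsSummable, h]
  have hs : Summable fun k : ℕ => ‖r⁻¹‖ * ‖r⁻¹‖ ^ k :=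
    (summable_geometric_of_lt_one (norm_nonneg _) (by
      rw [norm_inv]; exact inv_lt_one_of_one_lt₀ hr)).mul_left _
  refine hs.congr fun k => ?_
  rw [coeff_mk, norm_neg, norm_pow, pow_succ']

/-- The inverse of a polynomial without zeros in the closed unit disc has absolutely summable
coefficients. -/
theorem absSummable_inv_polynomial (p : Polynomial ℂ) (hp : ∀ z : ℂ, ‖z‖ ≤ 1 → p.eval z ≠ 0) :
    AbsSummable ((p : PowerSeries ℂ)⁻¹) := by
  induction hn : p.natDegree generalizing p with
  | zero =>
    have h0 : p.coeff 0 ≠ 0 := by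
      rw [Polynomial.coeff_zero_eq_eval_zero]
      exact hp 0 (by simp)
    have h : (p : PowerSeries ℂ)⁻¹ = ((Polynomial.C (p.coeff 0)⁻¹ : Polynomial ℂ) :
        PowerSeries ℂ) := by
      rw [PowerSeries.inv_eq_iff_mul_eq_one (by simpa using h0)]
      nth_rw 2 [Polynomial.eq_C_of_natDegree_eq_zero hn]
      rw [← Polynomial.coe_mul, ← Polynomial.C_mul, inv_mul_cancel₀ h0, Polynomial.C_1,
        Polynomial.coe_one]
    rw [h]
    exact absSummable_polynomial _
  | succ n ih =>
    have hdeg : p.degree ≠ 0 := by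
      intro h
      rw [Polynomial.natDegree_eq_of_degree_eq_some (n := 0) (by simpa using h)] at hn
      omega
    obtain ⟨r, hr⟩ := IsAlgClosed.exists_root p hdeg
    obtain ⟨q, rfl⟩ := Polynomial.dvd_iff_isRoot.2 hr
    have hr1 : 1 < ‖r‖ := by
      by_contra h
      exact hp r (not_lt.1 h) hr
    have hq : q ≠ 0 := by rintro rfl; simp at hn
    rw [Polynomial.coe_mul, PowerSeries.mul_inv_rev]
    refine (ih q (fun z hz h => hp z hz ?_) ?_).mul (absSummable_inv_X_sub_C hr1)
    · rw [Polynomial.eval_mul, h, mul_zero]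
    · rw [Polynomial.natDegree_mul (Polynomial.X_sub_C_ne_zero r) hq,
        Polynomial.natDegree_X_sub_C] at hn
      omega

end AbsSummable

/-! ### The seasonal series -/

section Seasonal

open PowerSeries

/-- The power series of `(1 - z ^ s) ^ d` with complex coefficients. -/
noncomputable def cseas (s : ℕ) (d : ℝ) : PowerSeries ℂ :=
  PowerSeries.map Complex.ofRealHom (seasonalSeries s d)

theorem coeff_cseas (s : ℕ) (d : ℝ) (k : ℕ) :
    coeff k (cseas s d) = if s ∣ k then (fracCoeff d (k / s) : ℂ) else 0 := by
  rw [cseas, coeff_map, seasonalSeries, coeff_mk]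
  split_ifs <;> simp

theorem cseas_add_one {s : ℕ} (hs : 0 < s) (d : ℝ) :
    cseas s (d + 1) = (1 - (X : PowerSeries ℂ) ^ s) * cseas s d := by
  ext k
  rw [sub_mul, one_mul, map_sub, PowerSeries.coeff_X_pow_mul']
  simp only [coeff_cseas]
  by_cases hk : s ∣ k
  · obtain ⟨m, rfl⟩ := hk
    cases m with
    | zero => simp [hs.ne']
    | succ m =>
      have h1 : s ≤ s * (m + 1) := Nat.le_mul_of_pos_right s (Nat.succ_pos m)
      have h2 : s * (m + 1) - s = s * m := by rw [mul_add, mul_one, Nat.add_sub_cancel]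
      rw [if_pos (dvd_mul_right _ _), if_pos h1, h2, if_pos (dvd_mul_right _ _),
        if_pos (dvd_mul_right _ _), Nat.mul_div_cancel_left _ hs, Nat.mul_div_cancel_left _ hs,
        fracCoeff_add_one_succ']
      push_cast
      rfl
  · rw [if_neg hk, if_neg hk]
    by_cases h : s ≤ k
    · have : ¬ s ∣ k - s := fun h' => hk (by
        have := dvd_add h' (dvd_refl s)
        rwa [Nat.sub_add_cancel h] at this)
      rw [if_pos h, if_neg this, sub_zero]
    · rw [if_neg h, sub_zero]

theorem hasSum_cseas_iff {s : ℕ} (hs : 0 < s) {f : ℕ → ℂ} {A : ℂ} :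
    HasSum (fun k => if s ∣ k then f (k / s) else 0) A ↔ HasSum f A := by
  have hinj : Function.Injective fun m : ℕ => s * m := fun a b h => Nat.eq_of_mul_eq_mul_left hs h
  rw [← hinj.hasSum_iff]
  · have : ((fun k => if s ∣ k then f (k / s) else 0) ∘ fun m => s * m) = f := by
      funext m
      simp [Nat.mul_div_cancel_left _ hs]
    rw [this]
  · intro k hk
    rw [if_neg]
    rintro ⟨m, rfl⟩
    exact hk ⟨m, rfl⟩

theorem absSummable_cseas {s : ℕ} (hs : 0 < s) {d : ℝ} (hd : 0 ≤ d) : AbsSummable (cseas s d) := by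
  have hinj : Function.Injective fun m : ℕ => s * m := fun a b h => Nat.eq_of_mul_eq_mul_left hs h
  rw [AbsSummable, ← hinj.summable_iff]
  · refine (summable_abs_fracCoeff hd).congr fun m => ?_
    simp [coeff_cseas, Nat.mul_div_cancel_left _ hs]
  · intro k hk
    rw [coeff_cseas, if_neg, norm_zero]
    rintro ⟨m, rfl⟩
    exact hk ⟨m, rfl⟩

theorem seriesEval_cseas {s : ℕ} (hs : 0 < s) {d : ℝ} (hd : 0 ≤ d) {w : ℂ} (hw : ‖w‖ ≤ 1)
    (hw1 : w ^ s ≠ 1) : seriesEval (cseas s d) w = (1 - w ^ s) ^ (d : ℂ) := by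
  have h := hasSum_fracCoeff_mul_pow_boundary hd (w := w ^ s)
    (by rw [norm_pow]; exact pow_le_one₀ (norm_nonneg _) hw) hw1
  rw [← hasSum_cseas_iff hs] at h
  refine (tsum_congr fun k => ?_).trans h.tsum_eq
  rw [coeff_cseas]
  split_ifs with hk
  · rw [← pow_mul, Nat.mul_div_cancel' hk]
  · rw [zero_mul]

theorem partialEval_cseas {s : ℕ} (hs : 0 < s) (d : ℝ) (n : ℕ) (w : ℂ) :
    partialEval (cseas s d) n w =
      ∑ k ∈ Finset.range ((n + s - 1) / s), (fracCoeff d k : ℂ) * (w ^ s) ^ k := by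
  have himg : (Finset.range n).filter (s ∣ ·) =
      (Finset.range ((n + s - 1) / s)).image (s * ·) := by
    ext k
    simp only [Finset.mem_filter, Finset.mem_range, Finset.mem_image]
    have key : ∀ m, m < (n + s - 1) / s ↔ s * m < n := fun m => by
      rw [← Nat.succ_le_iff, Nat.le_div_iff_mul_le hs, Nat.succ_mul, mul_comm]
      omega
    constructor
    · rintro ⟨hk, m, rfl⟩
      exact ⟨m, (key m).2 hk, rfl⟩
    · rintro ⟨m, hm, rfl⟩
      exact ⟨(key m).1 hm, dvd_mul_right _ _⟩
  have h : partialEval (cseas s d) n w =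
      ∑ k ∈ (Finset.range n).filter (s ∣ ·), (fracCoeff d (k / s) : ℂ) * w ^ k := by
    rw [partialEval, Finset.sum_filter]
    refine Finset.sum_congr rfl fun k _ => ?_
    rw [coeff_cseas]
    split_ifs <;> simp
  rw [h, himg, Finset.sum_image fun a _ b _ h => Nat.eq_of_mul_eq_mul_left hs h]
  refine Finset.sum_congr rfl fun k _ => ?_
  rw [Nat.mul_div_cancel_left _ hs, pow_mul]

end Seasonal

/-! ### Fourier coefficients of square-integrable functions on the circle -/

section Circle

/-- The circle `ℝ / 2πℤ` of frequencies. -/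
abbrev Circ := AddCircle (2 * Real.pi)

instance fact_two_pi_pos : Fact (0 < 2 * Real.pi) := ⟨Real.two_pi_pos⟩

/-- The Haar probability measure on the circle of frequencies. -/
noncomputable abbrev haarC : Measure Circ := AddCircle.haarAddCircle

/-- The function `x ↦ e^{-ix}` on the circle of frequencies, the symbol of the backward shift. -/
noncomputable def zed (x : Circ) : ℂ := fourier (-1) x

theorem norm_fourier_apply (k : ℤ) (x : Circ) : ‖(fourier k x : ℂ)‖ = 1 :=
  Circle.norm_coe _

theorem norm_zed (x : Circ) : ‖zed x‖ = 1 := norm_fourier_apply _ _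

theorem zed_pow (x : Circ) (k : ℕ) : zed x ^ k = fourier (-(k : ℤ)) x := by
  induction k with
  | zero => rw [pow_zero, Nat.cast_zero, neg_zero, fourier_zero]
  | succ k ih => rw [pow_succ, ih, zed, ← fourier_add]; congr 2; push_cast; ring

theorem zed_coe (x : ℝ) : zed (x : Circ) = Complex.exp (-(Complex.I * x)) := by
  rw [zed, fourier_coe_apply]
  congr 1
  have : (Real.pi : ℂ) ≠ 0 := by exact_mod_cast Real.pi_ne_zero
  push_cast
  field_simp

theorem fourier_coe_exp (k : ℤ) (x : ℝ) :
    (fourier k (x : Circ) : ℂ) = Complex.exp (Complex.I * k * x) := by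
  rw [fourier_coe_apply]
  congr 1
  have : (Real.pi : ℂ) ≠ 0 := by exact_mod_cast Real.pi_ne_zero
  push_cast
  field_simp

theorem continuous_zed : Continuous zed := (fourier (-1)).continuous

theorem measurable_zed : Measurable zed := continuous_zed.measurable

theorem measurable_fourier (k : ℤ) : Measurable fun x : Circ => (fourier k x : ℂ) :=
  (fourier k).continuous.measurable

theorem zed_eq_one_iff {x : Circ} : zed x = 1 ↔ x = 0 := by
  rw [zed, fourier_apply, neg_one_zsmul]
  constructor
  · intro h
    have h1 : AddCircle.toCircle (-x) = AddCircle.toCircle (0 : Circ) := by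
      rw [AddCircle.toCircle_zero]
      exact Circle.ext (by simpa using h)
    simpa using AddCircle.injective_toCircle (Real.two_pi_pos.ne') h1
  · rintro rfl
    simp

theorem zed_nsmul (s : ℕ) (x : Circ) : zed (s • x) = zed x ^ s := by
  rw [zed_pow, zed, fourier_apply, fourier_apply, neg_one_zsmul, neg_zsmul, natCast_zsmul]

theorem measurePreserving_nsmul_haarC {s : ℕ} (hs : 0 < s) :
    MeasurePreserving (fun x : Circ => s • x) haarC haarC := by
  have := MeasureTheory.Measure.measurePreserving_zsmul (G := Circ) haarC (n := (s : ℤ)) (by exact_mod_cast hs.ne')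
  simpa using this

instance nullSingleton_haarC : NullSingletonClass haarC := by
  have h : (volume : Measure Circ) = ENNReal.ofReal (2 * Real.pi) • haarC :=
    AddCircle.volume_eq_smul_haarAddCircle
  refine ⟨fun x => ?_⟩
  have hx : (volume : Measure Circ) {x} = 0 := by
    have := AddCircle.volume_closedBall (T := 2 * Real.pi) (x := x) 0
    simpa using this
  rw [h, Measure.smul_apply, smul_eq_mul, mul_eq_zero] at hx
  refine hx.resolve_left ?_
  simpa using Real.pi_pos

theorem ae_zed_pow_ne_one {s : ℕ} (hs : 0 < s) : ∀ᵐ x ∂haarC, zed x ^ s ≠ 1 := by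
  have h0 : ∀ᵐ x ∂haarC, x ≠ 0 := by
    rw [ae_iff]
    simp
  have := (measurePreserving_nsmul_haarC hs).quasiMeasurePreserving.ae h0
  filter_upwards [this] with x hx h
  rw [← zed_nsmul, zed_eq_one_iff] at h
  exact hx h

theorem memLp_of_bounded_mul {F g : Circ → ℂ} (hF : MemLp F 2 haarC)
    (hg : AEStronglyMeasurable g haarC) {C : ℝ} (hC : ∀ x, ‖g x‖ ≤ C) :
    MemLp (fun x => g x * F x) 2 haarC :=
  hF.of_le_mul (c := C) (hg.mul hF.1) (Eventually.of_forall fun x => by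
    rw [norm_mul]; exact mul_le_mul_of_nonneg_right (hC x) (norm_nonneg _))

theorem memLp_of_continuous {F : Circ → ℂ} (hF : Continuous F) : MemLp F 2 haarC := by
  obtain ⟨C, hC⟩ := (isCompact_range hF).isBounded.exists_norm_le
  exact MemLp.of_bound hF.aestronglyMeasurable C (Eventually.of_forall fun x => hC _ ⟨x, rfl⟩)

theorem memLp_fourier_mul {F : Circ → ℂ} (hF : MemLp F 2 haarC) (k : ℤ) :
    MemLp (fun x => fourier k x * F x) 2 haarC :=
  memLp_of_bounded_mul hF (measurable_fourier k).aestronglyMeasurable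
    (C := 1) fun x => (norm_fourier_apply k x).le

/-- The coefficient of `e^{-ikx}` in the Fourier series of `F`. -/
noncomputable def cf (F : Circ → ℂ) (k : ℤ) : ℂ := ∫ x, fourier k x * F x ∂haarC

theorem cf_eq_fourierCoeff (F : Circ → ℂ) (k : ℤ) : cf F k = fourierCoeff F (-k) := by
  simp only [cf, fourierCoeff, neg_neg, smul_eq_mul]

theorem cf_congr {F G : Circ → ℂ} (h : F =ᵐ[haarC] G) (k : ℤ) : cf F k = cf G k :=
  integral_congr_ae (by filter_upwards [h] with x hx; rw [hx])

theorem cf_fourier (k n : ℤ) : cf (fun x => fourier (-n) x) k = if k = n then 1 else 0 := by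
  rw [cf_eq_fourierCoeff]
  have := fourierCoeff_fourier (T := 2 * Real.pi) (-n)
  rw [show (fun x : Circ => (fourier (-n) x : ℂ)) = ⇑(fourier (-n)) from rfl, this]
  by_cases h : k = n
  · subst h; simp
  · rw [if_neg h, Pi.single_eq_of_ne]
    simpa using h

theorem ae_eq_of_cf_eq {F G : Circ → ℂ} (hF : MemLp F 2 haarC) (hG : MemLp G 2 haarC)
    (h : ∀ k, cf F k = cf G k) : F =ᵐ[haarC] G := by
  have key : hF.toLp F = hG.toLp G := by
    apply (fourierBasis (T := 2 * Real.pi)).repr.injective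
    ext i
    rw [fourierBasis_repr, fourierBasis_repr, fourierCoeff_congr_ae hF.coeFn_toLp,
      fourierCoeff_congr_ae hG.coeFn_toLp]
    have := h (-i)
    rwa [cf_eq_fourierCoeff, cf_eq_fourierCoeff, neg_neg] at this
  exact (MemLp.toLp_eq_toLp_iff hF hG).1 key

theorem tendsto_cf_atBot {F : Circ → ℂ} (hF : MemLp F 2 haarC) : Tendsto (cf F) atBot (𝓝 0) := by
  have h := (hasSum_sq_fourierCoeff (hF.toLp F)).summable.tendsto_cofinite_zero
  have h1 : Tendsto (fun i => ‖fourierCoeff F i‖) cofinite (𝓝 0) := by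
    have h2 := h.sqrt
    simp only [Real.sqrt_zero] at h2
    refine h2.congr fun i => ?_
    rw [Real.sqrt_sq (norm_nonneg _), fourierCoeff_congr_ae hF.coeFn_toLp]
  have h2 := h1.comp (f := fun k : ℤ => -k) (neg_injective.tendsto_cofinite)
  rw [tendsto_zero_iff_norm_tendsto_zero]
  simp only [cf_eq_fourierCoeff]
  exact h2.mono_left atBot_le_cofinite

theorem cf_sub_zed_pow_mul {F : Circ → ℂ} (hF : MemLp F 2 haarC) (s : ℕ) (k : ℤ) :
    cf (fun x => (1 - zed x ^ s) * F x) k = cf F k - cf F (k - s) := by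
  have h1 := (memLp_fourier_mul hF k).integrable one_le_two
  have h2 := (memLp_fourier_mul hF (k - s)).integrable one_le_two
  rw [cf, cf, cf, ← integral_sub h1 h2]
  refine integral_congr_ae (Eventually.of_forall fun x => ?_)
  simp only [zed_pow, sub_eq_add_neg, fourier_add]
  ring

end Circle

/-! ### Power series and their boundary functions in `L²` -/

section BoundaryFunction

open PowerSeries

/-- The coefficients of a power series, extended by zero to negative indices. -/
noncomputable def extCoeff (c : PowerSeries ℂ) (k : ℤ) : ℂ :=
  if 0 ≤ k then coeff k.toNat c else 0

/-- `ψ` is the boundary function of the power series `c`, as far as square-integrable functions can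
tell: a square-integrable function on the circle has the Fourier coefficients of `c` if and only if
it is almost everywhere equal to `ψ`. Neither side is required to occur. -/
def IsBoundaryFunction (c : PowerSeries ℂ) (ψ : Circ → ℂ) : Prop :=
  ∀ F : Circ → ℂ, MemLp F 2 haarC → ((∀ k, cf F k = extCoeff c k) ↔ F =ᵐ[haarC] ψ)

variable {c : PowerSeries ℂ} {ψ ψ' : Circ → ℂ}

theorem IsBoundaryFunction.congr (h : IsBoundaryFunction c ψ) (hψ : ψ =ᵐ[haarC] ψ') :
    IsBoundaryFunction c ψ' := fun F hF =>
  (h F hF).trans ⟨fun h => h.trans hψ, fun h => h.trans hψ.symm⟩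

theorem AbsSummable.continuous_seriesEval (hc : AbsSummable c) :
    Continuous fun x : Circ => seriesEval c (zed x) := by
  refine continuous_tsum (fun k => ?_) hc fun k x => ?_
  · exact continuous_const.mul (continuous_zed.pow k)
  · rw [norm_mul, norm_pow, norm_zed, one_pow, mul_one]

theorem cf_seriesEval (hc : AbsSummable c) (k : ℤ) :
    cf (fun x => seriesEval c (zed x)) k = extCoeff c k := by
  have hterm : ∀ n : ℕ, ∫ x, fourier k x * (coeff n c * zed x ^ n) ∂haarC =
      if k = n then coeff n c else 0 := fun n => by
    have h := cf_fourier k n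
    rw [cf] at h
    have e : (fun x : Circ => fourier k x * (coeff n c * zed x ^ n)) =
        fun x => coeff n c * (fourier k x * fourier (-(n : ℤ)) x) := by
      funext x; rw [zed_pow]; ring
    rw [e, integral_const_mul, h, mul_ite, mul_one, mul_zero]
  have hmeas : ∀ n : ℕ, Integrable (fun x => fourier k x * (coeff n c * zed x ^ n)) haarC :=
    fun n => (memLp_of_continuous ((fourier k).continuous.mul
      (continuous_const.mul (continuous_zed.pow n)))).integrable one_le_two
  have hnorm : ∀ n : ℕ, ∫ x, ‖(fourier k x : ℂ) * (coeff n c * zed x ^ n)‖ ∂haarC = ‖coeff n c‖ :=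
    fun n => by
      simp only [norm_mul, norm_fourier_apply, norm_pow, norm_zed, one_pow, one_mul, mul_one]
      simp
  have h := hasSum_integral_of_summable_integral_norm hmeas (by simp only [hnorm]; exact hc)
  simp only [hterm] at h
  have e : (fun x => ∑' n, fourier k x * (coeff n c * zed x ^ n)) =
      fun x => fourier k x * seriesEval c (zed x) := by
    funext x; rw [tsum_mul_left, seriesEval]
  rw [e] at h
  rw [cf, ← h.tsum_eq, extCoeff]
  split_ifs with hk
  · rw [tsum_eq_single k.toNat]
    · rw [if_pos (Int.toNat_of_nonneg hk).symm]
    · intro n hn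
      rw [if_neg]
      rintro rfl
      simp at hn
  · refine (tsum_congr fun n => ?_).trans tsum_zero
    rw [if_neg]
    rintro rfl
    exact hk (Int.natCast_nonneg n)

theorem AbsSummable.isBoundaryFunction (hc : AbsSummable c) :
    IsBoundaryFunction c fun x => seriesEval c (zed x) := by
  intro F hF
  constructor
  · intro h
    exact ae_eq_of_cf_eq hF (memLp_of_continuous hc.continuous_seriesEval) fun k => by
      rw [h, cf_seriesEval hc]
  · intro h k
    rw [cf_congr h, cf_seriesEval hc]

theorem extCoeff_sub_X_pow_mul (c : PowerSeries ℂ) (s : ℕ) (k : ℤ) :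
    extCoeff ((1 - (X : PowerSeries ℂ) ^ s) * c) k = extCoeff c k - extCoeff c (k - s) := by
  rw [sub_mul, one_mul]
  simp only [extCoeff, map_sub, PowerSeries.coeff_X_pow_mul']
  rcases lt_or_ge k 0 with hk | hk
  · rw [if_neg (not_le.2 hk), if_neg (not_le.2 hk), if_neg (by omega), sub_zero]
  · rw [if_pos hk, if_pos hk]
    by_cases h : (s : ℤ) ≤ k
    · rw [if_pos (by omega), if_pos (by omega)]
      congr 3
      omega
    · rw [if_neg (by omega), if_neg (by omega)]

/-- Boundary functions can be recognized after multiplication by `1 - z ^ s`. -/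
theorem IsBoundaryFunction.of_mul {s : ℕ} (hs : 0 < s)
    (h : IsBoundaryFunction ((1 - (X : PowerSeries ℂ) ^ s) * c)
      fun x => (1 - zed x ^ s) * ψ x) : IsBoundaryFunction c ψ := by
  intro F hF
  have hbd : ∀ x, ‖1 - zed x ^ s‖ ≤ 2 := fun x => by
    refine (norm_sub_le _ _).trans ?_
    rw [norm_one, norm_pow, norm_zed, one_pow]; norm_num
  have hcont : Continuous fun x => 1 - zed x ^ s := continuous_const.sub (continuous_zed.pow s)
  have hF' : MemLp (fun x => (1 - zed x ^ s) * F x) 2 haarC :=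
    memLp_of_bounded_mul hF hcont.aestronglyMeasurable hbd
  have h' := h _ hF'
  constructor
  · intro hk
    have := h'.1 fun k => by
      rw [cf_sub_zed_pow_mul hF, extCoeff_sub_X_pow_mul, hk, hk]
    filter_upwards [this, ae_zed_pow_ne_one hs] with x hx hx1
    exact mul_left_cancel₀ (sub_ne_zero.2 hx1.symm) hx
  · intro hk
    have hcf := h'.2 (by filter_upwards [hk] with x hx; rw [hx])
    -- the difference of the coefficients is `s`-periodic and vanishes at `-∞`
    set u : ℤ → ℂ := fun k => cf F k - extCoeff c k with hu
    have hper : ∀ k, u k = u (k - s) := fun k => by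
      have := hcf k
      rw [cf_sub_zed_pow_mul hF, extCoeff_sub_X_pow_mul] at this
      simp only [hu]
      linear_combination this
    have hper' : ∀ (n : ℕ) k, u k = u (k - n * s) := by
      intro n
      induction n with
      | zero => intro k; simp
      | succ n ih => intro k; rw [ih, hper]; congr 1; push_cast; ring
    have hlim : Tendsto u atBot (𝓝 0) := by
      have h0 : Tendsto (extCoeff c) atBot (𝓝 0) := by
        refine tendsto_const_nhds.congr' ?_
        filter_upwards [eventually_lt_atBot (0 : ℤ)] with k hk
        rw [extCoeff, if_neg (not_le.2 hk)]
      simpa using (tendsto_cf_atBot hF).sub h0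
    intro k
    have h1 : Tendsto (fun n : ℕ => k - n * (s : ℤ)) atTop atBot := by
      refine tendsto_atBot_mono (fun n => ?_)
        (tendsto_atBot_add_const_left atTop k (tendsto_neg_atTop_atBot.comp
          (tendsto_natCast_atTop_atTop (R := ℤ))))
      have : (n : ℤ) * 1 ≤ n * s := by gcongr; exact_mod_cast hs
      simp only [Function.comp_apply]
      linarith
    have h2 := (hlim.comp h1).congr fun n => (hper' n k).symm
    have h3 := tendsto_nhds_unique tendsto_const_nhds h2
    exact sub_eq_zero.1 h3

/-- The boundary function of `(1 - z ^ s) ^ d`. -/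
noncomputable def bdry (s : ℕ) (d : ℝ) (x : Circ) : ℂ := (1 - zed x ^ s) ^ (d : ℂ)

theorem bdry_add_one {s : ℕ} (d : ℝ) {x : Circ} (hx : zed x ^ s ≠ 1) :
    bdry s (d + 1) x = (1 - zed x ^ s) * bdry s d x := by
  rw [bdry, cpow_one_sub_eq hx, bdry]

theorem isBoundaryFunction_cseas_mul_aux {s₁ s₂ : ℕ} (hs₁ : 0 < s₁) (hs₂ : 0 < s₂)
    {q : PowerSeries ℂ} (hq : AbsSummable q) (N₁ : ℕ) :
    ∀ N₂ : ℕ, ∀ d₁ d₂ : ℝ, 0 ≤ d₁ + N₁ → 0 ≤ d₂ + N₂ →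
    IsBoundaryFunction (cseas s₁ d₁ * cseas s₂ d₂ * q)
      fun x => bdry s₁ d₁ x * bdry s₂ d₂ x * seriesEval q (zed x) := by
  induction N₁ with
  | zero =>
    intro N₂
    induction N₂ with
    | zero =>
      intro d₁ d₂ h₁ h₂
      rw [Nat.cast_zero, add_zero] at h₁ h₂
      have a₁ := absSummable_cseas hs₁ h₁
      have a₂ := absSummable_cseas hs₂ h₂
      refine ((a₁.mul a₂).mul hq).isBoundaryFunction.congr ?_
      filter_upwards [ae_zed_pow_ne_one hs₁, ae_zed_pow_ne_one hs₂] with x hx₁ hx₂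
      have hz := (norm_zed x).le
      rw [seriesEval_mul (a₁.mul a₂) hq hz, seriesEval_mul a₁ a₂ hz, seriesEval_cseas hs₁ h₁ hz hx₁,
        seriesEval_cseas hs₂ h₂ hz hx₂, bdry, bdry]
    | succ N₂ ih =>
      intro d₁ d₂ h₁ h₂
      refine IsBoundaryFunction.of_mul hs₂ ?_
      have := ih d₁ (d₂ + 1) h₁ (by push_cast at h₂; linarith)
      rw [cseas_add_one hs₂] at this
      rw [show (1 - (X : PowerSeries ℂ) ^ s₂) * (cseas s₁ d₁ * cseas s₂ d₂ * q) =
        cseas s₁ d₁ * ((1 - (X : PowerSeries ℂ) ^ s₂) * cseas s₂ d₂) * q by ring]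
      refine this.congr ?_
      filter_upwards [ae_zed_pow_ne_one hs₂] with x hx
      rw [bdry_add_one _ hx]
      ring
  | succ N₁ ih =>
    intro N₂ d₁ d₂ h₁ h₂
    refine IsBoundaryFunction.of_mul hs₁ ?_
    have := ih N₂ (d₁ + 1) d₂ (by push_cast at h₁; linarith) h₂
    rw [cseas_add_one hs₁] at this
    rw [show (1 - (X : PowerSeries ℂ) ^ s₁) * (cseas s₁ d₁ * cseas s₂ d₂ * q) =
      ((1 - (X : PowerSeries ℂ) ^ s₁) * cseas s₁ d₁) * cseas s₂ d₂ * q by ring]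
    refine this.congr ?_
    filter_upwards [ae_zed_pow_ne_one hs₁] with x hx
    rw [bdry_add_one _ hx]
    ring

/-- The boundary function of `(1 - z ^ s₁) ^ d₁ * (1 - z ^ s₂) ^ d₂ * q(z)`, for arbitrary real
exponents and an absolutely summable power series `q`. -/
theorem isBoundaryFunction_cseas_mul {s₁ s₂ : ℕ} (hs₁ : 0 < s₁) (hs₂ : 0 < s₂)
    {q : PowerSeries ℂ} (hq : AbsSummable q) (d₁ d₂ : ℝ) :
    IsBoundaryFunction (cseas s₁ d₁ * cseas s₂ d₂ * q)
      fun x => bdry s₁ d₁ x * bdry s₂ d₂ x * seriesEval q (zed x) := by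
  obtain ⟨N₁, h₁⟩ := exists_nat_ge (-d₁)
  obtain ⟨N₂, h₂⟩ := exists_nat_ge (-d₂)
  exact isBoundaryFunction_cseas_mul_aux hs₁ hs₂ hq N₁ N₂ d₁ d₂ (by linarith) (by linarith)

end BoundaryFunction

/-! ### Integrability of powers of `|1 - e^{-isx}|` -/

section Integrability

theorem measurePreserving_coe_circ :
    MeasurePreserving ((↑) : ℝ → Circ)
      (volume.restrict (Set.Ioc (-Real.pi) Real.pi)) (volume : Measure Circ) := by
  have := AddCircle.measurePreserving_mk (2 * Real.pi) (-Real.pi)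
  rwa [show -Real.pi + 2 * Real.pi = Real.pi by ring] at this

theorem volume_circ : (volume : Measure Circ) = ENNReal.ofReal (2 * Real.pi) • haarC :=
  AddCircle.volume_eq_smul_haarAddCircle

theorem integrable_haarC_iff_volume {E : Type*} [NormedAddCommGroup E] {f : Circ → E} :
    Integrable f haarC ↔ Integrable f volume := by
  rw [volume_circ, integrable_smul_measure]
  · simpa using Real.pi_pos
  · exact ENNReal.ofReal_ne_top

theorem ae_haarC_iff_volume {p : Circ → Prop} :
    (∀ᵐ x ∂haarC, p x) ↔ ∀ᵐ x ∂(volume : Measure Circ), p x := by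
  rw [volume_circ, Measure.ae_ennreal_smul_measure_iff]
  simpa using Real.pi_pos

theorem integrable_haarC_iff {E : Type*} [NormedAddCommGroup E] {f : Circ → E}
    (hf : AEStronglyMeasurable f haarC) :
    Integrable f haarC ↔
      IntegrableOn (fun x : ℝ => f x) (Set.Ioc (-Real.pi) Real.pi) := by
  have hf' : AEStronglyMeasurable f (volume : Measure Circ) := by
    rw [volume_circ]; exact hf.smul_measure _
  have hmp := measurePreserving_coe_circ
  rw [integrable_haarC_iff_volume, IntegrableOn]
  rw [← hmp.map_eq] at hf' ⊢
  exact integrable_map_measure hf' hmp.measurable.aemeasurable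

theorem ae_coe_of_ae_haarC {p : Circ → Prop} (h : ∀ᵐ x ∂haarC, p x) :
    ∀ᵐ x : ℝ ∂(volume.restrict (Set.Ioc (-Real.pi) Real.pi)), p x :=
  measurePreserving_coe_circ.quasiMeasurePreserving.ae (ae_haarC_iff_volume.1 h)

theorem integral_haarC (f : Circ → ℂ) :
    ∫ x, f x ∂haarC = (2 * Real.pi : ℂ)⁻¹ * ∫ x in (-Real.pi)..Real.pi, f (x : Circ) := by
  rw [AddCircle.integral_haarAddCircle,
    ← AddCircle.intervalIntegral_preimage (2 * Real.pi) (-Real.pi),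
    show -Real.pi + 2 * Real.pi = Real.pi by ring, Complex.real_smul]
  push_cast
  rfl

theorem norm_one_sub_zed_pow_coe (s : ℕ) (x : ℝ) :
    ‖1 - zed (x : Circ) ^ s‖ = |2 * Real.sin (x * s / 2)| := by
  rw [zed_coe, ← Complex.exp_nat_mul, norm_sub_rev]
  have := Complex.norm_exp_I_mul_ofReal_sub_one (-(s * x))
  rw [show (s : ℂ) * -(Complex.I * x) = Complex.I * ((-(s * x) : ℝ) : ℂ) by push_cast; ring, this,
    Real.norm_eq_abs, neg_div, Real.sin_neg, mul_neg, abs_neg]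
  congr 3
  ring

theorem intervalIntegrable_abs_rpow {r : ℝ} (hr : -1 < r) (a : ℝ) :
    IntervalIntegrable (fun x : ℝ => |x| ^ r) volume (-a) a := by
  have key : ∀ c : ℝ, IntervalIntegrable (fun x : ℝ => |x| ^ r) volume 0 c := by
    have hpos : ∀ c : ℝ, 0 ≤ c → IntervalIntegrable (fun x : ℝ => |x| ^ r) volume 0 c := by
      intro c hc
      refine (intervalIntegral.intervalIntegrable_rpow' hr (a := 0) (b := c)).congr ?_
      intro x hx
      rw [Set.uIoc_of_le hc] at hx
      simp only [abs_of_pos hx.1]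
    intro c
    rcases le_total 0 c with hc | hc
    · exact hpos c hc
    · rw [IntervalIntegrable.iff_comp_neg]
      simpa using hpos (-c) (by linarith)
  exact (key (-a)).symm.trans (key a)

theorem integrable_norm_one_sub_zed_rpow {s : ℕ} (hs : 0 < s) {p : ℝ} (hp : -1 < p) :
    Integrable (fun x => ‖1 - zed x ^ s‖ ^ p) haarC := by
  -- the map `x ↦ s • x` preserves the Haar measure
  suffices h : Integrable (fun x => ‖1 - zed x‖ ^ p) haarC by
    have := (measurePreserving_nsmul_haarC hs).integrable_comp_of_integrable h
    refine this.congr (Eventually.of_forall fun x => ?_)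
    simp only [Function.comp_apply, zed_nsmul]
  have hmeas : Measurable fun x => ‖1 - zed x‖ ^ p :=
    ((measurable_const.sub measurable_zed).norm).pow_const _
  rw [integrable_haarC_iff hmeas.aestronglyMeasurable]
  have hcoe : ∀ x : ℝ, ‖1 - zed (x : Circ)‖ = |2 * Real.sin (x / 2)| := fun x => by
    simpa using norm_one_sub_zed_pow_coe 1 x
  simp only [hcoe]
  have hmeas' : Measurable fun x : ℝ => |2 * Real.sin (x / 2)| ^ p := by fun_prop
  rcases le_or_gt 0 p with hp0 | hp0
  · refine Measure.integrableOn_of_bounded (M := 2 ^ p) (by simp) hmeas'.aestronglyMeasurable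
      (Eventually.of_forall fun x => ?_)
    rw [Real.norm_of_nonneg (by positivity)]
    refine Real.rpow_le_rpow (abs_nonneg _) ?_ hp0
    rw [abs_mul, abs_two]
    linarith [Real.abs_sin_le_one (x / 2)]
  · have h1 := ((intervalIntegrable_iff_integrableOn_Ioc_of_le (by linarith [Real.pi_pos])).1
      (intervalIntegrable_abs_rpow hp Real.pi)).const_mul ((2 / Real.pi) ^ p)
    refine Integrable.mono' h1 hmeas'.aestronglyMeasurable ?_
    filter_upwards [ae_restrict_mem measurableSet_Ioc,
      (ae_restrict_of_ae (Measure.ae_ne volume (0 : ℝ)) :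
        ∀ᵐ x : ℝ ∂(volume.restrict (Set.Ioc (-Real.pi) Real.pi)), x ≠ 0)] with x hx hx0
    rw [Real.norm_of_nonneg (by positivity)]
    have hpi := Real.pi_pos
    have h2 : 2 / Real.pi * |x| ≤ |2 * Real.sin (x / 2)| := by
      have h3 : |x / 2| ≤ Real.pi / 2 := by
        rw [abs_div, abs_two]
        have := abs_le.2 ⟨hx.1.le, hx.2⟩
        linarith
      have := Real.mul_abs_le_abs_sin h3
      rw [abs_div, abs_two] at this
      rw [abs_mul, abs_two]
      linarith
    have h4 : 0 < 2 / Real.pi * |x| := by positivity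
    rw [← Real.mul_rpow (by positivity) (abs_nonneg x)]
    exact Real.rpow_le_rpow_of_nonpos h4 h2 hp0.le

theorem measurable_bdry (s : ℕ) (d : ℝ) : Measurable (bdry s d) :=
  (measurable_const.sub (measurable_zed.pow_const s)).pow_const _

theorem norm_bdry (s : ℕ) (d : ℝ) (x : Circ) : ‖bdry s d x‖ = ‖1 - zed x ^ s‖ ^ d :=
  Complex.norm_cpow_real _ _

theorem norm_one_sub_zed_pow_le (s : ℕ) (x : Circ) : ‖1 - zed x ^ s‖ ≤ 2 := by
  refine (norm_sub_le _ _).trans ?_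
  rw [norm_one, norm_pow, norm_zed, one_pow]; norm_num

theorem norm_bdry_le {d : ℝ} (hd : 0 ≤ d) (s : ℕ) (x : Circ) : ‖bdry s d x‖ ≤ 2 ^ d := by
  rw [norm_bdry]
  exact Real.rpow_le_rpow (norm_nonneg _) (norm_one_sub_zed_pow_le s x) hd

theorem bdry_mul_bdry_neg {s : ℕ} (d : ℝ) {x : Circ} (hx : zed x ^ s ≠ 1) :
    bdry s d x * bdry s (-d) x = 1 := by
  have h0 : 1 - zed x ^ s ≠ 0 := sub_ne_zero.2 hx.symm
  rw [bdry, bdry, ← Complex.cpow_add _ _ h0]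
  simp

theorem memLp_bdry {s : ℕ} (hs : 0 < s) {d : ℝ} (hd : -(1 / 2) < d) :
    MemLp (bdry s d) 2 haarC := by
  rw [memLp_two_iff_integrable_sq_norm (measurable_bdry s d).aestronglyMeasurable]
  refine (integrable_norm_one_sub_zed_rpow hs (p := d * 2) (by linarith)).congr
    (Eventually.of_forall fun x => ?_)
  simp only [norm_bdry]
  rw [Real.rpow_mul (norm_nonneg _), Real.rpow_two]

/-- Square integrability of `(1 - z ^ s₁) ^ d₁ * (1 - z ^ s₂) ^ d₂` on the unit circle. -/
theorem memLp_bdry_mul_bdry {s₁ s₂ : ℕ} (hs₁ : 0 < s₁) (hs₂ : 0 < s₂) {d₁ d₂ : ℝ}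
    (h₁ : -(1 / 2) < d₁) (h₂ : -(1 / 2) < d₂) (h₁₂ : -(1 / 2) < d₁ + d₂) :
    MemLp (fun x => bdry s₁ d₁ x * bdry s₂ d₂ x) 2 haarC := by
  rcases le_or_gt 0 d₁ with hd₁ | hd₁
  · exact memLp_of_bounded_mul (memLp_bdry hs₂ h₂) (measurable_bdry s₁ d₁).aestronglyMeasurable
      (norm_bdry_le hd₁ s₁)
  rcases le_or_gt 0 d₂ with hd₂ | hd₂
  · simp only [mul_comm (bdry s₁ d₁ _)]
    exact memLp_of_bounded_mul (memLp_bdry hs₁ h₁) (measurable_bdry s₂ d₂).aestronglyMeasurable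
      (norm_bdry_le hd₂ s₂)
  -- both exponents are negative: weighted arithmetic-geometric mean inequality
  have hm := (measurable_bdry s₁ d₁).mul (measurable_bdry s₂ d₂)
  have hD : d₁ + d₂ < 0 := by linarith
  have hw₁ : 0 ≤ d₁ / (d₁ + d₂) := div_nonneg_of_nonpos hd₁.le hD.le
  have hw₂ : 0 ≤ d₂ / (d₁ + d₂) := div_nonneg_of_nonpos hd₂.le hD.le
  have hw : d₁ / (d₁ + d₂) + d₂ / (d₁ + d₂) = 1 := by
    rw [← add_div, div_self hD.ne]
  have hb := ((memLp_bdry hs₁ h₁₂).norm.const_mul (d₁ / (d₁ + d₂))).add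
    ((memLp_bdry hs₂ h₁₂).norm.const_mul (d₂ / (d₁ + d₂)))
  refine hb.mono' hm.aestronglyMeasurable (Eventually.of_forall fun x => ?_)
  have h := Real.geom_mean_le_arith_mean2_weighted hw₁ hw₂
    (Real.rpow_nonneg (norm_nonneg (1 - zed x ^ s₁)) (d₁ + d₂))
    (Real.rpow_nonneg (norm_nonneg (1 - zed x ^ s₂)) (d₁ + d₂)) hw
  rw [← Real.rpow_mul (norm_nonneg _), ← Real.rpow_mul (norm_nonneg _),
    mul_div_cancel₀ _ hD.ne, mul_div_cancel₀ _ hD.ne] at h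
  simpa [norm_mul, norm_bdry] using h

end Integrability

/-! ### Mean square convergence of filters in the frequency domain -/

section MeanSquare

open PowerSeries

theorem tendsto_eLpNorm_of_dominated {F : ℕ → Circ → ℂ} {G : Circ → ℂ} {g : Circ → ℝ}
    (hF : ∀ n, AEStronglyMeasurable (F n) haarC) (hg : MemLp g 2 haarC)
    (hb : ∀ n, ∀ᵐ x ∂haarC, ‖F n x‖ ≤ g x)
    (hlim : ∀ᵐ x ∂haarC, Tendsto (fun n => F n x) atTop (𝓝 (G x))) :
    Tendsto (fun n => eLpNorm (fun x => F n x - G x) 2 haarC) atTop (𝓝 0) := by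
  have hG : AEStronglyMeasurable G haarC := aestronglyMeasurable_of_tendsto_ae atTop hF hlim
  have h2 : (2 : ENNReal) ≠ 0 := two_ne_zero
  have hGb : ∀ᵐ x ∂haarC, ‖G x‖ ≤ g x := by
    filter_upwards [ae_all_iff.2 hb, hlim] with x hx hx'
    exact le_of_tendsto hx'.norm (Eventually.of_forall hx)
  have hlin : Tendsto (fun n => ∫⁻ x, ‖F n x - G x‖ₑ ^ (2 : ℝ) ∂haarC) atTop
      (𝓝 (∫⁻ _, 0 ∂haarC)) := by
    refine tendsto_lintegral_of_dominated_convergence' (fun x => ‖2 * g x‖ₑ ^ (2 : ℝ))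
      (fun n => ((hF n).sub hG).enorm.pow_const _) (fun n => ?_) ?_ ?_
    · filter_upwards [hb n, hGb] with x hx hx'
      refine ENNReal.rpow_le_rpow ?_ (by norm_num)
      rw [enorm_le_iff_norm_le]
      refine (norm_sub_le _ _).trans ?_
      refine le_trans ?_ (Real.le_norm_self _)
      linarith
    · have := (hg.const_mul 2).2
      rw [eLpNorm_lt_top_iff_lintegral_rpow_enorm_lt_top h2 (by simp)] at this
      simpa using this.ne
    · filter_upwards [hlim] with x hx
      have h3 : Tendsto (fun n => ‖F n x - G x‖ₑ) atTop (𝓝 0) := by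
        have := (hx.sub_const (G x)).enorm
        simpa using this
      have h4 := h3.ennrpow_const 2
      simpa using h4
  rw [lintegral_zero] at hlin
  have h5 := hlin.ennrpow_const (1 / 2)
  rw [ENNReal.zero_rpow_of_pos (by norm_num)] at h5
  refine h5.congr fun n => ?_
  rw [eLpNorm_eq_lintegral_rpow_enorm_toReal h2 (by simp)]
  simp

theorem continuous_partialEval (c : PowerSeries ℂ) (n : ℕ) :
    Continuous fun x : Circ => partialEval c n (zed x) :=
  continuous_finsetSum _ fun k _ => continuous_const.mul (continuous_zed.pow k)

theorem memLp_partialEval_mul {W : Circ → ℂ} (hW : MemLp W 2 haarC) (c : PowerSeries ℂ) (n : ℕ) :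
    MemLp (fun x => partialEval c n (zed x) * W x) 2 haarC := by
  obtain ⟨C, hC⟩ := (isCompact_range (continuous_partialEval c n)).isBounded.exists_norm_le
  exact memLp_of_bounded_mul hW (continuous_partialEval c n).aestronglyMeasurable
    fun x => hC _ ⟨x, rfl⟩

theorem partialEval_mul (q c : PowerSeries ℂ) (n : ℕ) (w : ℂ) :
    partialEval (q * c) n w =
      ∑ j ∈ Finset.range n, coeff j q * w ^ j * partialEval c (n - j) w := by
  simp only [partialEval]
  induction n with
  | zero => simp
  | succ n ih =>
    have h1 : ∀ j ∈ Finset.range (n + 1),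
        coeff j q * w ^ j * ∑ k ∈ Finset.range (n + 1 - j), coeff k c * w ^ k =
        coeff j q * w ^ j * ∑ k ∈ Finset.range (n - j), coeff k c * w ^ k +
          coeff j q * coeff (n - j) c * w ^ n := by
      intro j hj
      have hj' : j ≤ n := Nat.lt_succ_iff.1 (Finset.mem_range.1 hj)
      rw [Nat.succ_sub hj', Finset.sum_range_succ, mul_add]
      congr 1
      rw [show w ^ n = w ^ j * w ^ (n - j) by rw [← pow_add, Nat.add_sub_cancel' hj']]
      ring
    rw [Finset.sum_congr rfl h1, Finset.sum_add_distrib, Finset.sum_range_succ, ih,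
      Finset.sum_range_succ (fun j => coeff j q * w ^ j *
        ∑ k ∈ Finset.range (n - j), coeff k c * w ^ k), Nat.sub_self, Finset.sum_range_zero, mul_zero,
      add_zero, coeff_mul, Finset.Nat.sum_antidiagonal_eq_sum_range_succ_mk, Finset.sum_mul]

/-- Mean square convergence of the filter with transfer `c` along the weight `W` is inherited by
the product of `c` with an absolutely summable series. -/
theorem tendsto_eLpNorm_partialEval_mul {q c : PowerSeries ℂ} (hq : AbsSummable q)
    {W H : Circ → ℂ} (hW : MemLp W 2 haarC) (hH : MemLp H 2 haarC)
    (h : Tendsto (fun n => eLpNorm (fun x => partialEval c n (zed x) * W x - H x) 2 haarC)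
      atTop (𝓝 0)) :
    Tendsto (fun n => eLpNorm (fun x => partialEval (q * c) n (zed x) * W x -
      seriesEval q (zed x) * H x) 2 haarC) atTop (𝓝 0) := by
  set A : ℕ → Circ → ℂ := fun n x => partialEval c n (zed x) * W x - H x with hA
  have hAm : ∀ n, MemLp (A n) 2 haarC := fun n => (memLp_partialEval_mul hW c n).sub hH
  set a : ℕ → ℝ := fun n => (eLpNorm (A n) 2 haarC).toReal with ha
  have ha0 : ∀ n, 0 ≤ a n := fun n => ENNReal.toReal_nonneg
  have haA : ∀ n, eLpNorm (A n) 2 haarC = ENNReal.ofReal (a n) := fun n =>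
    (ENNReal.ofReal_toReal (hAm n).2.ne).symm
  have halim : Tendsto a atTop (𝓝 0) := by
    have := (ENNReal.tendsto_toReal ENNReal.zero_ne_top).comp h
    rwa [ENNReal.toReal_zero] at this
  obtain ⟨M, hM⟩ : ∃ M, ∀ n, a n ≤ M := by
    obtain ⟨M, hM⟩ := halim.bddAbove_range
    exact ⟨M, fun n => hM ⟨n, rfl⟩⟩
  -- the part of the sum over `j ≥ n` is not small, it is replaced by the tail of `q`
  have hb : Tendsto (fun n => ∑' j, if j < n then ‖coeff j q‖ * a (n - j) else 0) atTop (𝓝 0) := by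
    have : Tendsto (fun n => ∑' j, if j < n then ‖coeff j q‖ * a (n - j) else 0) atTop
        (𝓝 (∑' _ : ℕ, (0 : ℝ))) := by
      refine tendsto_tsum_of_dominated_convergence (hq.mul_right M) (fun j => ?_)
        (Eventually.of_forall fun n j => ?_)
      · have h1 : Tendsto (fun n => ‖coeff j q‖ * a (n - j)) atTop (𝓝 (‖coeff j q‖ * 0)) :=
          (halim.comp (tendsto_sub_atTop_nat j)).const_mul _
        rw [mul_zero] at h1
        refine h1.congr' ?_
        filter_upwards [eventually_gt_atTop j] with n hn
        rw [if_pos hn]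
      · have h2 : 0 ≤ ‖coeff j q‖ * M := mul_nonneg (norm_nonneg _) ((ha0 0).trans (hM 0))
        split_ifs
        · rw [Real.norm_of_nonneg (mul_nonneg (norm_nonneg _) (ha0 _))]
          exact mul_le_mul_of_nonneg_left (hM _) (norm_nonneg _)
        · rwa [norm_zero]
    simpa using this
  have htail : Tendsto (fun n => ∑' j, ‖coeff (j + n) q‖) atTop (𝓝 0) :=
    tendsto_sum_nat_add fun j => ‖coeff j q‖
  have hbound : ∀ n, eLpNorm (fun x => partialEval (q * c) n (zed x) * W x -
      seriesEval q (zed x) * H x) 2 haarC ≤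
      ENNReal.ofReal ((∑' j, if j < n then ‖coeff j q‖ * a (n - j) else 0) +
        (∑' j, ‖coeff (j + n) q‖) * (eLpNorm H 2 haarC).toReal) := by
    intro n
    have hdec : (fun x => partialEval (q * c) n (zed x) * W x - seriesEval q (zed x) * H x) =
        (∑ j ∈ Finset.range n, fun x => coeff j q * zed x ^ j * A (n - j) x) +
          fun x => -(∑' j, coeff (j + n) q * zed x ^ (j + n)) * H x := by
      funext x
      have hs := (hq.hasSum (norm_zed x).le)
      rw [Pi.add_apply, Finset.sum_apply, partialEval_mul, ← hs.tsum_eq,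
        ← hs.summable.sum_add_tsum_nat_add n, Finset.sum_mul, add_mul, Finset.sum_mul]
      simp only [hA, mul_sub, Finset.sum_sub_distrib, mul_assoc]
      ring
    have hm1 : ∀ j ∈ Finset.range n,
        AEStronglyMeasurable (fun x => coeff j q * zed x ^ j * A (n - j) x) haarC := fun j _ =>
      ((measurable_const.mul (measurable_zed.pow_const j)).aestronglyMeasurable).mul (hAm _).1
    have hm2 : AEStronglyMeasurable
        (fun x => -(∑' j, coeff (j + n) q * zed x ^ (j + n)) * H x) haarC := by
      refine AEStronglyMeasurable.mul (Continuous.aestronglyMeasurable ?_) hH.1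
      refine (continuous_tsum (fun k => ?_) ((summable_nat_add_iff n).2 hq) fun k x => ?_).neg
      · exact continuous_const.mul (continuous_zed.pow _)
      · rw [norm_mul, norm_pow, norm_zed, one_pow, mul_one]
    rw [hdec]
    refine (eLpNorm_add_le (Finset.aestronglyMeasurable_sum _ hm1) hm2 one_le_two).trans ?_
    rw [ENNReal.ofReal_add (tsum_nonneg fun j => by
      split_ifs; exacts [mul_nonneg (norm_nonneg _) (ha0 _), le_rfl]) (by positivity)]
    refine add_le_add ((eLpNorm_sum_le hm1 one_le_two).trans ?_) ?_
    · rw [tsum_eq_sum (s := Finset.range n) (fun j hj => if_neg (by simpa using hj)),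
        ENNReal.ofReal_sum_of_nonneg fun j _ => by
          split_ifs; exacts [mul_nonneg (norm_nonneg _) (ha0 _), le_rfl]]
      refine Finset.sum_le_sum fun j hj => ?_
      rw [if_pos (Finset.mem_range.1 hj), ENNReal.ofReal_mul (norm_nonneg _), ← haA]
      refine eLpNorm_le_mul_eLpNorm_of_ae_le_mul (Eventually.of_forall fun x => ?_) 2
      rw [norm_mul, norm_mul, norm_pow, norm_zed, one_pow, mul_one]
    · rw [ENNReal.ofReal_mul (tsum_nonneg fun _ => norm_nonneg _), ENNReal.ofReal_toReal hH.2.ne]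
      refine eLpNorm_le_mul_eLpNorm_of_ae_le_mul (Eventually.of_forall fun x => ?_) 2
      rw [norm_mul, norm_neg]
      refine mul_le_mul_of_nonneg_right ?_ (norm_nonneg _)
      refine tsum_of_norm_bounded ((summable_nat_add_iff n).2 hq).hasSum fun j => ?_
      rw [norm_mul, norm_pow, norm_zed, one_pow, mul_one]
  have hlim : Tendsto (fun n => (∑' j, if j < n then ‖coeff j q‖ * a (n - j) else 0) +
        (∑' j, ‖coeff (j + n) q‖) * (eLpNorm H 2 haarC).toReal) atTop (𝓝 0) := by
    simpa using hb.add (htail.mul_const (eLpNorm H 2 haarC).toReal)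
  have hlim' := (ENNReal.continuous_ofReal.tendsto 0).comp hlim
  rw [ENNReal.ofReal_zero] at hlim'
  exact tendsto_of_tendsto_of_tendsto_of_le_of_le tendsto_const_nhds hlim' (fun _ => zero_le)
    hbound

/-- The Fourier series of a square-integrable boundary function converges in mean square. -/
theorem IsBoundaryFunction.tendsto_partialEval {c : PowerSeries ℂ} {ψ : Circ → ℂ}
    (h : IsBoundaryFunction c ψ) (hψ : MemLp ψ 2 haarC) :
    Tendsto (fun n => eLpNorm (fun x => partialEval c n (zed x) - ψ x) 2 haarC) atTop (𝓝 0) := by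
  have hcoef := (h ψ hψ).2 EventuallyEq.rfl
  have hs := hasSum_fourier_series_L2 (hψ.toLp ψ)
  have hcf : ∀ i : ℤ, fourierCoeff (hψ.toLp ψ) i = extCoeff c (-i) := fun i => by
    rw [fourierCoeff_congr_ae hψ.coeFn_toLp, ← hcoef, cf_eq_fourierCoeff, neg_neg]
  simp only [hcf] at hs
  have hinj : Function.Injective fun k : ℕ => -(k : ℤ) := fun a b h => by simpa using h
  rw [← hinj.hasSum_iff] at hs
  swap
  · intro i hi
    rw [extCoeff, if_neg, zero_smul]
    intro h0
    exact hi ⟨(-i).toNat, by simp only [Int.toNat_of_nonneg h0, neg_neg]⟩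
  have hlim := hs.tendsto_sum_nat
  rw [Lp.tendsto_Lp_iff_tendsto_eLpNorm'] at hlim
  refine hlim.congr fun n => eLpNorm_congr_ae ?_
  have h1 : ∀ᵐ x ∂haarC, ∀ k : ℕ, (fourierLp (T := 2 * Real.pi) 2 (-(k : ℤ)) : Circ → ℂ) x =
      fourier (-(k : ℤ)) x := ae_all_iff.2 fun k => coeFn_fourierLp 2 _
  have h2 : ∀ m : ℕ, ∀ᵐ x ∂haarC, ((∑ k ∈ Finset.range m,
      extCoeff c (- -(k : ℤ)) • fourierLp (T := 2 * Real.pi) 2 (-(k : ℤ)) : Lp ℂ 2 haarC) :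
        Circ → ℂ) x = partialEval c m (zed x) := by
    intro m
    induction m with
    | zero =>
      filter_upwards [Lp.coeFn_zero ℂ 2 haarC] with x hx
      rw [partialEval, Finset.sum_range_zero, Finset.sum_range_zero, hx, Pi.zero_apply]
    | succ m ih =>
      rw [Finset.sum_range_succ]
      filter_upwards [ih, Lp.coeFn_add (∑ k ∈ Finset.range m,
        extCoeff c (- -(k : ℤ)) • fourierLp (T := 2 * Real.pi) 2 (-(k : ℤ)))
        (extCoeff c (- -(m : ℤ)) • fourierLp (T := 2 * Real.pi) 2 (-(m : ℤ))),
        Lp.coeFn_smul (extCoeff c (- -(m : ℤ))) (fourierLp (T := 2 * Real.pi) 2 (-(m : ℤ))), h1]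
        with x hx1 hx2 hx3 hx4
      rw [hx2, Pi.add_apply, hx1, hx3, Pi.smul_apply, hx4, partialEval, partialEval,
        Finset.sum_range_succ, zed_pow, neg_neg, extCoeff, if_pos (Int.natCast_nonneg m),
        Int.toNat_natCast, smul_eq_mul]
  filter_upwards [Lp.coeFn_sub (∑ k ∈ Finset.range n,
      extCoeff c (- -(k : ℤ)) • fourierLp (T := 2 * Real.pi) 2 (-(k : ℤ))) (hψ.toLp ψ), h2 n,
      hψ.coeFn_toLp] with x hx1 hx2 hx3
  simp only [Function.comp_apply]
  rw [Pi.sub_apply, hx2, hx3]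

end MeanSquare

/-! ### Inversion of the seasonal fractional filter in the frequency domain -/

section Inversion

open PowerSeries

variable {s₁ s₂ : ℕ} {d₁ d₂ : ℝ}

theorem bdry_mul_bdry_inv (hs₁ : 0 < s₁) (hs₂ : 0 < s₂) (d₁ d₂ : ℝ) :
    ∀ᵐ x ∂haarC, bdry s₁ d₁ x * bdry s₂ d₂ x * (bdry s₁ (-d₁) x * bdry s₂ (-d₂) x) = 1 := by
  filter_upwards [ae_zed_pow_ne_one hs₁, ae_zed_pow_ne_one hs₂] with x h₁ h₂
  rw [mul_mul_mul_comm, bdry_mul_bdry_neg d₁ h₁, bdry_mul_bdry_neg d₂ h₂, one_mul]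

theorem isBoundaryFunction_cseas (hs₁ : 0 < s₁) (hs₂ : 0 < s₂) (d₁ d₂ : ℝ) :
    IsBoundaryFunction (cseas s₁ d₁ * cseas s₂ d₂) fun x => bdry s₁ d₁ x * bdry s₂ d₂ x := by
  have h1 : AbsSummable (1 : PowerSeries ℂ) := by
    simpa using absSummable_polynomial 1
  have h := isBoundaryFunction_cseas_mul hs₁ hs₂ h1 d₁ d₂
  rw [mul_one] at h
  refine h.congr (Eventually.of_forall fun x => ?_)
  have h2 := seriesEval_polynomial 1 (zed x)
  rw [Polynomial.coe_one, Polynomial.eval_one] at h2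
  simp only [h2, mul_one]

/-- The partial sums of a one-factor series with a nonpositive exponent are dominated by a multiple
of the boundary function. -/
theorem exists_norm_partialEval_cseas_le {s : ℕ} (hs : 0 < s) {d : ℝ} (hd : d ≤ 0) (hd1 : -1 < d) :
    ∃ C : ℝ, 0 ≤ C ∧ ∀ x : Circ, zed x ^ s ≠ 1 → ∀ n,
      ‖partialEval (cseas s d) n (zed x)‖ ≤ C * ‖bdry s d x‖ := by
  obtain ⟨C, hC, h⟩ := exists_norm_sum_fracCoeff_neg_le (a := -d) (by linarith) (by linarith)
  refine ⟨C, hC, fun x hx n => ?_⟩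
  have := h (zed x ^ s) (by rw [norm_pow, norm_zed, one_pow]) hx ((n + s - 1) / s)
  rw [neg_neg] at this
  rwa [partialEval_cseas hs, norm_bdry]

theorem tendsto_partialEval_cseas {s : ℕ} (hs : 0 < s) {d : ℝ} (hd : d ≤ 0) (hd1 : -1 < d)
    {x : Circ} (hx : zed x ^ s ≠ 1) :
    Tendsto (fun n => partialEval (cseas s d) n (zed x)) atTop (𝓝 (bdry s d x)) := by
  have h := tendsto_sum_fracCoeff_neg (a := -d) (by linarith) (by linarith)
    (w := zed x ^ s) (by rw [norm_pow, norm_zed, one_pow]) hx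
  rw [neg_neg] at h
  have h2 : Tendsto (fun n => (n + s - 1) / s) atTop atTop := by
    refine tendsto_atTop_mono (fun n => Nat.div_le_div_right (c := s) (?_ : n ≤ n + s - 1))
      (Nat.tendsto_div_const_atTop hs.ne')
    omega
  refine (h.comp h2).congr fun n => ?_
  rw [partialEval_cseas hs, Function.comp_apply]

theorem tendsto_partialEval_inverse_of_mixed (hs₁ : 0 < s₁) (hs₂ : 0 < s₂)
    (h₁ : d₁ ≤ 0) (h₁' : -(1 / 2) < d₁) (h₂ : 0 ≤ d₂) (h₂' : d₂ < 1 / 2) :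
    Tendsto (fun n => eLpNorm (fun x => partialEval (cseas s₁ d₁ * cseas s₂ d₂) n (zed x) *
      (bdry s₁ (-d₁) x * bdry s₂ (-d₂) x) - 1) 2 haarC) atTop (𝓝 0) := by
  have hH : MemLp (bdry s₂ (-d₂)) 2 haarC := memLp_bdry hs₂ (by linarith)
  have hW : MemLp (fun x => bdry s₁ (-d₁) x * bdry s₂ (-d₂) x) 2 haarC :=
    memLp_of_bounded_mul hH (measurable_bdry _ _).aestronglyMeasurable
      (norm_bdry_le (by linarith) s₁)
  obtain ⟨C, hC, hb⟩ := exists_norm_partialEval_cseas_le hs₁ h₁ (by linarith)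
  have hdom : Tendsto (fun n => eLpNorm (fun x => partialEval (cseas s₁ d₁) n (zed x) *
      (bdry s₁ (-d₁) x * bdry s₂ (-d₂) x) - bdry s₂ (-d₂) x) 2 haarC) atTop (𝓝 0) := by
    refine tendsto_eLpNorm_of_dominated (fun n => (memLp_partialEval_mul hW _ n).1)
      (hH.norm.const_mul C) (fun n => ?_) ?_
    · filter_upwards [ae_zed_pow_ne_one hs₁] with x hx
      rw [norm_mul, norm_mul]
      have h := bdry_mul_bdry_neg d₁ hx
      have h' : ‖bdry s₁ d₁ x‖ * ‖bdry s₁ (-d₁) x‖ = 1 := by rw [← norm_mul, h, norm_one]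
      calc _ ≤ C * ‖bdry s₁ d₁ x‖ * (‖bdry s₁ (-d₁) x‖ * ‖bdry s₂ (-d₂) x‖) :=
            mul_le_mul_of_nonneg_right (hb x hx n) (by positivity)
        _ = C * (‖bdry s₁ d₁ x‖ * ‖bdry s₁ (-d₁) x‖) * ‖bdry s₂ (-d₂) x‖ := by ring
        _ = C * ‖bdry s₂ (-d₂) x‖ := by rw [h', mul_one]
    · filter_upwards [ae_zed_pow_ne_one hs₁] with x hx
      have := (tendsto_partialEval_cseas hs₁ h₁ (by linarith) hx).mul_const
        (bdry s₁ (-d₁) x * bdry s₂ (-d₂) x)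
      rwa [← mul_assoc, bdry_mul_bdry_neg d₁ hx, one_mul] at this
  have h := tendsto_eLpNorm_partialEval_mul (absSummable_cseas hs₂ h₂) hW hH hdom
  rw [mul_comm (cseas s₂ d₂)] at h
  refine h.congr fun n => eLpNorm_congr_ae ?_
  filter_upwards [ae_zed_pow_ne_one hs₂] with x hx
  rw [seriesEval_cseas hs₂ h₂ (norm_zed x).le hx]
  change _ - bdry s₂ d₂ x * bdry s₂ (-d₂) x = _
  rw [bdry_mul_bdry_neg d₂ hx]

/-- Under the memory conditions, the partial sums of the series of
`(1 - z ^ s₁) ^ d₁ * (1 - z ^ s₂) ^ d₂` invert the transfer function of the fractional filter in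
mean square. If both exponents are nonnegative the series is absolutely summable; if both are
nonpositive it is square summable and the weight is bounded; in the mixed case the partial sums of
the factor with the negative exponent are dominated by the boundary function. -/
theorem tendsto_partialEval_inverse (hs₁ : 0 < s₁) (hs₂ : 0 < s₂)
    (h₁ : |d₁| < 1 / 2) (h₂ : |d₂| < 1 / 2) (h₁₂ : |d₁ + d₂| < 1 / 2) :
    Tendsto (fun n => eLpNorm (fun x => partialEval (cseas s₁ d₁ * cseas s₂ d₂) n (zed x) *
      (bdry s₁ (-d₁) x * bdry s₂ (-d₂) x) - 1) 2 haarC) atTop (𝓝 0) := by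
  rw [abs_lt] at h₁ h₂ h₁₂
  have hW : MemLp (fun x => bdry s₁ (-d₁) x * bdry s₂ (-d₂) x) 2 haarC :=
    memLp_bdry_mul_bdry hs₁ hs₂ (by linarith) (by linarith) (by linarith)
  rcases le_total 0 d₁ with hd₁ | hd₁ <;> rcases le_total 0 d₂ with hd₂ | hd₂
  · have a₁ := absSummable_cseas hs₁ hd₁
    have a₂ := absSummable_cseas hs₂ hd₂
    have h := tendsto_eLpNorm_partialEval_mul (c := 1) (a₁.mul a₂) hW hW (by
      refine tendsto_const_nhds.congr' ?_
      filter_upwards [eventually_ge_atTop 1] with n hn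
      have : ∀ w, partialEval 1 n w = 1 := fun w => by
        rw [partialEval, Finset.sum_eq_single 0]
        · simp
        · intro k _ hk
          rw [coeff_one, if_neg hk, zero_mul]
        · intro h
          exact absurd (Finset.mem_range.2 hn) h
      simp [this])
    rw [mul_one] at h
    refine h.congr fun n => eLpNorm_congr_ae ?_
    filter_upwards [bdry_mul_bdry_inv hs₁ hs₂ d₁ d₂, ae_zed_pow_ne_one hs₁,
      ae_zed_pow_ne_one hs₂] with x hx h₁ h₂
    have hz := (norm_zed x).le
    rw [seriesEval_mul a₁ a₂ hz, seriesEval_cseas hs₁ hd₁ hz h₁, seriesEval_cseas hs₂ hd₂ hz h₂]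
    change _ - bdry s₁ d₁ x * bdry s₂ d₂ x * _ = _
    rw [hx]
  · have h := tendsto_partialEval_inverse_of_mixed hs₂ hs₁ hd₂ h₂.1 hd₁ h₁.2
    simpa only [mul_comm (cseas s₂ d₂), mul_comm (bdry s₂ (-d₂) _)] using h
  · exact tendsto_partialEval_inverse_of_mixed hs₁ hs₂ hd₁ h₁.1 hd₂ h₂.2
  · have hψ : MemLp (fun x => bdry s₁ d₁ x * bdry s₂ d₂ x) 2 haarC :=
      memLp_bdry_mul_bdry hs₁ hs₂ (by linarith) (by linarith) (by linarith)
    have hB := isBoundaryFunction_cseas hs₁ hs₂ d₁ d₂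
    have h := hB.tendsto_partialEval hψ
    have hlim := ENNReal.Tendsto.const_mul (a := ENNReal.ofReal (2 ^ (-d₁) * 2 ^ (-d₂))) h
      (Or.inr ENNReal.ofReal_ne_top)
    rw [mul_zero] at hlim
    refine tendsto_of_tendsto_of_tendsto_of_le_of_le tendsto_const_nhds hlim (fun _ => zero_le)
      fun n => eLpNorm_le_mul_eLpNorm_of_ae_le_mul ?_ 2
    filter_upwards [bdry_mul_bdry_inv hs₁ hs₂ d₁ d₂] with x hx
    rw [← hx, ← sub_mul, norm_mul, mul_comm, norm_mul]
    refine mul_le_mul_of_nonneg_right ?_ (norm_nonneg _)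
    exact mul_le_mul (norm_bdry_le (by linarith) s₁ x) (norm_bdry_le (by linarith) s₂ x)
      (norm_nonneg _) (by positivity)

end Inversion

/-! ### The spectral isometry of a white noise -/

section SpectralIsometry

variable {Ω : Type*} [MeasurableSpace Ω] {P : Measure Ω} {v : NNReal}
  {e : ℤ → Ω → ℝ} {U : Lp ℂ 2 haarC →L[ℂ] Lp ℂ 2 P}

namespace IsGaussianNoise

theorem memLp (he : IsGaussianNoise P v e) (t : ℤ) : MemLp (e t) 2 P := by
  have h := memLp_id_gaussianReal (μ := 0) (v := v) 2
  rw [← (he.law t).map_eq] at h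
  exact (memLp_map_measure_iff h.1 (he.law t).aemeasurable).1 h

theorem integral_eq_zero (he : IsGaussianNoise P v e) (t : ℤ) : ∫ ω, e t ω ∂P = 0 := by
  rw [(he.law t).integral_eq, integral_id_gaussianReal]

theorem integral_mul [IsProbabilityMeasure P] (he : IsGaussianNoise P v e) (s t : ℤ) :
    ∫ ω, e s ω * e t ω ∂P = if s = t then (v : ℝ) else 0 := by
  have hcov := covariance_eq_sub (he.memLp s) (he.memLp t)
  rw [he.integral_eq_zero, zero_mul, sub_zero] at hcov
  refine Eq.trans hcov.symm ?_
  split_ifs with h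
  · subst h
    rw [covariance_self (he.law s).aemeasurable, (he.law s).variance_eq, variance_id_gaussianReal]
  · exact (he.indep.indepFun h).covariance_eq_zero (he.memLp s) (he.memLp t)

end IsGaussianNoise

/-- `U` maps the square-integrable functions on the circle into the complex square-integrable
random variables: it is, up to the factor `√v`, the isometry which sends `e^{itx}` to the
innovation `e_t`. -/
structure IsSpectralIsometry (P : Measure Ω) (v : NNReal) (e : ℤ → Ω → ℝ)
    (U : Lp ℂ 2 haarC →L[ℂ] Lp ℂ 2 P) : Prop where
  map_fourier : ∀ t, (U (fourierLp 2 t) : Ω → ℂ) =ᵐ[P] fun ω => (e t ω : ℂ)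
  inner_map : ∀ f g, inner ℂ (U f) (U g) = (v : ℂ) * inner ℂ f g

theorem IsGaussianNoise.exists_isSpectralIsometry [IsProbabilityMeasure P] (he : IsGaussianNoise P v e) :
    ∃ U : Lp ℂ 2 haarC →L[ℂ] Lp ℂ 2 P, IsSpectralIsometry P v e U := by
  classical
  set ε : ℤ → Lp ℂ 2 P := fun t => (he.memLp t).ofReal.toLp with hε
  have hεae : ∀ t, (ε t : Ω → ℂ) =ᵐ[P] fun ω => (e t ω : ℂ) := fun t =>
    (he.memLp t).ofReal.coeFn_toLp
  have hinner : ∀ s t, inner ℂ (ε s) (ε t) = if s = t then (v : ℂ) else 0 := fun s t => by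
    rw [L2.inner_def]
    have h1 : ∫ ω, inner ℂ (ε s ω) (ε t ω) ∂P = ∫ ω, ((e s ω * e t ω : ℝ) : ℂ) ∂P := by
      refine integral_congr_ae ?_
      filter_upwards [hεae s, hεae t] with ω h1 h2
      rw [h1, h2]
      simp [mul_comm]
    rw [h1, integral_complex_ofReal, he.integral_mul]
    split_ifs <;> simp
  rcases eq_or_ne v 0 with rfl | hv
  · refine ⟨0, fun t => ?_, fun f g => by simp⟩
    have h0 : ε t = 0 := by
      have := hinner t t
      rw [if_pos rfl] at this
      rw [← inner_self_eq_zero (𝕜 := ℂ), this]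
      simp
    have := hεae t
    rw [h0] at this
    exact this
  · have hv' : (0 : ℝ) < Real.sqrt v := Real.sqrt_pos.2 (by positivity)
    have hvc : ((Real.sqrt v : ℝ) : ℂ) ≠ 0 := by exact_mod_cast hv'.ne'
    have hsq : ((Real.sqrt v : ℝ) : ℂ) * ((Real.sqrt v : ℝ) : ℂ) = v := by
      rw [← Complex.ofReal_mul, Real.mul_self_sqrt (by positivity)]
    have hon : Orthonormal ℂ fun t => ((Real.sqrt v : ℝ) : ℂ)⁻¹ • ε t := by
      rw [orthonormal_iff_ite]
      intro s t
      rw [inner_smul_left, inner_smul_right, hinner, map_inv₀, Complex.conj_ofReal]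
      split_ifs
      · rw [← hsq]; field_simp
      · simp
    set I := hon.orthogonalFamily.linearIsometry with hI
    refine ⟨((Real.sqrt v : ℝ) : ℂ) • (I.toContinuousLinearMap.comp
      (fourierBasis (T := 2 * Real.pi)).repr.toContinuousLinearEquiv.toContinuousLinearMap),
      fun t => ?_, fun f g => ?_⟩
    · have h1 : (fourierBasis (T := 2 * Real.pi)).repr (fourierLp 2 t) = lp.single 2 t (1 : ℂ) := by
        rw [← coe_fourierBasis, HilbertBasis.repr_self]
      have h2 : I (lp.single 2 t (1 : ℂ)) = ((Real.sqrt v : ℝ) : ℂ)⁻¹ • ε t := by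
        rw [hI, OrthogonalFamily.linearIsometry_apply_single]
        simp
      have h3 : (((Real.sqrt v : ℝ) : ℂ) • (I.toContinuousLinearMap.comp
          (fourierBasis (T := 2 * Real.pi)).repr.toContinuousLinearEquiv.toContinuousLinearMap))
          (fourierLp 2 t) = ε t := by
        change ((Real.sqrt v : ℝ) : ℂ) • I ((fourierBasis (T := 2 * Real.pi)).repr
          (fourierLp 2 t)) = ε t
        rw [h1, h2, smul_smul, mul_inv_cancel₀ hvc, one_smul]
      rw [h3]
      exact hεae t
    · change inner ℂ (((Real.sqrt v : ℝ) : ℂ) • I ((fourierBasis (T := 2 * Real.pi)).repr f))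
        (((Real.sqrt v : ℝ) : ℂ) • I ((fourierBasis (T := 2 * Real.pi)).repr g)) = _
      rw [inner_smul_left, inner_smul_right, I.inner_map_map, LinearIsometryEquiv.inner_map_map,
        Complex.conj_ofReal, ← mul_assoc, hsq]

namespace IsSpectralIsometry

theorem norm_map (hU : IsSpectralIsometry P v e U) (f : Lp ℂ 2 haarC) :
    ‖U f‖ = Real.sqrt v * ‖f‖ := by
  have h := hU.inner_map f f
  rw [inner_self_eq_norm_sq_to_K, inner_self_eq_norm_sq_to_K] at h
  have h' : ‖U f‖ ^ 2 = v * ‖f‖ ^ 2 := by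
    have : ((‖U f‖ ^ 2 : ℝ) : ℂ) = ((v * ‖f‖ ^ 2 : ℝ) : ℂ) := by
      push_cast; exact h
    exact_mod_cast this
  rw [← Real.sqrt_sq (norm_nonneg (U f)), h', Real.sqrt_mul (by positivity),
    Real.sqrt_sq (norm_nonneg f)]

theorem eLpNorm_map (hU : IsSpectralIsometry P v e U) {F : Circ → ℂ} (hF : MemLp F 2 haarC) :
    eLpNorm (U (hF.toLp F)) 2 P = ENNReal.ofReal (Real.sqrt v) * eLpNorm F 2 haarC := by
  rw [← Lp.enorm_def, ← ofReal_norm, hU.norm_map, ENNReal.ofReal_mul (Real.sqrt_nonneg _),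
    ofReal_norm, Lp.enorm_toLp]

theorem integral_map [IsProbabilityMeasure P] (hU : IsSpectralIsometry P v e U) (he : IsGaussianNoise P v e)
    (f : Lp ℂ 2 haarC) : ∫ ω, U f ω ∂P = 0 := by
  have h1 : MemLp (fun _ : Ω => (1 : ℂ)) 2 P := memLp_const 1
  have hint : ∀ g : Lp ℂ 2 P, ∫ ω, g ω ∂P = inner ℂ (h1.toLp _) g := fun g => by
    rw [L2.inner_def]
    refine integral_congr_ae ?_
    filter_upwards [h1.coeFn_toLp] with ω hω
    rw [hω]; simp
  have hs := ((hasSum_fourier_series_L2 f).mapL U).mapL (innerSL ℂ (h1.toLp _))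
  rw [hint, ← innerSL_apply_apply, ← hs.tsum_eq]
  refine (tsum_congr fun t => ?_).trans tsum_zero
  rw [map_smul, innerSL_apply_apply, inner_smul_right, ← hint, integral_congr_ae (hU.map_fourier t),
    integral_complex_ofReal, he.integral_eq_zero]
  simp

end IsSpectralIsometry

/-- The process `X` has the transfer function `G` with respect to the noise: `X_t` is the image of
`e^{itx} G(x)` under the spectral isometry. -/
def HasTransfer (P : Measure Ω) (U : Lp ℂ 2 haarC →L[ℂ] Lp ℂ 2 P) (X : ℤ → Ω → ℝ)
    (G : Circ → ℂ) : Prop :=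
  ∃ hG : MemLp G 2 haarC, ∀ t,
    (fun ω => (X t ω : ℂ)) =ᵐ[P] U ((memLp_fourier_mul hG t).toLp fun x => fourier t x * G x)

variable {X Y : ℤ → Ω → ℝ} {G H : Circ → ℂ}

namespace HasTransfer

theorem memLp_transfer (h : HasTransfer P U X G) : MemLp G 2 haarC := h.1

theorem congr_ae (h : HasTransfer P U X G) (hGH : G =ᵐ[haarC] H) : HasTransfer P U X H := by
  obtain ⟨hG, h⟩ := h
  refine ⟨(memLp_congr_ae hGH).1 hG, fun t => ?_⟩
  have : (memLp_fourier_mul hG t).toLp (fun x => fourier t x * G x) =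
      (memLp_fourier_mul ((memLp_congr_ae hGH).1 hG) t).toLp fun x => fourier t x * H x := by
    rw [MemLp.toLp_eq_toLp_iff]
    filter_upwards [hGH] with x hx
    rw [hx]
  rw [← this]
  exact h t

theorem congr_process (h : HasTransfer P U X G) (hXY : ∀ t, Y t =ᵐ[P] X t) :
    HasTransfer P U Y G := by
  obtain ⟨hG, h⟩ := h
  refine ⟨hG, fun t => ?_⟩
  filter_upwards [h t, hXY t] with ω h1 h2
  rw [h2, h1]

theorem memLp (h : HasTransfer P U X G) (t : ℤ) : MemLp (X t) 2 P := by
  obtain ⟨hG, h⟩ := h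
  have h1 := (memLp_congr_ae (h t)).2 (Lp.memLp _)
  have h2 := h1.re
  simpa using h2

theorem integral_eq_zero [IsProbabilityMeasure P] (h : HasTransfer P U X G) (hU : IsSpectralIsometry P v e U)
    (he : IsGaussianNoise P v e) (t : ℤ) : ∫ ω, X t ω ∂P = 0 := by
  obtain ⟨hG, h⟩ := h
  have h1 := integral_congr_ae (h t)
  rw [hU.integral_map he, integral_complex_ofReal] at h1
  exact_mod_cast h1

theorem integral_mul (hX : HasTransfer P U X G) (hU : IsSpectralIsometry P v e U) (s t : ℤ) :
    ((∫ ω, X s ω * X t ω ∂P : ℝ) : ℂ) =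
      v * ∫ x, fourier (s - t) x * ((‖G x‖ ^ 2 : ℝ) : ℂ) ∂haarC := by
  obtain ⟨hG, h⟩ := hX
  have h1 := hU.inner_map ((memLp_fourier_mul hG t).toLp fun x => fourier t x * G x)
    ((memLp_fourier_mul hG s).toLp fun x => fourier s x * G x)
  rw [L2.inner_def, L2.inner_def] at h1
  have h2 : ((∫ ω, X s ω * X t ω ∂P : ℝ) : ℂ) = ∫ ω, inner ℂ
      (U ((memLp_fourier_mul hG t).toLp fun x => fourier t x * G x) ω)
      (U ((memLp_fourier_mul hG s).toLp fun x => fourier s x * G x) ω) ∂P := by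
    rw [← integral_complex_ofReal]
    refine integral_congr_ae ?_
    filter_upwards [h s, h t] with ω hs ht
    rw [← hs, ← ht]
    simp
  rw [h2, h1]
  congr 1
  refine integral_congr_ae ?_
  filter_upwards [(memLp_fourier_mul hG t).coeFn_toLp, (memLp_fourier_mul hG s).coeFn_toLp]
    with x ht hs
  rw [ht, hs, RCLike.inner_apply', map_mul, ← fourier_neg, sub_eq_add_neg, fourier_add,
    ← Complex.normSq_eq_norm_sq, Complex.normSq_eq_conj_mul_self]
  ring

theorem covariance_eq [IsProbabilityMeasure P] (hX : HasTransfer P U X G) (hU : IsSpectralIsometry P v e U)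
    (he : IsGaussianNoise P v e) (s t : ℤ) :
    covariance (X s) (X t) P = ∫ ω, X s ω * X t ω ∂P := by
  rw [covariance_eq_sub (hX.memLp s) (hX.memLp t), hX.integral_eq_zero hU he, zero_mul, sub_zero]
  rfl

theorem isCovStationary [IsProbabilityMeasure P] (hX : HasTransfer P U X G) (hU : IsSpectralIsometry P v e U)
    (he : IsGaussianNoise P v e) : IsCovStationary P X where
  memLp := hX.memLp
  mean_eq t := by rw [hX.integral_eq_zero hU he, hX.integral_eq_zero hU he]
  cov_eq t h := by
    rw [hX.covariance_eq hU he, hX.covariance_eq hU he]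
    have h1 := hX.integral_mul hU (t + h) t
    have h2 := hX.integral_mul hU h 0
    rw [add_sub_cancel_left] at h1
    rw [sub_zero, ← h1] at h2
    exact_mod_cast h2.symm

/-- A process with transfer function `G` has the spectral density `v / (2π) |G|²`. -/
theorem isSpectralDensity [IsProbabilityMeasure P] (hX : HasTransfer P U X G) (hU : IsSpectralIsometry P v e U)
    (he : IsGaussianNoise P v e) :
    IsSpectralDensity P X fun x => v / (2 * Real.pi) * ‖G (x : Circ)‖ ^ 2 where
  nonneg := Eventually.of_forall fun x => by positivity
  integrable := by
    have h1 := (memLp_two_iff_integrable_sq_norm hX.memLp_transfer.1).1 hX.memLp_transfer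
    exact ((integrable_haarC_iff h1.1).1 h1).const_mul _
  cov_eq t h := by
    rw [hX.covariance_eq hU he, hX.integral_mul hU, integral_haarC, add_sub_cancel_left,
      ← mul_assoc, ← intervalIntegral.integral_const_mul]
    refine intervalIntegral.integral_congr fun x _ => ?_
    simp only [fourier_coe_exp]
    push_cast
    ring

/-- Finite filters act on transfer functions by multiplication. -/
theorem partialSum_ae_eq (hX : HasTransfer P U X G) (c : PowerSeries ℝ) (n : ℕ) (t : ℤ) :
    (fun ω => ((∑ k ∈ Finset.range n, PowerSeries.coeff k c * X (t - k) ω : ℝ) : ℂ)) =ᵐ[P]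
      U ((memLp_fourier_mul (memLp_partialEval_mul hX.memLp_transfer
        (PowerSeries.map Complex.ofRealHom c) n) t).toLp
        fun x => fourier t x *
          (partialEval (PowerSeries.map Complex.ofRealHom c) n (zed x) * G x)) := by
  induction n with
  | zero =>
    have h0 : (memLp_fourier_mul (memLp_partialEval_mul hX.memLp_transfer
        (PowerSeries.map Complex.ofRealHom c) 0) t).toLp
        (fun x => fourier t x *
          (partialEval (PowerSeries.map Complex.ofRealHom c) 0 (zed x) * G x)) = 0 := by
      rw [← MemLp.toLp_zero (MemLp.zero (ε := ℂ) (p := 2) (μ := haarC)), MemLp.toLp_eq_toLp_iff]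
      refine Eventually.of_forall fun x => ?_
      simp [partialEval]
    rw [h0, map_zero]
    filter_upwards [Lp.coeFn_zero ℂ 2 P] with ω hω
    rw [hω]
    simp
  | succ n ih =>
    obtain ⟨hG, h⟩ := hX
    have h1 : (memLp_fourier_mul (memLp_partialEval_mul hG
        (PowerSeries.map Complex.ofRealHom c) (n + 1)) t).toLp
        (fun x => fourier t x *
          (partialEval (PowerSeries.map Complex.ofRealHom c) (n + 1) (zed x) * G x)) =
        (memLp_fourier_mul (memLp_partialEval_mul hG
        (PowerSeries.map Complex.ofRealHom c) n) t).toLp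
        (fun x => fourier t x *
          (partialEval (PowerSeries.map Complex.ofRealHom c) n (zed x) * G x)) +
        ((PowerSeries.coeff n c : ℝ) : ℂ) • (memLp_fourier_mul hG (t - n)).toLp
          fun x => fourier (t - n) x * G x := by
      rw [← MemLp.toLp_const_smul, ← MemLp.toLp_add, MemLp.toLp_eq_toLp_iff]
      refine Eventually.of_forall fun x => ?_
      simp only [Pi.add_apply, Pi.smul_apply, smul_eq_mul, partialEval, Finset.sum_range_succ,
        zed_pow, PowerSeries.coeff_map, sub_eq_add_neg t, fourier_add, Complex.ofRealHom_eq_coe]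
      ring
    rw [h1, map_add, map_smul]
    filter_upwards [ih, h (t - n), Lp.coeFn_add (U ((memLp_fourier_mul (memLp_partialEval_mul hG
        (PowerSeries.map Complex.ofRealHom c) n) t).toLp
        (fun x => fourier t x *
          (partialEval (PowerSeries.map Complex.ofRealHom c) n (zed x) * G x))))
        (((PowerSeries.coeff n c : ℝ) : ℂ) • U ((memLp_fourier_mul hG (t - n)).toLp
          fun x => fourier (t - n) x * G x)),
        Lp.coeFn_smul ((PowerSeries.coeff n c : ℝ) : ℂ) (U ((memLp_fourier_mul hG (t - n)).toLp
          fun x => fourier (t - n) x * G x))] with ω h2 h3 h4 h5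
    rw [h4, Pi.add_apply, ← h2, h5, Pi.smul_apply, ← h3, Finset.sum_range_succ]
    push_cast
    rfl

end HasTransfer

/-- The mean square distance of `U(e^{itx} H)` and a partial sum of a filter is the distance of
the transfer functions. -/
theorem eLpNorm_sub_partialSum (hU : IsSpectralIsometry P v e U) (hY : HasTransfer P U Y G)
    (hH : MemLp H 2 haarC) (c : PowerSeries ℝ) (n : ℕ) (t : ℤ) :
    eLpNorm (fun ω => U ((memLp_fourier_mul hH t).toLp fun x => fourier t x * H x) ω -
      ((∑ k ∈ Finset.range n, PowerSeries.coeff k c * Y (t - k) ω : ℝ) : ℂ)) 2 P =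
    ENNReal.ofReal (Real.sqrt v) * eLpNorm (fun x =>
      partialEval (PowerSeries.map Complex.ofRealHom c) n (zed x) * G x - H x) 2 haarC := by
  have hS := memLp_partialEval_mul hY.memLp_transfer (PowerSeries.map Complex.ofRealHom c) n
  have h1 := hU.eLpNorm_map ((memLp_fourier_mul hH t).sub (memLp_fourier_mul hS t))
  rw [MemLp.toLp_sub (memLp_fourier_mul hH t) (memLp_fourier_mul hS t), map_sub] at h1
  have h2 : eLpNorm (fun ω => U ((memLp_fourier_mul hH t).toLp fun x => fourier t x * H x) ω -
      ((∑ k ∈ Finset.range n, PowerSeries.coeff k c * Y (t - k) ω : ℝ) : ℂ)) 2 P =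
      eLpNorm ((U ((memLp_fourier_mul hH t).toLp fun x => fourier t x * H x) -
        U ((memLp_fourier_mul hS t).toLp _) : Lp ℂ 2 P) : Ω → ℂ) 2 P := by
    refine eLpNorm_congr_ae ?_
    filter_upwards [hY.partialSum_ae_eq c n t, Lp.coeFn_sub (U ((memLp_fourier_mul hH t).toLp
      fun x => fourier t x * H x)) (U ((memLp_fourier_mul hS t).toLp _))] with ω h3 h4
    rw [h4, Pi.sub_apply, ← h3]
  rw [h2, h1]
  congr 1
  refine eLpNorm_congr_norm_ae (Eventually.of_forall fun x => ?_)
  simp only [Pi.sub_apply]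
  rw [← mul_sub, norm_mul, norm_fourier_apply, one_mul, norm_sub_rev]

theorem eLpNorm_ofReal_sub (f g : Ω → ℝ) :
    eLpNorm (fun ω => (f ω : ℂ) - (g ω : ℂ)) 2 P = eLpNorm (fun ω => f ω - g ω) 2 P := by
  refine eLpNorm_congr_norm_ae (Eventually.of_forall fun ω => ?_)
  rw [← Complex.ofReal_sub, Complex.norm_real]

/-- Mean square convergence in the frequency domain yields filter outputs. -/
theorem HasTransfer.isFilterOutput (hX : HasTransfer P U X H) (hY : HasTransfer P U Y G)
    (hU : IsSpectralIsometry P v e U) {c : PowerSeries ℝ}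
    (h : Tendsto (fun n => eLpNorm (fun x =>
      partialEval (PowerSeries.map Complex.ofRealHom c) n (zed x) * G x - H x) 2 haarC) atTop
      (𝓝 0)) : IsFilterOutput P c Y X := by
  intro t
  refine ⟨hX.memLp t, ?_⟩
  have h1 := ENNReal.Tendsto.const_mul (a := ENNReal.ofReal (Real.sqrt v)) h
    (Or.inr ENNReal.ofReal_ne_top)
  rw [mul_zero] at h1
  refine h1.congr fun n => ?_
  obtain ⟨hH, hX⟩ := hX
  rw [← eLpNorm_sub_partialSum hU hY hH c n t, ← eLpNorm_ofReal_sub]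
  refine eLpNorm_congr_ae ?_
  filter_upwards [hX t] with ω hω
  rw [hω]

theorem ae_eq_of_tendsto_eLpNorm {f g : Ω → ℂ} {S : ℕ → Ω → ℂ} (hf : AEStronglyMeasurable f P)
    (hg : AEStronglyMeasurable g P) (hS : ∀ n, AEStronglyMeasurable (S n) P)
    (h1 : Tendsto (fun n => eLpNorm (fun ω => f ω - S n ω) 2 P) atTop (𝓝 0))
    (h2 : Tendsto (fun n => eLpNorm (fun ω => g ω - S n ω) 2 P) atTop (𝓝 0)) : f =ᵐ[P] g := by
  have h : eLpNorm (fun ω => f ω - g ω) 2 P ≤ 0 := by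
    refine ge_of_tendsto (by simpa using h1.add h2) (Eventually.of_forall fun n => ?_)
    have e : (fun ω => f ω - g ω) = (fun ω => f ω - S n ω) + fun ω => -(g ω - S n ω) := by
      funext ω; simp
    rw [e]
    refine (eLpNorm_add_le (hf.sub (hS n)) (hg.sub (hS n)).neg one_le_two).trans ?_
    exact add_le_add le_rfl (eLpNorm_neg (fun ω => g ω - S n ω) 2 P).le
  have h0 := (eLpNorm_eq_zero_iff (hf.sub hg) two_ne_zero).1 (le_antisymm h zero_le)
  filter_upwards [h0] with ω hω
  exact sub_eq_zero.1 hω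

theorem HasTransfer.aestronglyMeasurable_partialSum (hY : HasTransfer P U Y G) (c : PowerSeries ℝ)
    (t : ℤ) (n : ℕ) : AEStronglyMeasurable
      (fun ω => ((∑ k ∈ Finset.range n, PowerSeries.coeff k c * Y (t - k) ω : ℝ) : ℂ)) P :=
  (Lp.aestronglyMeasurable _).congr (hY.partialSum_ae_eq c n t).symm

/-- Filter outputs are unique, and their transfer functions are the mean square limits. -/
theorem IsFilterOutput.hasTransfer {c : PowerSeries ℝ} (hX : IsFilterOutput P c Y X)
    (hY : HasTransfer P U Y G) (hU : IsSpectralIsometry P v e U) (hH : MemLp H 2 haarC)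
    (h : Tendsto (fun n => eLpNorm (fun x =>
      partialEval (PowerSeries.map Complex.ofRealHom c) n (zed x) * G x - H x) 2 haarC) atTop
      (𝓝 0)) : HasTransfer P U X H := by
  refine ⟨hH, fun t => ?_⟩
  have h1 := ENNReal.Tendsto.const_mul (a := ENNReal.ofReal (Real.sqrt v)) h
    (Or.inr ENNReal.ofReal_ne_top)
  rw [mul_zero] at h1
  refine ae_eq_of_tendsto_eLpNorm (hX t).1.ofReal.1 (Lp.aestronglyMeasurable _)
    (hY.aestronglyMeasurable_partialSum c t) ?_
    (h1.congr fun n => (eLpNorm_sub_partialSum hU hY hH c n t).symm)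
  refine (hX t).2.congr fun n => (eLpNorm_ofReal_sub _ _).symm

/-- A mean square convergent filter has an output. -/
theorem exists_hasTransfer (hY : HasTransfer P U Y G) (hU : IsSpectralIsometry P v e U)
    (hH : MemLp H 2 haarC) {c : PowerSeries ℝ}
    (h : Tendsto (fun n => eLpNorm (fun x =>
      partialEval (PowerSeries.map Complex.ofRealHom c) n (zed x) * G x - H x) 2 haarC) atTop
      (𝓝 0)) : ∃ X : ℤ → Ω → ℝ, IsFilterOutput P c Y X := by
  set W : ℤ → Lp ℂ 2 P := fun t =>
    U ((memLp_fourier_mul hH t).toLp fun x => fourier t x * H x) with hW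
  refine ⟨fun t ω => (W t ω).re, fun t => ⟨(Lp.memLp (W t)).re, ?_⟩⟩
  have h1 := ENNReal.Tendsto.const_mul (a := ENNReal.ofReal (Real.sqrt v)) h
    (Or.inr ENNReal.ofReal_ne_top)
  rw [mul_zero] at h1
  refine tendsto_of_tendsto_of_tendsto_of_le_of_le tendsto_const_nhds h1 (fun _ => zero_le)
    fun n => ?_
  simp only
  rw [← eLpNorm_sub_partialSum hU hY hH c n t]
  refine eLpNorm_mono fun ω => ?_
  have e : (W t ω).re - ∑ k ∈ Finset.range n, PowerSeries.coeff k c * Y (t - k) ω =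
      (W t ω - ((∑ k ∈ Finset.range n, PowerSeries.coeff k c * Y (t - k) ω : ℝ) : ℂ)).re := by
    rw [Complex.sub_re, Complex.ofReal_re]
  rw [e]
  exact Complex.abs_re_le_norm _

/-- If the noise is not degenerate, mean square convergence in the time domain implies mean square
convergence in the frequency domain. -/
theorem IsFilterOutput.exists_tendsto {c : PowerSeries ℝ} (hX : IsFilterOutput P c Y X)
    (hY : HasTransfer P U Y G) (hU : IsSpectralIsometry P v e U) (hv : v ≠ 0) :
    ∃ H : Circ → ℂ, MemLp H 2 haarC ∧ Tendsto (fun n => eLpNorm (fun x =>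
      partialEval (PowerSeries.map Complex.ofRealHom c) n (zed x) * G x - H x) 2 haarC) atTop
      (𝓝 0) := by
  have hv' : (0 : ℝ) < Real.sqrt v := Real.sqrt_pos.2 (by positivity)
  have hS := memLp_partialEval_mul hY.memLp_transfer (PowerSeries.map Complex.ofRealHom c)
  have hX0 : MemLp (fun ω => (X 0 ω : ℂ)) 2 P := (hX 0).1.ofReal
  set f : ℕ → Lp ℂ 2 haarC := fun n => (memLp_fourier_mul (hS n) 0).toLp _ with hf
  have hconv : Tendsto (fun n => U (f n)) atTop (𝓝 (hX0.toLp)) := by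
    rw [Lp.tendsto_Lp_iff_tendsto_eLpNorm']
    refine (hX 0).2.congr fun n => ?_
    rw [← eLpNorm_ofReal_sub]
    refine eLpNorm_congr_norm_ae ?_
    filter_upwards [hX0.coeFn_toLp, hY.partialSum_ae_eq c n 0] with ω h2 h3
    rw [Pi.sub_apply, h2, h3, norm_sub_rev]
  have hcauchy : CauchySeq f := by
    rw [Metric.cauchySeq_iff]
    intro δ hδ
    obtain ⟨N, hN⟩ := Metric.cauchySeq_iff.1 hconv.cauchySeq (Real.sqrt v * δ) (by positivity)
    refine ⟨N, fun m hm n hn => ?_⟩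
    have := hN m hm n hn
    rw [dist_eq_norm, ← map_sub, hU.norm_map] at this
    rw [dist_eq_norm]
    exact lt_of_mul_lt_mul_left this hv'.le
  obtain ⟨F, hF⟩ := cauchySeq_tendsto_of_complete hcauchy
  refine ⟨F, Lp.memLp F, ?_⟩
  rw [Lp.tendsto_Lp_iff_tendsto_eLpNorm'] at hF
  refine hF.congr fun n => eLpNorm_congr_ae ?_
  filter_upwards [(memLp_fourier_mul (hS n) 0).coeFn_toLp] with x h2
  rw [Pi.sub_apply, h2, fourier_zero, one_mul]

/-- The noise has the transfer function `1`. -/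
theorem IsSpectralIsometry.hasTransfer_noise (hU : IsSpectralIsometry P v e U) :
    HasTransfer P U e fun _ => 1 := by
  refine ⟨memLp_const 1, fun t => ?_⟩
  have : (memLp_fourier_mul (memLp_const 1) t).toLp (fun x : Circ => fourier t x * (1 : ℂ)) =
      fourierLp 2 t := by
    apply Lp.ext
    filter_upwards [(memLp_fourier_mul (memLp_const 1) t).coeFn_toLp, coeFn_fourierLp 2 t]
      with x h1 h2
    rw [h1, h2, mul_one]
  rw [this]
  exact (hU.map_fourier t).symm

end SpectralIsometry

/-! ### Strict stationarity -/

section StrictStationarity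

variable {Ω : Type*} [MeasurableSpace Ω] {P : Measure Ω} {v : NNReal}
  {e : ℤ → Ω → ℝ} {U : Lp ℂ 2 haarC →L[ℂ] Lp ℂ 2 P} {X : ℤ → Ω → ℝ} {G : Circ → ℂ}

theorem IsGaussianNoise.identDistrib_shift (he : IsGaussianNoise P v e) (h : ℤ) :
    IdentDistrib (fun ω (j : ℤ) => e j ω) (fun ω (j : ℤ) => e (j + h) ω) P P :=
  IdentDistrib.pi (fun j => (he.law j).identDistrib (he.law (j + h))) he.indep
    (he.indep.precomp (g := fun j : ℤ => j + h) (add_left_injective h))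

/-- The time domain representation of a process with a transfer function: the coefficients of the
innovations do not depend on time. -/
theorem HasTransfer.tendsto_sum_noise (hX : HasTransfer P U X G)
    (hU : IsSpectralIsometry P v e U) (t : ℤ) :
    Tendsto (fun F : Finset ℤ => eLpNorm (fun ω => (∑ j ∈ F, (fourierCoeff G j).re * e (j + t) ω) -
      X t ω) 2 P) atTop (𝓝 0) := by
  obtain ⟨hG, h⟩ := hX
  have hs := hasSum_fourier_series_L2 ((memLp_fourier_mul hG t).toLp fun x => fourier t x * G x)
  have hcoef : ∀ i, fourierCoeff ((memLp_fourier_mul hG t).toLp fun x => fourier t x * G x) i =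
      fourierCoeff G (i - t) := fun i => by
    rw [fourierCoeff_congr_ae (memLp_fourier_mul hG t).coeFn_toLp]
    refine integral_congr_ae (Eventually.of_forall fun x => ?_)
    simp only [smul_eq_mul]
    rw [← mul_assoc, ← fourier_add]
    congr 3
    ring
  simp only [hcoef] at hs
  rw [← (Equiv.addRight t).hasSum_iff] at hs
  have hs' := hs.mapL U
  have hlim : Tendsto (fun F : Finset ℤ => ∑ j ∈ F, U (fourierCoeff G j • fourierLp 2 (j + t)))
      atTop (𝓝 (U ((memLp_fourier_mul hG t).toLp fun x => fourier t x * G x))) := by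
    refine hs'.congr fun F => Finset.sum_congr rfl fun j _ => ?_
    simp
  rw [Lp.tendsto_Lp_iff_tendsto_eLpNorm'] at hlim
  refine tendsto_of_tendsto_of_tendsto_of_le_of_le tendsto_const_nhds hlim (fun _ => zero_le)
    fun F => eLpNorm_mono_ae ?_
  have hsum : ∀ F : Finset ℤ, ((∑ j ∈ F, U (fourierCoeff G j • fourierLp 2 (j + t)) : Lp ℂ 2 P) :
      Ω → ℂ) =ᵐ[P] fun ω => ∑ j ∈ F, fourierCoeff G j * (e (j + t) ω : ℂ) := by
    intro F
    classical
    induction F using Finset.induction_on with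
    | empty =>
      rw [Finset.sum_empty]
      filter_upwards [Lp.coeFn_zero ℂ 2 P] with ω hω
      rw [hω, Pi.zero_apply, Finset.sum_empty]
    | insert i F hi ih =>
      rw [Finset.sum_insert hi]
      filter_upwards [ih, hU.map_fourier (i + t), Lp.coeFn_add
        (U (fourierCoeff G i • fourierLp 2 (i + t)))
        (∑ j ∈ F, U (fourierCoeff G j • fourierLp 2 (j + t))),
        Lp.coeFn_smul (fourierCoeff G i) (U (fourierLp 2 (i + t)))] with ω h1 h2 h3 h4
      rw [h3, Pi.add_apply, h1, map_smul, h4, Pi.smul_apply, h2, Finset.sum_insert hi, smul_eq_mul]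
  filter_upwards [hsum F, h t] with ω h1 h2
  have e1 : (∑ j ∈ F, (fourierCoeff G j).re * e (j + t) ω) - X t ω =
      ((∑ j ∈ F, fourierCoeff G j * (e (j + t) ω : ℂ)) - (X t ω : ℂ)).re := by
    rw [Complex.sub_re, Complex.re_sum, Complex.ofReal_re]
    simp
  rw [Pi.sub_apply, h1, ← h2, e1]
  exact Complex.abs_re_le_norm _

theorem HasTransfer.isStrictlyStationary [IsProbabilityMeasure P] (hX : HasTransfer P U X G)
    (hU : IsSpectralIsometry P v e U) (he : IsGaussianNoise P v e) : IsStrictlyStationary P X := by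
  intro n t h
  set A : (Fin n → ℤ) → Finset ℤ → Ω → Fin n → ℝ := fun t F ω i =>
    ∑ j ∈ F, (fourierCoeff G j).re * e (j + t i) ω with hA
  have hAmeas : ∀ t F, AEMeasurable (A t F) P := fun t F =>
    aemeasurable_pi_lambda _ fun i => by
      simp only [hA]
      exact Finset.aemeasurable_fun_sum _ fun j _ => ((he.law _).aemeasurable).const_mul _
  have hXmeas : ∀ t : Fin n → ℤ, AEMeasurable (fun ω i => X (t i) ω) P := fun t =>
    aemeasurable_pi_lambda _ fun i => (hX.memLp (t i)).1.aemeasurable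
  have hlim : ∀ t : Fin n → ℤ, TendstoInMeasure P (A t) atTop fun ω i => X (t i) ω := by
    intro t
    refine tendstoInMeasure_of_tendsto_eLpNorm (p := 2) two_ne_zero
      (fun F => (hAmeas t F).aestronglyMeasurable) (hXmeas t).aestronglyMeasurable ?_
    have hz : Tendsto (fun F : Finset ℤ => ∑ i : Fin n, eLpNorm (fun ω =>
        (∑ j ∈ F, (fourierCoeff G j).re * e (j + t i) ω) - X (t i) ω) 2 P) atTop (𝓝 0) := by
      simpa using tendsto_finsetSum (Finset.univ : Finset (Fin n))
        fun i _ => hX.tendsto_sum_noise hU (t i)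
    refine tendsto_of_tendsto_of_tendsto_of_le_of_le tendsto_const_nhds hz (fun _ => zero_le)
      fun F => ?_
    have hm : ∀ i : Fin n, AEStronglyMeasurable (fun ω =>
        (∑ j ∈ F, (fourierCoeff G j).re * e (j + t i) ω) - X (t i) ω) P := fun i =>
      (((aemeasurable_pi_iff.1 (hAmeas t F)) i).sub
        (hX.memLp (t i)).1.aemeasurable).aestronglyMeasurable
    calc eLpNorm (A t F - fun ω i => X (t i) ω) 2 P
        ≤ eLpNorm (∑ i : Fin n, fun ω =>
          ‖(∑ j ∈ F, (fourierCoeff G j).re * e (j + t i) ω) - X (t i) ω‖) 2 P := by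
          refine eLpNorm_mono fun ω => ?_
          rw [Finset.sum_apply, Real.norm_of_nonneg (Finset.sum_nonneg fun i _ => norm_nonneg _)]
          refine (pi_norm_le_iff_of_nonneg (Finset.sum_nonneg fun i _ => norm_nonneg _)).2
            fun i => ?_
          exact Finset.single_le_sum (f := fun i =>
            ‖(∑ j ∈ F, (fourierCoeff G j).re * e (j + t i) ω) - X (t i) ω‖)
            (fun i _ => norm_nonneg _) (Finset.mem_univ i)
      _ ≤ ∑ i : Fin n, eLpNorm (fun ω =>
          ‖(∑ j ∈ F, (fourierCoeff G j).re * e (j + t i) ω) - X (t i) ω‖) 2 P :=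
          eLpNorm_sum_le (fun i _ => (hm i).norm) one_le_two
      _ = _ := Finset.sum_congr rfl fun i _ => eLpNorm_norm _
  have hident : ∀ F, IdentDistrib (A t F) (A (fun i => t i + h) F) P P := by
    intro F
    have hmeas : Measurable fun (y : ℤ → ℝ) (i : Fin n) =>
        ∑ j ∈ F, (fourierCoeff G j).re * y (j + t i) :=
      measurable_pi_lambda _ fun i => Finset.measurable_fun_sum _ fun j _ =>
        (measurable_pi_apply _).const_mul _
    have := (he.identDistrib_shift h).comp hmeas
    simpa only [hA, Function.comp_def, add_assoc] using this
  have h1 := (hlim t).tendstoInDistribution (hAmeas t)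
  have h2 := (hlim fun i => t i + h).tendstoInDistribution (hAmeas _)
  have h3 : TendstoInDistribution (A t) atTop (fun ω i => X (t i + h) ω) (fun _ => P) P := by
    refine ⟨hAmeas t, hXmeas _, ?_⟩
    have := h2.tendsto
    refine this.congr fun F => ?_
    exact Subtype.ext (hident F).map_eq.symm
  exact ⟨hXmeas t, hXmeas _, tendstoInDistribution_unique _ h1 h3⟩

end StrictStationarity

/-! ### Stationary autoregressive moving average processes -/

section ARMA

/-- A bounded solution on `ℤ` of a homogeneous linear recurrence whose characteristic polynomial
has no zero on the unit circle vanishes. -/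
theorem eq_zero_of_bounded_of_recurrence {V : Type*} [NormedAddCommGroup V] [NormedSpace ℂ V]
    (B : Module.End ℂ (ℤ → V)) (hB : ∀ D t, B D t = D (t - 1)) (p : Polynomial ℂ)
    (hp : ∀ z : ℂ, ‖z‖ = 1 → p.eval z ≠ 0) {D : ℤ → V} {C : ℝ} (hD : ∀ t, ‖D t‖ ≤ C)
    (h : Polynomial.aeval B p D = 0) : D = 0 := by
  induction hn : p.natDegree generalizing p D C with
  | zero =>
    have hc : p.coeff 0 ≠ 0 := by
      have := hp 1 (by simp)
      rwa [Polynomial.eq_C_of_natDegree_eq_zero hn, Polynomial.eval_C] at this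
    rw [Polynomial.eq_C_of_natDegree_eq_zero hn, Polynomial.aeval_C,
      Module.algebraMap_end_apply] at h
    exact (smul_eq_zero.1 h).resolve_left hc
  | succ n ih =>
    have hdeg : p.degree ≠ 0 := by
      intro h
      rw [Polynomial.natDegree_eq_of_degree_eq_some (n := 0) (by simpa using h)] at hn
      omega
    obtain ⟨r, hr⟩ := IsAlgClosed.exists_root p hdeg
    obtain ⟨q, rfl⟩ := Polynomial.dvd_iff_isRoot.2 hr
    have hr1 : ‖r‖ ≠ 1 := fun h => hp r h hr
    have hq : q ≠ 0 := by rintro rfl; simp at hn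
    -- the bounded solution `E` of the first order recurrence `E (t - 1) = r • E t` vanishes
    have hfirst : ∀ E : ℤ → V, ∀ C, (∀ t, ‖E t‖ ≤ C) → (∀ t, E (t - 1) = r • E t) → E = 0 := by
      intro E C hE hrec
      have hC : 0 ≤ C := (norm_nonneg _).trans (hE 0)
      funext t
      rw [Pi.zero_apply, ← norm_le_zero_iff]
      rcases lt_or_gt_of_ne hr1 with hlt | hgt
      · have hpow : ∀ n : ℕ, ‖E t‖ ≤ ‖r‖ ^ n * C := by
          have : ∀ (n : ℕ) t, E t = r ^ n • E (t + n) := by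
            intro n
            induction n with
            | zero => intro t; simp
            | succ n ihn =>
              intro t
              have h1 := hrec (t + n + 1)
              rw [add_sub_cancel_right] at h1
              rw [ihn t, h1, smul_smul, pow_succ]
              push_cast
              rw [add_assoc]
          intro n
          rw [this n t, norm_smul, norm_pow]
          exact mul_le_mul_of_nonneg_left (hE _) (by positivity)
        have hlim : Tendsto (fun n : ℕ => ‖r‖ ^ n * C) atTop (𝓝 0) := by
          simpa using (tendsto_pow_atTop_nhds_zero_of_lt_one (norm_nonneg r) hlt).mul_const C
        exact ge_of_tendsto hlim (Eventually.of_forall hpow)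
      · have hpow : ∀ n : ℕ, ‖E t‖ ≤ (‖r‖⁻¹) ^ n * C := by
          have : ∀ (n : ℕ) t, E (t - n) = r ^ n • E t := by
            intro n
            induction n with
            | zero => intro t; simp
            | succ n ihn =>
              intro t
              have h1 := hrec (t - n)
              rw [ihn t, smul_smul, ← pow_succ', sub_sub] at h1
              push_cast
              exact h1
          intro n
          have h2 : ‖E (t - n)‖ = ‖r‖ ^ n * ‖E t‖ := by rw [this n t, norm_smul, norm_pow]
          have h3 : 0 < ‖r‖ ^ n := by positivity
          rw [inv_pow, inv_mul_eq_div, le_div_iff₀ h3, mul_comm, ← h2]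
          exact hE _
        have hlim : Tendsto (fun n : ℕ => (‖r‖⁻¹) ^ n * C) atTop (𝓝 0) := by
          simpa using (tendsto_pow_atTop_nhds_zero_of_lt_one (by positivity)
            (inv_lt_one_of_one_lt₀ hgt)).mul_const C
        exact ge_of_tendsto hlim (Eventually.of_forall hpow)
    have hbdd : ∀ p : Polynomial ℂ, ∃ C', ∀ t, ‖Polynomial.aeval B p D t‖ ≤ C' := by
      intro p
      have hpowB : ∀ (k : ℕ) t, (B ^ k) D t = D (t - k) := by
        intro k
        induction k with
        | zero => intro t; simp
        | succ k ihk =>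
          intro t
          rw [pow_succ', Module.End.mul_apply, hB, ihk]
          congr 1
          push_cast
          ring
      refine ⟨∑ k ∈ Finset.range (p.natDegree + 1), ‖p.coeff k‖ * C, fun t => ?_⟩
      rw [Polynomial.aeval_eq_sum_range, LinearMap.sum_apply, Finset.sum_apply]
      refine (norm_sum_le _ _).trans (Finset.sum_le_sum fun k _ => ?_)
      rw [LinearMap.smul_apply, Pi.smul_apply, norm_smul, hpowB]
      exact mul_le_mul_of_nonneg_left (hD _) (norm_nonneg _)
    obtain ⟨C', hC'⟩ := hbdd q
    have hqD : Polynomial.aeval B q D = 0 := by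
      refine hfirst _ C' hC' fun t => ?_
      rw [map_mul, Module.End.mul_apply, map_sub, Polynomial.aeval_X, Polynomial.aeval_C,
        LinearMap.sub_apply, Module.algebraMap_end_apply] at h
      have := congrFun h t
      rw [Pi.sub_apply, hB, Pi.smul_apply, Pi.zero_apply, sub_eq_zero] at this
      exact this
    refine ih q (fun z hz h0 => hp z hz ?_) hD hqD ?_
    · rw [Polynomial.eval_mul, h0, mul_zero]
    · rw [Polynomial.natDegree_mul (Polynomial.X_sub_C_ne_zero r) hq,
        Polynomial.natDegree_X_sub_C] at hn
      omega

variable {Ω : Type*} [MeasurableSpace Ω] {P : Measure Ω} {v : NNReal}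
  {e ν : ℤ → Ω → ℝ} {U : Lp ℂ 2 haarC →L[ℂ] Lp ℂ 2 P} {Φ Θ : Polynomial ℝ}

/-- The transfer function `Θ(e^{-ix}) / Φ(e^{-ix})` of an ARMA process. -/
noncomputable def armaTransfer (Φ Θ : Polynomial ℝ) (x : Circ) : ℂ :=
  Polynomial.aeval (zed x) Θ / Polynomial.aeval (zed x) Φ

theorem continuous_aeval_zed (p : Polynomial ℝ) :
    Continuous fun x : Circ => Polynomial.aeval (zed x) p :=
  (Polynomial.continuous_aeval p).comp continuous_zed

theorem continuous_armaTransfer (hΦ : ∀ z : ℂ, ‖z‖ = 1 → Polynomial.aeval z Φ ≠ 0) :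
    Continuous (armaTransfer Φ Θ) :=
  (continuous_aeval_zed Θ).div (continuous_aeval_zed Φ) fun x => hΦ _ (norm_zed x)

theorem armaGain_eq (Φ Θ : Polynomial ℝ) (x : ℝ) :
    armaGain Φ Θ x = ‖armaTransfer Φ Θ (x : Circ)‖ ^ 2 := by
  rw [armaGain, armaTransfer, zed_coe]

theorem partialEval_natDegree (p : Polynomial ℝ) (w : ℂ) :
    partialEval (PowerSeries.map Complex.ofRealHom (p : PowerSeries ℝ)) (p.natDegree + 1) w =
      Polynomial.aeval w p := by
  rw [partialEval, Polynomial.aeval_eq_sum_range]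
  refine Finset.sum_congr rfl fun k _ => ?_
  rw [PowerSeries.coeff_map, Polynomial.coeff_coe, Complex.ofRealHom_eq_coe, Complex.real_smul]

theorem IsCovStationary.eLpNorm_eq [IsProbabilityMeasure P] (hν : IsCovStationary P ν) (t : ℤ) :
    eLpNorm (ν t) 2 P = eLpNorm (ν 0) 2 P := by
  have hsq : ∀ t, ∫ ω, ν t ω ^ 2 ∂P = covariance (ν t) (ν t) P + (∫ ω, ν t ω ∂P) ^ 2 := fun t => by
    rw [covariance_eq_sub (hν.memLp t) (hν.memLp t)]
    simp only [Pi.mul_apply, sq]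
    ring
  have hcov := hν.cov_eq t 0
  rw [add_zero] at hcov
  have h : ∀ t, eLpNorm (ν t) 2 P = ENNReal.ofReal ((∫ ω, ν t ω ^ 2 ∂P) ^ ((2 : ℝ)⁻¹)) := fun t => by
    have := (hν.memLp t).eLpNorm_eq_integral_rpow_norm two_ne_zero (by simp)
    simpa using this
  rw [h, h, hsq, hsq, hcov, hν.mean_eq t]

/-- A covariance stationary solution of the ARMA equation has the transfer function
`Θ(e^{-ix}) / Φ(e^{-ix})`: the difference to the process with this transfer function is a bounded
solution of the homogeneous equation. -/
theorem IsStationaryARMA.hasTransfer [IsProbabilityMeasure P] (hν : IsStationaryARMA P Φ Θ e ν)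
    (hU : IsSpectralIsometry P v e U) : HasTransfer P U ν (armaTransfer Φ Θ) := by
  have hg : MemLp (armaTransfer Φ Θ) 2 haarC :=
    memLp_of_continuous (continuous_armaTransfer hν.ar_ne_zero)
  refine ⟨hg, ?_⟩
  have hνc : ∀ t, MemLp (fun ω => (ν t ω : ℂ)) 2 P := fun t => (hν.stationary.memLp t).ofReal
  set N : ℤ → Lp ℂ 2 P := fun t => (hνc t).toLp with hN
  set W : ℤ → Lp ℂ 2 P := fun t =>
    U ((memLp_fourier_mul hg t).toLp fun x => fourier t x * armaTransfer Φ Θ x) with hW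
  set B : Module.End ℂ (ℤ → Lp ℂ 2 P) := LinearMap.funLeft ℂ _ (fun t : ℤ => t - 1) with hBdef
  have hB : ∀ D t, B D t = D (t - 1) := fun D t => rfl
  have hpowB : ∀ (k : ℕ) (D : ℤ → Lp ℂ 2 P) t, (B ^ k) D t = D (t - k) := by
    intro k
    induction k with
    | zero => intro D t; simp
    | succ k ihk =>
      intro D t
      rw [pow_succ', Module.End.mul_apply, hB, ihk]
      congr 1
      push_cast
      ring
  set p : Polynomial ℂ := Φ.map (algebraMap ℝ ℂ) with hp
  have hpdeg : p.natDegree = Φ.natDegree := Polynomial.natDegree_map _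
  have haeval : ∀ (D : ℤ → Lp ℂ 2 P) t, Polynomial.aeval B p D t =
      ∑ k ∈ Finset.range (Φ.natDegree + 1), ((Φ.coeff k : ℝ) : ℂ) • D (t - k) := by
    intro D t
    rw [Polynomial.aeval_eq_sum_range, LinearMap.sum_apply, Finset.sum_apply, hpdeg]
    refine Finset.sum_congr rfl fun k _ => ?_
    rw [LinearMap.smul_apply, Pi.smul_apply, hpowB, hp, Polynomial.coeff_map]
    rfl
  have hcoe : ∀ (D : ℤ → Lp ℂ 2 P) (n : ℕ) t,
      ((∑ k ∈ Finset.range n, ((Φ.coeff k : ℝ) : ℂ) • D (t - k) : Lp ℂ 2 P) : Ω → ℂ) =ᵐ[P]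
        fun ω => ∑ k ∈ Finset.range n, ((Φ.coeff k : ℝ) : ℂ) * D (t - k) ω := by
    intro D n t
    induction n with
    | zero =>
      rw [Finset.sum_range_zero]
      filter_upwards [Lp.coeFn_zero ℂ 2 P] with ω hω
      rw [hω, Pi.zero_apply, Finset.sum_range_zero]
    | succ n ih =>
      rw [Finset.sum_range_succ]
      filter_upwards [ih, Lp.coeFn_add (∑ k ∈ Finset.range n, ((Φ.coeff k : ℝ) : ℂ) • D (t - k))
        (((Φ.coeff n : ℝ) : ℂ) • D (t - n)), Lp.coeFn_smul ((Φ.coeff n : ℝ) : ℂ) (D (t - n))]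
        with ω h1 h2 h3
      rw [h2, Pi.add_apply, h1, h3, Pi.smul_apply, Finset.sum_range_succ, smul_eq_mul]
  -- `Φ(B)` maps the process with transfer function `Θ / Φ` to `Θ(B) e`
  have hWΦ : ∀ t, ∑ k ∈ Finset.range (Φ.natDegree + 1), ((Φ.coeff k : ℝ) : ℂ) • W (t - k) =
      U ((memLp_fourier_mul (memLp_partialEval_mul (memLp_const 1)
        (PowerSeries.map Complex.ofRealHom (Θ : PowerSeries ℝ)) (Θ.natDegree + 1)) t).toLp
        fun x => fourier t x * (partialEval (PowerSeries.map Complex.ofRealHom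
          (Θ : PowerSeries ℝ)) (Θ.natDegree + 1) (zed x) * 1)) := by
    intro t
    simp only [hW]
    simp only [← map_smul, ← map_sum, ← MemLp.toLp_const_smul]
    congr 1
    have hfs : ∀ n : ℕ, ∃ h : MemLp (fun x => ∑ k ∈ Finset.range n, ((Φ.coeff k : ℝ) : ℂ) *
        (fourier (t - k) x * armaTransfer Φ Θ x)) 2 haarC,
        ∑ k ∈ Finset.range n, ((memLp_fourier_mul hg (t - k)).const_smul
          ((Φ.coeff k : ℝ) : ℂ)).toLp (((Φ.coeff k : ℝ) : ℂ) •
            fun x => fourier (t - k) x * armaTransfer Φ Θ x) = h.toLp := by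
      intro n
      induction n with
      | zero =>
        have h0 : MemLp (fun x : Circ => ∑ k ∈ Finset.range 0, ((Φ.coeff k : ℝ) : ℂ) *
            (fourier (t - k) x * armaTransfer Φ Θ x)) 2 haarC := by
          simpa only [Finset.sum_range_zero] using memLp_const (0 : ℂ)
        refine ⟨h0, ?_⟩
        rw [Finset.sum_range_zero]
        apply Lp.ext
        filter_upwards [Lp.coeFn_zero ℂ 2 haarC, h0.coeFn_toLp] with x h1 h2
        rw [h1, h2, Finset.sum_range_zero, Pi.zero_apply]
      | succ n ih =>
        obtain ⟨h, ih⟩ := ih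
        have h2 := (memLp_fourier_mul hg (t - n)).const_smul ((Φ.coeff n : ℝ) : ℂ)
        refine ⟨?_, ?_⟩
        · simp only [Finset.sum_range_succ]
          exact h.add h2
        · rw [Finset.sum_range_succ, ih, ← MemLp.toLp_add, MemLp.toLp_eq_toLp_iff]
          refine Eventually.of_forall fun x => ?_
          simp only [Pi.add_apply, Finset.sum_range_succ, Pi.smul_apply, smul_eq_mul]
    obtain ⟨h, hsum⟩ := hfs (Φ.natDegree + 1)
    rw [hsum, MemLp.toLp_eq_toLp_iff]
    refine Eventually.of_forall fun x => ?_
    have hΦx := hν.ar_ne_zero (zed x) (norm_zed x)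
    simp only
    rw [partialEval_natDegree, mul_one]
    have h1 : ∑ k ∈ Finset.range (Φ.natDegree + 1), ((Φ.coeff k : ℝ) : ℂ) *
        (fourier (t - k) x * armaTransfer Φ Θ x) =
        fourier t x * (Polynomial.aeval (zed x) Φ * armaTransfer Φ Θ x) := by
      rw [Polynomial.aeval_eq_sum_range, Finset.sum_mul, Finset.mul_sum]
      refine Finset.sum_congr rfl fun k _ => ?_
      rw [zed_pow, sub_eq_add_neg, fourier_add, Complex.real_smul]
      ring
    rw [h1, armaTransfer, mul_div_cancel₀ _ hΦx]
  have hNΦ : ∀ t, ∑ k ∈ Finset.range (Φ.natDegree + 1), ((Φ.coeff k : ℝ) : ℂ) • N (t - k) =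
      ∑ k ∈ Finset.range (Φ.natDegree + 1), ((Φ.coeff k : ℝ) : ℂ) • W (t - k) := by
    intro t
    rw [hWΦ]
    apply Lp.ext
    have h1 : ∀ᵐ ω ∂P, ∀ k : ℕ, N (t - k) ω = (ν (t - k) ω : ℂ) :=
      ae_all_iff.2 fun k => (hνc (t - k)).coeFn_toLp
    filter_upwards [hcoe N (Φ.natDegree + 1) t, h1, hν.eqn t,
      hU.hasTransfer_noise.partialSum_ae_eq (Θ : PowerSeries ℝ) (Θ.natDegree + 1) t]
      with ω h2 h3 h4 h5
    rw [h2, ← h5]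
    simp only [h3]
    rw [polyFilter, polyFilter] at h4
    simp only [Polynomial.coeff_coe]
    rw [← h4]
    push_cast
    rfl
  have hD0 : N - W = 0 := by
    refine eq_zero_of_bounded_of_recurrence B hB p (fun z hz => ?_) (D := N - W)
      (C := (eLpNorm (ν 0) 2 P).toReal + Real.sqrt v * (eLpNorm (armaTransfer Φ Θ) 2 haarC).toReal)
      (fun t => ?_) ?_
    · rw [hp, Polynomial.eval_map_algebraMap]
      exact hν.ar_ne_zero z hz
    · refine (norm_sub_le _ _).trans (add_le_add (le_of_eq ?_) (le_of_eq ?_))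
      · rw [hN, Lp.norm_toLp, ← hν.stationary.eLpNorm_eq t]
        congr 1
        refine eLpNorm_congr_norm_ae (Eventually.of_forall fun ω => ?_)
        rw [Complex.norm_real]
      · rw [hW, hU.norm_map, Lp.norm_toLp]
        congr 2
        refine eLpNorm_congr_norm_ae (Eventually.of_forall fun x => ?_)
        rw [norm_mul, norm_fourier_apply, one_mul]
    · funext t
      rw [map_sub, Pi.sub_apply, haeval, haeval, hNΦ, sub_self, Pi.zero_apply]
  intro t
  have := congrFun hD0 t
  rw [Pi.sub_apply, Pi.zero_apply, sub_eq_zero] at this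
  have h1 := (hνc t).coeFn_toLp
  filter_upwards [h1] with ω hω
  rw [← hω]
  change N t ω = W t ω
  rw [this]

end ARMA

/-! ### Solutions of the seasonal fractional equation -/

section Solutions

open PowerSeries

variable {Ω : Type*} [MeasurableSpace Ω] {P : Measure Ω} {v : NNReal} {e ν X : ℤ → Ω → ℝ}
  {U : Lp ℂ 2 haarC →L[ℂ] Lp ℂ 2 P} {Φ Θ : Polynomial ℝ} {s : Fin 2 → ℕ} {d : Fin 2 → ℝ}

/-- The transfer function `(1 - z ^ s₁) ^ d₁ * (1 - z ^ s₂) ^ d₂` at `z = e^{-ix}`. -/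
noncomputable def seasonalTransfer (s : Fin 2 → ℕ) (d : Fin 2 → ℝ) (x : Circ) : ℂ :=
  bdry (s 0) (d 0) x * bdry (s 1) (d 1) x

theorem map_nablaSeries (s : Fin 2 → ℕ) (d : Fin 2 → ℝ) :
    PowerSeries.map Complex.ofRealHom (nablaSeries s d) =
      cseas (s 0) (d 0) * cseas (s 1) (d 1) := by
  rw [nablaSeries, Fin.prod_univ_two, map_mul]
  rfl

theorem map_coe_polynomial (p : Polynomial ℝ) :
    PowerSeries.map Complex.ofRealHom (p : PowerSeries ℝ) =
      ((p.map Complex.ofRealHom : Polynomial ℂ) : PowerSeries ℂ) :=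
  (Polynomial.polynomial_map_coe).symm

theorem eval_map_ofRealHom (p : Polynomial ℝ) (w : ℂ) :
    (p.map Complex.ofRealHom).eval w = Polynomial.aeval w p := by
  rw [Polynomial.eval_map]
  rfl

/-- Mean square convergence is preserved under multiplication by a bounded function. -/
theorem tendsto_eLpNorm_mul_of_bounded {F : ℕ → Circ → ℂ} {H g : Circ → ℂ} {C : ℝ}
    (hg : ∀ x, ‖g x‖ ≤ C)
    (h : Tendsto (fun n => eLpNorm (fun x => F n x - H x) 2 haarC) atTop (𝓝 0)) :
    Tendsto (fun n => eLpNorm (fun x => F n x * g x - H x * g x) 2 haarC) atTop (𝓝 0) := by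
  have hlim := ENNReal.Tendsto.const_mul (a := ENNReal.ofReal C) h (Or.inr ENNReal.ofReal_ne_top)
  rw [mul_zero] at hlim
  refine tendsto_of_tendsto_of_tendsto_of_le_of_le tendsto_const_nhds hlim (fun _ => zero_le)
    fun n => eLpNorm_le_mul_eLpNorm_of_ae_le_mul (Eventually.of_forall fun x => ?_) 2
  rw [← sub_mul, norm_mul, mul_comm]
  exact mul_le_mul_of_nonneg_right (hg x) (norm_nonneg _)

theorem exists_norm_le_of_continuous {g : Circ → ℂ} (hg : Continuous g) : ∃ C, ∀ x, ‖g x‖ ≤ C := by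
  obtain ⟨C, hC⟩ := isCompact_univ.exists_bound_of_continuousOn hg.continuousOn
  exact ⟨C, fun x => hC x (Set.mem_univ x)⟩

theorem memLp_seasonalTransfer (hs : ∀ i, 0 < s i) (h₁₂ : |d 0 + d 1| < 1 / 2)
    (h : ∀ i, |d i| < 1 / 2) : MemLp (seasonalTransfer s (-d)) 2 haarC := by
  have h0 := abs_lt.1 (h 0)
  have h1 := abs_lt.1 (h 1)
  have h2 := abs_lt.1 h₁₂
  exact memLp_bdry_mul_bdry (hs 0) (hs 1) (by simp only [Pi.neg_apply]; linarith)
    (by simp only [Pi.neg_apply]; linarith) (by simp only [Pi.neg_apply]; linarith)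

theorem tendsto_partialEval_nabla_neg (hs : ∀ i, 0 < s i) (h₁₂ : |d 0 + d 1| < 1 / 2)
    (h : ∀ i, |d i| < 1 / 2) {g : Circ → ℂ} (hg : Continuous g) :
    Tendsto (fun n => eLpNorm (fun x =>
      partialEval (PowerSeries.map Complex.ofRealHom (nablaSeries s (-d))) n (zed x) * g x -
        seasonalTransfer s (-d) x * g x) 2 haarC) atTop (𝓝 0) := by
  obtain ⟨C, hC⟩ := exists_norm_le_of_continuous hg
  rw [map_nablaSeries]
  exact tendsto_eLpNorm_mul_of_bounded hC
    ((isBoundaryFunction_cseas (hs 0) (hs 1) _ _).tendsto_partialEval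
      (memLp_seasonalTransfer hs h₁₂ h))

theorem tendsto_partialEval_nabla_inverse (hs : ∀ i, 0 < s i) (h₁₂ : |d 0 + d 1| < 1 / 2)
    (h : ∀ i, |d i| < 1 / 2) {g : Circ → ℂ} (hg : Continuous g) :
    Tendsto (fun n => eLpNorm (fun x =>
      partialEval (PowerSeries.map Complex.ofRealHom (nablaSeries s d)) n (zed x) *
        (seasonalTransfer s (-d) x * g x) - g x) 2 haarC) atTop (𝓝 0) := by
  obtain ⟨C, hC⟩ := exists_norm_le_of_continuous hg
  have := tendsto_eLpNorm_mul_of_bounded hC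
    (tendsto_partialEval_inverse (hs 0) (hs 1) (h 0) (h 1) h₁₂)
  rw [map_nablaSeries]
  simpa only [one_mul, mul_assoc, seasonalTransfer, Pi.neg_apply] using this

/-- If `Θ` has no zero in the closed unit disc, the series of
`Φ / Θ * (1 - z ^ s₁) ^ d₁ * (1 - z ^ s₂) ^ d₂` recovers the noise in mean square. -/
theorem tendsto_partialEval_arma_inverse (hs : ∀ i, 0 < s i) (h₁₂ : |d 0 + d 1| < 1 / 2)
    (h : ∀ i, |d i| < 1 / 2) (hΦ : ∀ z : ℂ, ‖z‖ = 1 → Polynomial.aeval z Φ ≠ 0)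
    (hΘ : ∀ z : ℂ, ‖z‖ ≤ 1 → Polynomial.aeval z Θ ≠ 0) :
    Tendsto (fun n => eLpNorm (fun x =>
      partialEval (PowerSeries.map Complex.ofRealHom
        ((Φ : PowerSeries ℝ) * (Θ : PowerSeries ℝ)⁻¹ * nablaSeries s d)) n (zed x) *
        (seasonalTransfer s (-d) x * armaTransfer Φ Θ x) - 1) 2 haarC) atTop (𝓝 0) := by
  have hg := continuous_armaTransfer (Θ := Θ) hΦ
  obtain ⟨C, hC⟩ := exists_norm_le_of_continuous hg
  have hW : MemLp (fun x => seasonalTransfer s (-d) x * armaTransfer Φ Θ x) 2 haarC := by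
    simpa only [mul_comm] using memLp_of_bounded_mul (memLp_seasonalTransfer hs h₁₂ h)
      hg.aestronglyMeasurable hC
  set p := Φ.map Complex.ofRealHom with hp
  set q := Θ.map Complex.ofRealHom with hq
  have hq0 : ∀ z : ℂ, ‖z‖ ≤ 1 → q.eval z ≠ 0 := fun z hz => by
    rw [hq, eval_map_ofRealHom]; exact hΘ z hz
  have hc0 : constantCoeff (q : PowerSeries ℂ) ≠ 0 := by
    have := hq0 0 (by simp)
    rwa [← Polynomial.coeff_zero_eq_eval_zero, ← Polynomial.coeff_coe,
      coeff_zero_eq_constantCoeff_apply] at this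
  have hr0 : constantCoeff (Θ : PowerSeries ℝ) ≠ 0 := by
    intro h0
    apply hc0
    rw [hq, ← map_coe_polynomial, ← coeff_zero_eq_constantCoeff_apply, coeff_map,
      coeff_zero_eq_constantCoeff_apply, h0, map_zero]
  have hinv : PowerSeries.map Complex.ofRealHom (Θ : PowerSeries ℝ)⁻¹ = (q : PowerSeries ℂ)⁻¹ := by
    rw [PowerSeries.eq_inv_iff_mul_eq_one hc0, hq, ← map_coe_polynomial, ← map_mul,
      PowerSeries.inv_mul_cancel _ hr0, map_one]
  have hAp := absSummable_polynomial p
  have hAq := absSummable_inv_polynomial q hq0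
  have hlim := tendsto_eLpNorm_partialEval_mul (hAp.mul hAq) hW (memLp_of_continuous hg)
    (tendsto_partialEval_nabla_inverse hs h₁₂ h hg)
  rw [map_mul, map_mul, hinv, map_coe_polynomial, ← hp]
  refine hlim.congr fun n => eLpNorm_congr_ae (Eventually.of_forall fun x => ?_)
  have hz := (norm_zed x).le
  have h1 : seriesEval (q : PowerSeries ℂ)⁻¹ (zed x) * Polynomial.aeval (zed x) Θ = 1 := by
    rw [← eval_map_ofRealHom, ← hq, ← seriesEval_polynomial,
      ← seriesEval_mul hAq (absSummable_polynomial q) hz, PowerSeries.inv_mul_cancel _ hc0,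
      ← Polynomial.coe_one, seriesEval_polynomial, Polynomial.eval_one]
  have h2 : seriesEval ((p : PowerSeries ℂ) * (q : PowerSeries ℂ)⁻¹) (zed x) *
      armaTransfer Φ Θ x = 1 := by
    rw [seriesEval_mul hAp hAq hz, seriesEval_polynomial, hp, eval_map_ofRealHom, armaTransfer]
    have h3 := hΦ (zed x) (norm_zed x)
    field_simp
    exact h1
  rw [h2]

/-- A square-integrable limit of the partial sums of the series `c`, times a polynomial, has the
Fourier coefficients of the product of `c` and the polynomial. -/
theorem cf_eq_extCoeff_of_tendsto {c : PowerSeries ℂ} {p : Polynomial ℂ} {H : Circ → ℂ}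
    (hH : MemLp H 2 haarC)
    (h : Tendsto (fun n => eLpNorm (fun x =>
      partialEval c n (zed x) * p.eval (zed x) - H x) 2 haarC) atTop (𝓝 0)) (k : ℤ) :
    cf H k = extCoeff (c * p) k := by
  have hcont : ∀ n, Continuous fun x : Circ => partialEval c n (zed x) * p.eval (zed x) := fun n =>
    (continuous_partialEval c n).mul (p.continuous.comp continuous_zed)
  have hF : ∀ n, MemLp (fun x : Circ => partialEval c n (zed x) * p.eval (zed x)) 2 haarC :=
    fun n => memLp_of_continuous (hcont n)
  have hlim : Tendsto (fun n => cf (fun x => partialEval c n (zed x) * p.eval (zed x)) k) atTop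
      (𝓝 (cf H k)) := by
    refine tendsto_integral_of_L1' (fun x => fourier k x * H x)
      (memLp_fourier_mul hH k).1 (Eventually.of_forall fun n =>
        (memLp_fourier_mul (hF n) k).integrable one_le_two) ?_
    refine tendsto_of_tendsto_of_tendsto_of_le_of_le tendsto_const_nhds h (fun _ => zero_le)
      fun n => ?_
    refine (eLpNorm_le_eLpNorm_of_exponent_le one_le_two
      ((memLp_fourier_mul (hF n) k).1.sub (memLp_fourier_mul hH k).1)).trans (le_of_eq ?_)
    refine eLpNorm_congr_norm_ae (Eventually.of_forall fun x => ?_)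
    simp only [Pi.sub_apply]
    rw [← mul_sub, norm_mul, norm_fourier_apply, one_mul]
  refine tendsto_nhds_unique hlim (tendsto_const_nhds.congr' ?_)
  filter_upwards [eventually_gt_atTop k.toNat] with n hn
  have h1 : (fun x : Circ => partialEval c n (zed x) * p.eval (zed x)) = fun x =>
      seriesEval ((trunc n c * p : Polynomial ℂ) : PowerSeries ℂ) (zed x) := by
    funext x
    rw [seriesEval_polynomial, Polynomial.eval_mul, partialEval, Polynomial.eval₂_id.symm,
      Polynomial.eval₂_id.symm, eval₂_trunc_eq_sum_range]
    rfl
  rw [h1, cf_seriesEval (absSummable_polynomial _), extCoeff, extCoeff]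
  split_ifs with hk
  · rw [Polynomial.coe_mul, coeff_mul, coeff_mul]
    refine Finset.sum_congr rfl fun ij hij => ?_
    rw [coeff_coe_trunc_of_lt]
    have := Finset.HasAntidiagonal.mem_antidiagonal.1 hij
    omega
  · rfl

/-- Every solution has the transfer function of the fractional filter times that of the ARMA
process, whether or not the memory parameters guarantee that a solution exists. -/
theorem IsFilterOutput.hasTransfer_seasonal (hs : ∀ i, 0 < s i)
    (hΦ : ∀ z : ℂ, ‖z‖ = 1 → Polynomial.aeval z Φ ≠ 0)
    (hX : IsFilterOutput P (nablaSeries s (-d)) ν X) (hν : HasTransfer P U ν (armaTransfer Φ Θ))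
    (hU : IsSpectralIsometry P v e U) (hv : v ≠ 0) :
    HasTransfer P U X fun x => seasonalTransfer s (-d) x * armaTransfer Φ Θ x := by
  obtain ⟨H, hH, hlim⟩ := hX.exists_tendsto hν hU hv
  refine (hX.hasTransfer hν hU hH hlim).congr_ae ?_
  have hcΦ : Continuous fun x : Circ => Polynomial.aeval (zed x) Φ := continuous_aeval_zed Φ
  obtain ⟨C, hC⟩ := exists_norm_le_of_continuous hcΦ
  have h1 := tendsto_eLpNorm_mul_of_bounded hC hlim
  have hHΦ : MemLp (fun x => H x * Polynomial.aeval (zed x) Φ) 2 haarC := by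
    simpa only [mul_comm] using memLp_of_bounded_mul hH hcΦ.aestronglyMeasurable hC
  have h2 := cf_eq_extCoeff_of_tendsto (c := PowerSeries.map Complex.ofRealHom (nablaSeries s (-d)))
    (p := Θ.map Complex.ofRealHom) hHΦ (by
      refine h1.congr fun n => eLpNorm_congr_ae (Eventually.of_forall fun x => ?_)
      simp only
      rw [eval_map_ofRealHom, mul_assoc, armaTransfer, div_mul_cancel₀ _ (hΦ _ (norm_zed x))])
  rw [map_nablaSeries] at h2
  have h3 := (isBoundaryFunction_cseas_mul (hs 0) (hs 1)
    (absSummable_polynomial (Θ.map Complex.ofRealHom)) _ _ _ hHΦ).1 h2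
  filter_upwards [h3] with x hx
  rw [seriesEval_polynomial, eval_map_ofRealHom] at hx
  rw [armaTransfer, seasonalTransfer, ← mul_div_assoc, ← hx, mul_div_cancel_right₀]
  exact hΦ _ (norm_zed x)

end Solutions

/-! ### Uniqueness of the spectral density -/

section SpectralDensity

variable {Ω : Type*} [MeasurableSpace Ω] {P : Measure Ω} {v : NNReal} {e ν X : ℤ → Ω → ℝ}
  {U : Lp ℂ 2 haarC →L[ℂ] Lp ℂ 2 P} {Φ Θ : Polynomial ℝ} {s : Fin 2 → ℕ} {d : Fin 2 → ℝ}

/-- An integrable function on `(-π, π]` whose Fourier coefficients vanish is zero almost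
everywhere: by density of the trigonometric polynomials its integral against every continuous
periodic function vanishes. -/
theorem ae_eq_zero_of_integral_exp_eq_zero {f : ℝ → ℝ}
    (hf : IntegrableOn f (Set.Ioc (-Real.pi) Real.pi))
    (h : ∀ n : ℤ, ∫ x in Set.Ioc (-Real.pi) Real.pi, Complex.exp (Complex.I * n * x) * f x = 0) :
    ∀ᵐ x ∂(volume.restrict (Set.Ioc (-Real.pi) Real.pi)), f x = 0 := by
  set μ := volume.restrict (Set.Ioc (-Real.pi) Real.pi) with hμ
  have hfC : Integrable (fun x => (f x : ℂ)) μ := hf.ofReal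
  have hint : ∀ φ : C(Circ, ℂ), Integrable (fun x : ℝ => φ (x : Circ) * f x) μ := fun φ =>
    hfC.bdd_mul (c := ‖φ‖) (φ.continuous.comp (AddCircle.continuous_mk' _)).aestronglyMeasurable
      (Eventually.of_forall fun x => φ.norm_coe_le_norm _)
  let L : C(Circ, ℂ) →ₗ[ℂ] ℂ :=
    { toFun := fun φ => ∫ x : ℝ, φ (x : Circ) * f x ∂μ
      map_add' := fun φ ψ => by
        simp only [ContinuousMap.add_apply, add_mul]
        exact integral_add (hint φ) (hint ψ)
      map_smul' := fun c φ => by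
        simp only [ContinuousMap.smul_apply, smul_eq_mul, mul_assoc, RingHom.id_apply]
        exact integral_const_mul _ _ }
  let L' : C(Circ, ℂ) →L[ℂ] ℂ := L.mkContinuous (∫ x, ‖f x‖ ∂μ) fun φ => by
    refine (norm_integral_le_integral_norm _).trans ?_
    rw [mul_comm (∫ x, ‖f x‖ ∂μ), ← integral_const_mul]
    refine integral_mono (hint φ).norm (hf.norm.const_mul _) fun x => ?_
    simp only [norm_mul, Complex.norm_real]
    exact mul_le_mul_of_nonneg_right (φ.norm_coe_le_norm _) (norm_nonneg _)
  have hL : ∀ φ, L' φ = 0 := by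
    have hcl : IsClosed (L'.ker : Set C(Circ, ℂ)) := L'.isClosed_ker
    have hle : Submodule.span ℂ (Set.range (fourier (T := 2 * Real.pi))) ≤ L'.ker := by
      rw [Submodule.span_le]
      rintro _ ⟨n, rfl⟩
      change L' (fourier n) = 0
      refine Eq.trans ?_ (h n)
      change ∫ x : ℝ, fourier n (x : Circ) * (f x : ℂ) ∂μ = _
      simp only [fourier_coe_exp]
    have htop := Submodule.topologicalClosure_minimal _ hle hcl
    rw [span_fourier_closure_eq_top] at htop
    exact fun φ => htop (Submodule.mem_top (x := φ))
  have hIoo : ∀ᵐ x ∂(volume : Measure ℝ), x ∈ Set.Ioo (-Real.pi) Real.pi → f x = 0 := by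
    refine isOpen_Ioo.ae_eq_zero_of_integral_contDiff_smul_eq_zero
      (hf.mono_set Set.Ioo_subset_Ioc_self).locallyIntegrableOn fun g hg _ hsupp => ?_
    have hg0 : ∀ x, x ∉ Set.Ioo (-Real.pi) Real.pi → g x = 0 := fun x hx => by
      by_contra h0
      exact hx (hsupp (subset_tsupport g h0))
    have hper : -Real.pi + 2 * Real.pi = Real.pi := by ring
    let φ : C(Circ, ℂ) := ⟨AddCircle.liftIoc (2 * Real.pi) (-Real.pi) fun x => (g x : ℂ),
      AddCircle.liftIoc_continuous (by rw [hper, hg0 _ (by simp), hg0 _ (by simp)])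
        (Complex.continuous_ofReal.comp hg.continuous).continuousOn⟩
    have h1 : ∫ x : ℝ, φ (x : Circ) * f x ∂μ = ((∫ x, g x • f x : ℝ) : ℂ) := by
      have h3 : ∫ x in Set.Ioc (-Real.pi) Real.pi, g x • f x = ∫ x, g x • f x :=
        setIntegral_eq_integral_of_forall_compl_eq_zero fun x hx => by
          rw [hg0 x fun h => hx (Set.Ioo_subset_Ioc_self h), zero_smul]
      rw [← h3, ← integral_complex_ofReal]
      refine setIntegral_congr_fun measurableSet_Ioc fun x hx => ?_
      simp only [smul_eq_mul, Complex.ofReal_mul]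
      congr 1
      exact AddCircle.liftIoc_coe_apply (f := fun x => (g x : ℂ)) (by rwa [hper])
    have h2 : ∫ x : ℝ, φ (x : Circ) * f x ∂μ = 0 := hL φ
    rw [h1] at h2
    exact_mod_cast h2
  rw [hμ, ← restrict_Ioo_eq_restrict_Ioc, ae_restrict_iff' measurableSet_Ioo]
  exact hIoo

theorem IsSpectralDensity.ae_eq {f g : ℝ → ℝ} (hf : IsSpectralDensity P X f)
    (hg : IsSpectralDensity P X g) :
    f =ᵐ[volume.restrict (Set.Ioc (-Real.pi) Real.pi)] g := by
  have hexp : ∀ {f : ℝ → ℝ}, IntegrableOn f (Set.Ioc (-Real.pi) Real.pi) → ∀ n : ℤ,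
      IntegrableOn (fun x : ℝ => Complex.exp (Complex.I * n * x) * (f x : ℂ))
        (Set.Ioc (-Real.pi) Real.pi) := fun hf n =>
    hf.ofReal.bdd_mul (c := 1) (by fun_prop) (Eventually.of_forall fun x => by
      rw [← fourier_coe_exp]; exact (norm_fourier_apply _ _).le)
  have h := ae_eq_zero_of_integral_exp_eq_zero (hf.integrable.sub hg.integrable) fun n => by
    have h1 := hf.cov_eq 0 n
    rw [hg.cov_eq 0 n, intervalIntegral.integral_of_le (by linarith [Real.pi_pos]),
      intervalIntegral.integral_of_le (by linarith [Real.pi_pos])] at h1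
    simp only [Pi.sub_apply, Complex.ofReal_sub, mul_sub]
    rw [integral_sub (hexp hf.integrable n) (hexp hg.integrable n), h1, sub_self]
  filter_upwards [h] with x hx
  exact sub_eq_zero.1 hx

theorem IsSpectralDensity.congr {f g : ℝ → ℝ} (hf : IsSpectralDensity P X f)
    (h : f =ᵐ[volume.restrict (Set.Ioc (-Real.pi) Real.pi)] g) : IsSpectralDensity P X g where
  nonneg := by
    filter_upwards [hf.nonneg, h] with x h1 h2
    rwa [← h2]
  integrable := hf.integrable.congr h
  cov_eq t n := by
    rw [hf.cov_eq t n, intervalIntegral.integral_of_le (by linarith [Real.pi_pos]),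
      intervalIntegral.integral_of_le (by linarith [Real.pi_pos])]
    refine integral_congr_ae ?_
    filter_upwards [h] with x hx
    rw [hx]

theorem norm_seasonalTransfer_neg_sq (s : Fin 2 → ℕ) (d : Fin 2 → ℝ) (x : ℝ) :
    ‖seasonalTransfer s (-d) (x : Circ)‖ ^ 2 = sineFactor s d x := by
  rw [seasonalTransfer, norm_mul, norm_bdry, norm_bdry, norm_one_sub_zed_pow_coe,
    norm_one_sub_zed_pow_coe, sineFactor, Fin.prod_univ_two, mul_pow, ← Real.rpow_natCast,
    ← Real.rpow_natCast, ← Real.rpow_mul (abs_nonneg _), ← Real.rpow_mul (abs_nonneg _)]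
  simp only [Pi.neg_apply]
  congr 2 <;> push_cast <;> ring

/-- With degenerate noise, all processes in question vanish. -/
theorem IsFilterOutput.ae_eq_zero {c : PowerSeries ℝ} {Y : ℤ → Ω → ℝ}
    (hX : IsFilterOutput P c Y X) (hY : ∀ t, Y t =ᵐ[P] 0) (t : ℤ) : X t =ᵐ[P] 0 := by
  obtain ⟨hm, hlim⟩ := hX t
  have h1 : eLpNorm (X t) 2 P = 0 := by
    refine tendsto_nhds_unique (tendsto_const_nhds.congr fun n => eLpNorm_congr_ae ?_) hlim
    filter_upwards [ae_all_iff.2 fun k : ℕ => hY (t - k)] with ω h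
    simp [h]
  exact (eLpNorm_eq_zero_iff hm.1 two_ne_zero).1 h1

theorem HasTransfer.ae_eq_zero {G : Circ → ℂ} (hX : HasTransfer P U X G)
    (hU : IsSpectralIsometry P 0 e U) (t : ℤ) : X t =ᵐ[P] 0 := by
  obtain ⟨hG, h⟩ := hX
  have h0 : U ((memLp_fourier_mul hG t).toLp fun x => fourier t x * G x) = 0 := by
    rw [← norm_eq_zero, hU.norm_map]
    simp
  filter_upwards [h t, Lp.coeFn_zero ℂ 2 P] with ω h1 h2
  rw [h0, h2] at h1
  simpa using h1

/-- The spectral density of a solution with respect to the canonical spectral density of the ARMA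
process. -/
theorem IsFilterOutput.isSpectralDensity [IsProbabilityMeasure P] (hs : ∀ i, 0 < s i)
    (hΦ : ∀ z : ℂ, ‖z‖ = 1 → Polynomial.aeval z Φ ≠ 0)
    (hX : IsFilterOutput P (nablaSeries s (-d)) ν X) (hν : HasTransfer P U ν (armaTransfer Φ Θ))
    (he : IsGaussianNoise P v e) (hU : IsSpectralIsometry P v e U) :
    IsSpectralDensity P X fun x => v / (2 * Real.pi) * armaGain Φ Θ x * sineFactor s d x := by
  rcases eq_or_ne v 0 with rfl | hv
  · have h0 : HasTransfer P U X fun _ => 0 := by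
      refine HasTransfer.congr_process (X := fun _ _ => 0) ⟨memLp_const 0, fun t => ?_⟩
        (hX.ae_eq_zero (hν.ae_eq_zero hU))
      have h1 : U ((memLp_fourier_mul (memLp_const (0 : ℂ)) t).toLp
          fun x => fourier t x * (0 : ℂ)) = 0 := by
        rw [← norm_eq_zero, hU.norm_map]
        simp
      filter_upwards [Lp.coeFn_zero ℂ 2 P] with ω h2
      rw [h1, h2]
      simp
    convert h0.isSpectralDensity hU he using 2
    simp
  · convert (hX.hasTransfer_seasonal hs hΦ hν hU hv).isSpectralDensity hU he using 2 with x
    rw [norm_mul, mul_pow, norm_seasonalTransfer_neg_sq, armaGain_eq]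
    ring

end SpectralDensity

/-! ### The frequency form of the spectral factor -/

section FrequencyFactor

variable {s : Fin 2 → ℕ} {d : Fin 2 → ℝ}

/-- The factor `|2 sin ((x - μ) / 2) * 2 sin ((x + μ) / 2)|` belonging to the frequency `μ`. -/
noncomputable def pairFactor (μ x : ℝ) : ℝ :=
  |(2 * Real.sin ((x - μ) / 2)) * (2 * Real.sin ((x + μ) / 2))|

theorem pairFactor_nonneg (μ x : ℝ) : 0 ≤ pairFactor μ x := abs_nonneg _

theorem norm_zed_sub_zed (x y : ℝ) :
    ‖zed (x : Circ) - zed (y : Circ)‖ = |2 * Real.sin ((x - y) / 2)| := by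
  have h := norm_one_sub_zed_pow_coe 1 (x - y)
  have h1 : zed ((x - y : ℝ) : Circ) * zed (y : Circ) = zed (x : Circ) := by
    rw [zed_coe, zed_coe, zed_coe, ← Complex.exp_add]
    congr 1
    push_cast
    ring
  rw [pow_one, Nat.cast_one, mul_one] at h
  rw [← h, ← h1, ← sub_one_mul, norm_mul, norm_zed, mul_one, norm_sub_rev]

theorem pairFactor_eq_norm (μ x : ℝ) :
    pairFactor μ x = ‖zed (x : Circ) - zed (μ : Circ)‖ * ‖zed (x : Circ) - zed ((-μ : ℝ) : Circ)‖ := by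
  rw [norm_zed_sub_zed, norm_zed_sub_zed, ← abs_mul, sub_neg_eq_add, pairFactor]

theorem freq_zero (m : ℕ) : freq m 0 = 0 := by simp [freq]

theorem freq_half {m : ℕ} (hm : 0 < m) : freq (2 * m) m = Real.pi := by
  have : (m : ℝ) ≠ 0 := by positivity
  rw [freq]
  push_cast
  field_simp

theorem freq_injective {n : ℕ} (hn : 0 < n) : Function.Injective (freq n) := by
  intro i j h
  have h1 : (n : ℝ) ≠ 0 := by positivity
  have h2 := Real.pi_pos.ne'
  rw [freq, freq, div_left_inj' h1] at h
  exact_mod_cast mul_left_cancel₀ (by positivity) h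

/-- Factorisation of `1 - z ^ n` over the `n`-th roots of unity. -/
theorem norm_one_sub_zed_pow_eq_prod {n : ℕ} (hn : 0 < n) (x : ℝ) :
    ‖1 - zed (x : Circ) ^ n‖ = ∏ j ∈ Finset.range n, ‖zed (x : Circ) - zed ((freq n j : ℝ) : Circ)‖ := by
  have : NeZero n := ⟨hn.ne'⟩
  have hζ := (Complex.isPrimitiveRoot_exp n hn.ne').inv
  have h := Polynomial.X_pow_sub_one_eq_prod hn hζ
  have h1 := congrArg (Polynomial.eval (zed (x : Circ))) h
  rw [Polynomial.eval_prod] at h1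
  simp only [Polynomial.eval_sub, Polynomial.eval_pow, Polynomial.eval_X, Polynomial.eval_one,
    Polynomial.eval_C] at h1
  rw [norm_sub_rev, h1, norm_prod]
  refine (Finset.prod_bij (fun j _ => (Complex.exp (2 * Real.pi * Complex.I / n))⁻¹ ^ j)
    (fun j _ => ?_) (fun i hi j hj hij => ?_) (fun z hz => ?_) (fun j _ => ?_)).symm
  · rw [Polynomial.mem_nthRootsFinset hn, pow_right_comm, hζ.pow_eq_one, one_pow]
  · exact hζ.pow_inj (Finset.mem_range.1 hi) (Finset.mem_range.1 hj) hij
  · obtain ⟨j, hj, h⟩ := hζ.eq_pow_of_pow_eq_one ((Polynomial.mem_nthRootsFinset hn _).1 hz)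
    exact ⟨j, Finset.mem_range.2 hj, h⟩
  · congr 2
    rw [zed_coe, ← Complex.exp_neg, ← Complex.exp_nat_mul, freq]
    congr 1
    push_cast
    ring

/-- The factors of the conjugate roots `e^{±ix}` combine; the weights are halved at `0` and `π`,
where the two roots coincide. -/
theorem norm_one_sub_zed_pow_rpow_eq_prod {m : ℕ} (hm : 0 < m) (a x : ℝ) :
    ‖1 - zed (x : Circ) ^ (2 * m)‖ ^ a =
      ∏ j ∈ Finset.range (m + 1), pairFactor (freq (2 * m) j) x ^
        (if j = 0 ∨ j = m then a / 2 else a) := by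
  set g : ℕ → ℝ := fun j => ‖zed (x : Circ) - zed ((freq (2 * m) j : ℝ) : Circ)‖ with hg
  have hg0 : ∀ j, 0 ≤ g j := fun j => norm_nonneg _
  have hper : ∀ j, j ≤ 2 * m → zed ((-freq (2 * m) j : ℝ) : Circ) =
      zed ((freq (2 * m) (2 * m - j) : ℝ) : Circ) := by
    intro j hj
    congr 1
    have h1 : freq (2 * m) (2 * m - j) = -freq (2 * m) j + 2 * Real.pi := by
      have : (m : ℝ) ≠ 0 := by positivity
      rw [freq, freq, Nat.cast_sub hj]
      push_cast
      field_simp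
      ring
    rw [h1]
    exact (AddCircle.coe_add_period _ _).symm
  have hF : ∀ j, j ≤ 2 * m → pairFactor (freq (2 * m) j) x = g j * g (2 * m - j) := by
    intro j hj
    rw [pairFactor_eq_norm, hper j hj]
  have h2m : g (2 * m) = g 0 := by
    have := hper 0 (Nat.zero_le _)
    rw [freq_zero, neg_zero, Nat.sub_zero] at this
    simp only [hg, freq_zero, this]
  have hsq : ∀ t : ℝ, 0 ≤ t → (t * t) ^ (a / 2) = t ^ a := by
    intro t ht
    rw [← sq, ← Real.rpow_natCast, ← Real.rpow_mul ht]
    congr 1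
    push_cast
    ring
  have hsplit : ∏ j ∈ Finset.range (2 * m), g j =
      g 0 * (∏ j ∈ Finset.Ico 1 m, g j * g (2 * m - j)) * g m := by
    rw [Finset.range_eq_Ico, ← Finset.prod_Ico_consecutive g (Nat.zero_le m) (by omega),
      Finset.prod_eq_prod_Ico_succ_bot hm, Finset.prod_eq_prod_Ico_succ_bot (a := m) (by omega),
      Finset.prod_mul_distrib]
    have h1 : ∏ j ∈ Finset.Ico 1 m, g (2 * m - j) = ∏ j ∈ Finset.Ico (m + 1) (2 * m), g j := by
      rw [Finset.prod_Ico_reflect g 1 (by omega)]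
      congr 2
      all_goals omega
    rw [h1]
    simp only [zero_add]
    ring
  rw [norm_one_sub_zed_pow_eq_prod (by omega), hsplit, Real.mul_rpow, Real.mul_rpow,
    ← Real.finsetProd_rpow, Finset.range_eq_Ico, Finset.prod_Ico_succ_top (Nat.zero_le m),
    Finset.prod_eq_prod_Ico_succ_bot hm, hF 0 (Nat.zero_le _), hF m (by omega), Nat.sub_zero, h2m,
    if_pos (Or.inl rfl), if_pos (Or.inr rfl), hsq _ (hg0 _), show 2 * m - m = m by omega,
    hsq _ (hg0 _)]
  · congr 2
    refine Finset.prod_congr (by rw [zero_add]) fun j hj => ?_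
    have := Finset.mem_Ico.1 hj
    rw [if_neg (by omega), hF j (by omega)]
  · exact fun j _ => mul_nonneg (hg0 _) (hg0 _)
  · exact hg0 0
  · exact Finset.prod_nonneg fun j _ => mul_nonneg (hg0 _) (hg0 _)
  · exact mul_nonneg (hg0 0) (Finset.prod_nonneg fun j _ => mul_nonneg (hg0 _) (hg0 _))
  · exact hg0 m

/-- The array that attaches to each period its own memory parameter. -/
noncomputable def periodArray (s : Fin 2 → ℕ) (d : Fin 2 → ℝ) (i : Fin 2) (j : ℕ) : ℝ :=
  if j = 0 ∨ j = s i / 2 then d i / 2 else d i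

theorem mem_seasonalFreqs {μ : ℝ} : μ ∈ seasonalFreqs s ↔ ∃ i, μ ∈ periodFreqs (s i) := by
  simp [seasonalFreqs]

theorem mem_periodFreqs {n : ℕ} {μ : ℝ} : μ ∈ periodFreqs n ↔ ∃ j ≤ n / 2, freq n j = μ := by
  simp [periodFreqs]

theorem sum_periodArray_eq {i : Fin 2} (hs : 0 < s i) (he : Even (s i)) (μ : ℝ) :
    (∑ j ∈ Finset.range (s i / 2 + 1), if freq (s i) j = μ then periodArray s d i j else 0) =
      if μ ∈ periodFreqs (s i) then (if μ = 0 ∨ μ = Real.pi then d i / 2 else d i) else 0 := by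
  have hπ : freq (s i) (s i / 2) = Real.pi := by
    obtain ⟨m, hm⟩ := he
    rw [show s i = 2 * m by omega, Nat.mul_div_cancel_left m two_pos]
    exact freq_half (by omega)
  split_ifs with h1 h2
  all_goals try
    obtain ⟨j, hj, rfl⟩ := mem_periodFreqs.1 h1
    rw [Finset.sum_eq_single_of_mem j (Finset.mem_range.2 (by omega)) fun k _ hk =>
      if_neg fun h => hk (freq_injective hs h), if_pos rfl, periodArray]
    rw [← hπ, ← freq_zero (s i), (freq_injective hs).eq_iff, (freq_injective hs).eq_iff] at h2
  · rw [if_pos h2]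
  · rw [if_neg h2]
  · refine Finset.sum_eq_zero fun j hj => if_neg fun h => h1 ?_
    exact mem_periodFreqs.2 ⟨j, by have := Finset.mem_range.1 hj; omega, h⟩

theorem isMemoryArray_periodArray (hs : ∀ i, 0 < s i) (he : ∀ i, Even (s i)) :
    IsMemoryArray s d (periodArray s d) := by
  intro μ _
  rw [memoryParam, memoryOrder, Finset.sum_div]
  simp only [sum_periodArray_eq (hs _) (he _)]
  split_ifs with h
  · refine Finset.sum_congr rfl fun i _ => ?_
    split_ifs <;> simp
  · rfl

theorem zed_freq_pow {n : ℕ} (hn : 0 < n) (j : ℕ) :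
    zed ((freq n j : ℝ) : Circ) ^ n = 1 ∧ zed ((-freq n j : ℝ) : Circ) ^ n = 1 := by
  have h0 : (n : ℂ) ≠ 0 := by exact_mod_cast hn.ne'
  rw [zed_coe, zed_coe, ← Complex.exp_nat_mul, ← Complex.exp_nat_mul]
  constructor
  · rw [Complex.exp_eq_one_iff]
    refine ⟨-j, ?_⟩
    rw [freq]
    push_cast
    field_simp
  · rw [Complex.exp_eq_one_iff]
    refine ⟨j, ?_⟩
    rw [freq]
    push_cast
    field_simp

theorem pairFactor_pos (hs : ∀ i, 0 < s i) {x : ℝ} (hx : ∀ i, Real.sin (x * s i / 2) ≠ 0) {μ : ℝ}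
    (hμ : μ ∈ seasonalFreqs s) : 0 < pairFactor μ x := by
  obtain ⟨i, hi⟩ := mem_seasonalFreqs.1 hμ
  obtain ⟨j, -, rfl⟩ := mem_periodFreqs.1 hi
  have h1 : zed (x : Circ) ^ s i ≠ 1 := by
    intro h
    have := norm_one_sub_zed_pow_coe (s i) x
    rw [h, sub_self, norm_zero, eq_comm, abs_eq_zero] at this
    exact hx i (by linarith)
  obtain ⟨h2, h3⟩ := zed_freq_pow (hs i) j
  rw [pairFactor_eq_norm]
  refine mul_pos (norm_pos_iff.2 ?_) (norm_pos_iff.2 ?_)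
  · exact sub_ne_zero.2 fun h => h1 (by rw [h, h2])
  · exact sub_ne_zero.2 fun h => h1 (by rw [h, h3])

/-- Away from the zeros, the frequency factor depends on the array only through the memory
parameters. -/
theorem freqFactor_eq_prod {D : Fin 2 → ℕ → ℝ} (hD : IsMemoryArray s d D) {x : ℝ}
    (hx : ∀ μ ∈ seasonalFreqs s, 0 < pairFactor μ x) :
    freqFactor s D x = ∏ μ ∈ seasonalFreqs s, pairFactor μ x ^ (-2 * memoryParam s d μ) := by
  have h1 : ∀ i, ∀ j ∈ Finset.range (s i / 2 + 1),
      pairFactor (freq (s i) j) x ^ (-2 * D i j) = ∏ μ ∈ seasonalFreqs s,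
        pairFactor μ x ^ (if freq (s i) j = μ then -2 * D i j else 0) := by
    intro i j hj
    rw [Finset.prod_eq_single (freq (s i) j)]
    · rw [if_pos rfl]
    · intro μ _ hμ
      rw [if_neg hμ.symm, Real.rpow_zero]
    · intro h
      exact absurd (mem_seasonalFreqs.2 ⟨i, mem_periodFreqs.2
        ⟨j, by have := Finset.mem_range.1 hj; omega, rfl⟩⟩) h
  calc freqFactor s D x = ∏ i, ∏ j ∈ Finset.range (s i / 2 + 1),
        pairFactor (freq (s i) j) x ^ (-2 * D i j) := rfl
    _ = ∏ i, ∏ j ∈ Finset.range (s i / 2 + 1), ∏ μ ∈ seasonalFreqs s,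
        pairFactor μ x ^ (if freq (s i) j = μ then -2 * D i j else 0) :=
      Finset.prod_congr rfl fun i _ => Finset.prod_congr rfl (h1 i)
    _ = ∏ μ ∈ seasonalFreqs s, ∏ i, ∏ j ∈ Finset.range (s i / 2 + 1),
        pairFactor μ x ^ (if freq (s i) j = μ then -2 * D i j else 0) := by
      rw [Finset.prod_comm]
      exact Finset.prod_congr rfl fun i _ => Finset.prod_comm
    _ = _ := by
      refine Finset.prod_congr rfl fun μ hμ => ?_
      rw [← hD μ hμ, Finset.mul_sum, Real.rpow_sum_of_pos (hx μ hμ)]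
      refine Finset.prod_congr rfl fun i _ => ?_
      rw [Finset.mul_sum, Real.rpow_sum_of_pos (hx μ hμ)]
      refine Finset.prod_congr rfl fun j _ => ?_
      rw [mul_ite, mul_zero]

theorem sineFactor_eq_freqFactor (hs : ∀ i, 0 < s i) (he : ∀ i, Even (s i)) (x : ℝ) :
    sineFactor s d x = freqFactor s (periodArray s d) x := by
  rw [sineFactor, freqFactor]
  refine Finset.prod_congr rfl fun i _ => ?_
  obtain ⟨m, hm⟩ := he i
  have hm' : s i = 2 * m := by omega
  have hm0 : 0 < m := by have := hs i; omega
  have h := norm_one_sub_zed_pow_rpow_eq_prod hm0 (-2 * d i) x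
  rw [← hm', norm_one_sub_zed_pow_coe] at h
  rw [h, show s i / 2 = m by omega]
  refine Finset.prod_congr rfl fun j _ => ?_
  rw [pairFactor, periodArray, show s i / 2 = m by omega]
  congr 1
  split_ifs <;> ring

theorem sineFactor_eq_prod (hs : ∀ i, 0 < s i) (he : ∀ i, Even (s i)) {x : ℝ}
    (hx : ∀ i, Real.sin (x * s i / 2) ≠ 0) :
    sineFactor s d x = ∏ μ ∈ seasonalFreqs s, pairFactor μ x ^ (-2 * memoryParam s d μ) := by
  rw [sineFactor_eq_freqFactor hs he,
    freqFactor_eq_prod (isMemoryArray_periodArray hs he) fun μ hμ => pairFactor_pos hs hx hμ]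

theorem freqFactor_eq_sineFactor (hs : ∀ i, 0 < s i) (he : ∀ i, Even (s i))
    {D : Fin 2 → ℕ → ℝ} (hD : IsMemoryArray s d D) {x : ℝ}
    (hx : ∀ i, Real.sin (x * s i / 2) ≠ 0) : freqFactor s D x = sineFactor s d x := by
  rw [sineFactor_eq_prod hs he hx, freqFactor_eq_prod hD fun μ hμ => pairFactor_pos hs hx hμ]

theorem ae_sin_ne_zero (hs : ∀ i, 0 < s i) :
    ∀ᵐ x : ℝ ∂(volume.restrict (Set.Ioc (-Real.pi) Real.pi)),
      ∀ i, Real.sin (x * s i / 2) ≠ 0 := by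
  refine ae_all_iff.2 fun i => ?_
  filter_upwards [ae_coe_of_ae_haarC (ae_zed_pow_ne_one (hs i))] with x hx h
  have := norm_one_sub_zed_pow_coe (s i) x
  rw [h, mul_zero, abs_zero, norm_eq_zero, sub_eq_zero] at this
  exact hx this.symm

end FrequencyFactor

/-! ### Fourier coefficients of a power singularity -/

section Singularity

variable {δ : ℝ}

theorem real_betaIntegral {a b : ℝ} (ha : 0 < a) (hb : 0 < b) :
    ∫ t in (0 : ℝ)..1, t ^ (a - 1) * (1 - t) ^ (b - 1) =
      Real.Gamma a * Real.Gamma b / Real.Gamma (a + b) := by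
  have h := beta_eq_betaIntegralReal a b ha hb
  rw [beta] at h
  rw [h, Complex.betaIntegral]
  have h1 : ∫ x in (0 : ℝ)..1, (x : ℂ) ^ ((a : ℂ) - 1) * (1 - (x : ℂ)) ^ ((b : ℂ) - 1) =
      ∫ x in (0 : ℝ)..1, ((x ^ (a - 1) * (1 - x) ^ (b - 1) : ℝ) : ℂ) := by
    refine intervalIntegral.integral_congr fun x hx => ?_
    rw [Set.uIcc_of_le zero_le_one] at hx
    rw [Complex.ofReal_mul, Complex.ofReal_cpow hx.1, Complex.ofReal_cpow (by linarith [hx.2])]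
    push_cast
    rfl
  rw [h1, intervalIntegral.integral_ofReal, Complex.ofReal_re]

/-- The substitution `t = sin² (x / 2)` turns the integral of a power of the sine into a beta
integral. -/
theorem integral_sin_half_rpow (hδ : δ < 1 / 2) :
    ∫ x in (0 : ℝ)..Real.pi, Real.sin (x / 2) ^ (-2 * δ) =
      Real.Gamma (1 / 2 - δ) * Real.Gamma (1 / 2) / Real.Gamma (1 - δ) := by
  have hπ := Real.pi_pos
  have hsin : ∀ x ∈ Set.Ioo 0 Real.pi, 0 < Real.sin (x / 2) := fun x hx =>
    Real.sin_pos_of_pos_of_lt_pi (by linarith [hx.1]) (by linarith [hx.2])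
  have hcos : ∀ x ∈ Set.Ioo 0 Real.pi, 0 < Real.cos (x / 2) := fun x hx =>
    Real.cos_pos_of_mem_Ioo ⟨by linarith [hx.1], by linarith [hx.2]⟩
  have hderiv : ∀ x : ℝ, HasDerivAt (fun x => Real.sin (x / 2) ^ 2)
      (Real.sin (x / 2) * Real.cos (x / 2)) x := fun x => by
    have := ((Real.hasDerivAt_sin (x / 2)).comp x ((hasDerivAt_id x).div_const 2)).pow 2
    refine this.congr_deriv ?_
    simp
    ring
  have hmono : StrictMonoOn (fun x => Real.sin (x / 2) ^ 2) (Set.Icc 0 Real.pi) :=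
    strictMonoOn_of_deriv_pos (convex_Icc _ _) (by fun_prop) fun x hx => by
      rw [interior_Icc] at hx
      rw [(hderiv x).deriv]
      exact mul_pos (hsin x hx) (hcos x hx)
  have himage : (fun x => Real.sin (x / 2) ^ 2) '' Set.Ioo 0 Real.pi = Set.Ioo 0 1 := by
    refine Set.Subset.antisymm ?_ ?_
    · rintro _ ⟨x, hx, rfl⟩
      have h1 := hsin x hx
      have h2 := hcos x hx
      have h3 := Real.sin_sq_add_cos_sq (x / 2)
      exact ⟨by positivity, by nlinarith⟩
    · have h := intermediate_value_Ioo hπ.le (f := fun x => Real.sin (x / 2) ^ 2) (by fun_prop)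
      simpa using h
  have hsub := integral_image_eq_integral_abs_deriv_smul measurableSet_Ioo
    (fun x _ => (hderiv x).hasDerivWithinAt) (hmono.injOn.mono Set.Ioo_subset_Icc_self)
    (fun t : ℝ => t ^ (1 / 2 - δ - 1) * (1 - t) ^ ((1 : ℝ) / 2 - 1))
  have hbeta := real_betaIntegral (a := 1 / 2 - δ) (b := 1 / 2) (by linarith) (by norm_num)
  rw [intervalIntegral.integral_of_le zero_le_one, integral_Ioc_eq_integral_Ioo, ← himage, hsub,
    show (1 : ℝ) / 2 - δ + 1 / 2 = 1 - δ by ring] at hbeta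
  rw [← hbeta, intervalIntegral.integral_of_le hπ.le, integral_Ioc_eq_integral_Ioo]
  refine setIntegral_congr_fun measurableSet_Ioo fun x hx => ?_
  have h1 := hsin x hx
  have h2 := hcos x hx
  have h3 : 1 - Real.sin (x / 2) ^ 2 = Real.cos (x / 2) ^ 2 := by
    linarith [Real.sin_sq_add_cos_sq (x / 2)]
  simp only [smul_eq_mul]
  rw [h3, abs_of_pos (mul_pos h1 h2), ← Real.rpow_natCast, ← Real.rpow_natCast, ← Real.rpow_mul h1.le,
    ← Real.rpow_mul h2.le]
  have e1 : ((2 : ℕ) : ℝ) * (1 / 2 - 1) = -1 := by norm_num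
  have e2 : ((2 : ℕ) : ℝ) * (1 / 2 - δ - 1) = -2 * δ + -1 := by push_cast; ring
  rw [e1, e2, Real.rpow_add h1, Real.rpow_neg_one, Real.rpow_neg_one]
  field_simp

/-- The Fourier coefficients of the even function `|1 - e^{-ix}| ^ (-2δ)`, written as cosine integrals over
`[0, π]`, where `|1 - e^{-ix}| = 2 sin (x / 2)`. -/
noncomputable def singCoeff (δ : ℝ) (h : ℤ) : ℝ :=
  (1 / Real.pi) * ∫ x in (0 : ℝ)..Real.pi, Real.cos (h * x) * (2 * Real.sin (x / 2)) ^ (-2 * δ)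

theorem singCoeff_neg (δ : ℝ) (h : ℤ) : singCoeff δ (-h) = singCoeff δ h := by
  simp only [singCoeff, Int.cast_neg, neg_mul, Real.cos_neg]

theorem sin_half_nonneg {x : ℝ} (hx : x ∈ Set.Icc 0 Real.pi) : 0 ≤ 2 * Real.sin (x / 2) :=
  mul_nonneg zero_le_two
    (Real.sin_nonneg_of_nonneg_of_le_pi (by linarith [hx.1]) (by linarith [hx.1, hx.2]))

theorem singCoeff_zero (hδ : δ < 1 / 2) :
    singCoeff δ 0 = Real.Gamma (1 - 2 * δ) / Real.Gamma (1 - δ) ^ 2 := by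
  have h1 : ∫ x in (0 : ℝ)..Real.pi, Real.cos ((0 : ℤ) * x) * (2 * Real.sin (x / 2)) ^ (-2 * δ) =
      2 ^ (-2 * δ) * ∫ x in (0 : ℝ)..Real.pi, Real.sin (x / 2) ^ (-2 * δ) := by
    rw [← intervalIntegral.integral_const_mul]
    refine intervalIntegral.integral_congr fun x hx => ?_
    rw [Set.uIcc_of_le Real.pi_pos.le] at hx
    have := sin_half_nonneg hx
    simp only [Int.cast_zero, zero_mul, Real.cos_zero, one_mul]
    rw [Real.mul_rpow zero_le_two (by linarith)]
  have h2 := Real.Gamma_mul_Gamma_add_half (1 / 2 - δ)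
  have h3 : Real.Gamma (1 - δ) ≠ 0 := (Real.Gamma_pos_of_pos (by linarith)).ne'
  rw [show (1 : ℝ) / 2 - δ + 1 / 2 = 1 - δ by ring, show 2 * ((1 : ℝ) / 2 - δ) = 1 - 2 * δ by ring,
    show 1 - (1 - 2 * δ) = 2 * δ by ring] at h2
  have h4 : (2 : ℝ) ^ (-2 * δ) * 2 ^ (2 * δ) = 1 := by
    rw [← Real.rpow_add two_pos, show -2 * δ + 2 * δ = 0 by ring, Real.rpow_zero]
  have h5 : Real.sqrt Real.pi * Real.sqrt Real.pi = Real.pi := Real.mul_self_sqrt Real.pi_pos.le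
  rw [singCoeff, h1, integral_sin_half_rpow hδ, Real.Gamma_one_half_eq]
  have hπ := Real.pi_pos.ne'
  field_simp
  calc _ = (2 : ℝ) ^ (-2 * δ) * (Real.Gamma (1 / 2 - δ) * Real.Gamma (1 - δ)) *
        Real.sqrt Real.pi := by ring_nf
    _ = ((2 : ℝ) ^ (-2 * δ) * 2 ^ (2 * δ)) * Real.Gamma (1 - 2 * δ) *
        (Real.sqrt Real.pi * Real.sqrt Real.pi) := by rw [h2]; ring
    _ = _ := by rw [h4, h5]; ring

theorem integrableOn_sin_half_rpow (hδ : δ < 1 / 2) :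
    IntervalIntegrable (fun x => (2 * Real.sin (x / 2)) ^ (-2 * δ)) volume 0 Real.pi := by
  have h := integrable_norm_one_sub_zed_rpow one_pos (p := -2 * δ) (by linarith)
  rw [integrable_haarC_iff h.1] at h
  rw [intervalIntegrable_iff_integrableOn_Ioc_of_le Real.pi_pos.le]
  refine (h.mono_set (Set.Ioc_subset_Ioc_left (by linarith [Real.pi_pos]))).congr_fun
    (fun x hx => ?_) measurableSet_Ioc
  simp only [norm_one_sub_zed_pow_coe, Nat.cast_one, mul_one]
  rw [abs_of_nonneg (sin_half_nonneg ⟨hx.1.le, hx.2⟩)]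

theorem intervalIntegrable_cos_mul (hδ : δ < 1 / 2) (h : ℤ) :
    IntervalIntegrable (fun x => Real.cos (h * x) * (2 * Real.sin (x / 2)) ^ (-2 * δ))
      volume 0 Real.pi :=
  (integrableOn_sin_half_rpow hδ).continuousOn_mul (by fun_prop)

/-- The recursion results from integrating the derivative of
`(2 sin (x / 2)) ^ (1 - 2δ) * cos ((h + 1 / 2) x)`, which vanishes at `0` and `π`. -/
theorem singCoeff_succ (hδ : δ < 1 / 2) (h : ℤ) :
    (h + 1 - δ) * singCoeff δ (h + 1) = (h + δ) * singCoeff δ h := by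
  have hπ := Real.pi_pos
  have hint : ∀ k : ℤ, _ := intervalIntegrable_cos_mul hδ
  have hd : ∀ x ∈ Set.Ioo 0 Real.pi, HasDerivAt
      (fun x => (2 * Real.sin (x / 2)) ^ (1 - 2 * δ) * Real.cos ((h + 1 / 2) * x))
      ((h + 1 - δ) * (Real.cos ((h + 1 : ℤ) * x) * (2 * Real.sin (x / 2)) ^ (-2 * δ)) -
        (h + δ) * (Real.cos (h * x) * (2 * Real.sin (x / 2)) ^ (-2 * δ))) x := by
    intro x hx
    have hs : 0 < 2 * Real.sin (x / 2) := mul_pos two_pos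
      (Real.sin_pos_of_pos_of_lt_pi (by linarith [hx.1]) (by linarith [hx.2]))
    have h1 : HasDerivAt (fun x => 2 * Real.sin (x / 2)) (Real.cos (x / 2)) x := by
      have := ((Real.hasDerivAt_sin (x / 2)).comp x ((hasDerivAt_id x).div_const 2)).const_mul 2
      exact this.congr_deriv (by ring)
    have h2 := h1.rpow_const (p := 1 - 2 * δ) (Or.inl hs.ne')
    have h3 : HasDerivAt (fun x => Real.cos ((h + 1 / 2 : ℝ) * x))
        (-Real.sin ((h + 1 / 2) * x) * (h + 1 / 2)) x := by
      have := (Real.hasDerivAt_cos ((h + 1 / 2 : ℝ) * x)).comp x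
        ((hasDerivAt_id x).const_mul (h + 1 / 2 : ℝ))
      exact this.congr_deriv (by ring)
    refine (h2.mul h3).congr_deriv ?_
    have e1 : Real.cos ((h + 1 : ℤ) * x) = Real.cos ((h + 1 / 2) * x + x / 2) := by
      congr 1; push_cast; ring
    have e2 : Real.cos (h * x) = Real.cos ((h + 1 / 2) * x - x / 2) := by congr 1; ring
    rw [e1, e2, Real.cos_add, Real.cos_sub, show 1 - 2 * δ - 1 = -2 * δ by ring,
      show 1 - 2 * δ = -2 * δ + 1 by ring, Real.rpow_add hs, Real.rpow_one]
    ring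
  have hftc := intervalIntegral.integral_eq_sub_of_hasDerivAt_of_le hπ.le (by
    refine ContinuousOn.mul (ContinuousOn.rpow_const (by fun_prop) fun x _ => Or.inr (by linarith))
      (by fun_prop)) hd (((hint (h + 1)).const_mul _).sub ((hint h).const_mul _))
  rw [intervalIntegral.integral_sub ((hint (h + 1)).const_mul _) ((hint h).const_mul _),
    intervalIntegral.integral_const_mul, intervalIntegral.integral_const_mul] at hftc
  have hend : Real.cos ((h + 1 / 2) * Real.pi) = 0 := by
    rw [Real.cos_eq_zero_iff]
    exact ⟨h, by ring⟩
  rw [hend, zero_div, Real.sin_zero, mul_zero, mul_zero, Real.zero_rpow (by linarith), zero_mul,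
    sub_zero, sub_eq_zero] at hftc
  rw [singCoeff, singCoeff, mul_left_comm, hftc]
  ring

theorem singCoeff_nat (hδ : δ < 1 / 2) (n : ℕ) :
    singCoeff δ n = singCoeff δ 0 *
      ((∏ j ∈ Finset.range n, (δ + j)) / ∏ j ∈ Finset.range n, (1 - δ + j)) := by
  induction n with
  | zero => simp
  | succ n ih =>
    have h := singCoeff_succ hδ n
    have h1 : (1 : ℝ) - δ + n ≠ 0 := by
      have : (0 : ℝ) ≤ n := Nat.cast_nonneg n
      linarith
    have h2 : ∏ j ∈ Finset.range n, (1 - δ + (j : ℝ)) ≠ 0 :=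
      Finset.prod_ne_zero_iff.2 fun j _ => by
        have : (0 : ℝ) ≤ j := Nat.cast_nonneg j
        linarith
    rw [Finset.prod_range_succ, Finset.prod_range_succ]
    rw [ih] at h
    push_cast at h ⊢
    have h3 : (n : ℝ) + 1 - δ = 1 - δ + n := by ring
    rw [h3] at h
    field_simp at h ⊢
    linarith

/-- The asymptotic behaviour of the Fourier coefficients of a power singularity, from Euler's limit
formula for the Gamma function. -/
theorem tendsto_singCoeff (hδ : δ < 1 / 2) :
    Tendsto (fun n : ℕ => (n : ℝ) ^ (1 - 2 * δ) * singCoeff δ n) atTop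
      (𝓝 (Real.Gamma (1 - 2 * δ) * Real.sin (Real.pi * δ) / Real.pi)) := by
  have hπ := Real.pi_pos.ne'
  have hG : Real.Gamma (1 - δ) ≠ 0 := (Real.Gamma_pos_of_pos (by linarith)).ne'
  have hrefl := Real.Gamma_mul_Gamma_one_sub δ
  -- both sides of the product formula are multiplied by `n ^ δ * n!`, so no case is lost if a
  -- factor `δ + j` vanishes
  have hprod : ∀ᶠ n : ℕ in atTop, singCoeff δ 0 * Real.GammaSeq (1 - δ) n *
      (Real.GammaSeq δ n)⁻¹ = (n : ℝ) ^ (1 - 2 * δ) * singCoeff δ (n + 1 : ℕ) := by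
    filter_upwards [eventually_gt_atTop 0] with n hn
    have hn' : (0 : ℝ) < n := by exact_mod_cast hn
    have h1 : (n : ℝ) ^ (1 - δ) = (n : ℝ) ^ (1 - 2 * δ) * (n : ℝ) ^ δ := by
      rw [← Real.rpow_add hn']; congr 1; ring
    have h2 : (n : ℝ) ^ δ ≠ 0 := (Real.rpow_pos_of_pos hn' _).ne'
    have h3 : (n.factorial : ℝ) ≠ 0 := by exact_mod_cast n.factorial_ne_zero
    rw [singCoeff_nat hδ, Real.GammaSeq, Real.GammaSeq, inv_div, h1]
    field_simp
  have hlim : Tendsto (fun n : ℕ => (n : ℝ) ^ (1 - 2 * δ) * singCoeff δ (n + 1 : ℕ)) atTop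
      (𝓝 (Real.Gamma (1 - 2 * δ) * Real.sin (Real.pi * δ) / Real.pi)) := by
    by_cases h0 : Real.Gamma δ = 0
    · obtain ⟨m, hm⟩ := (Real.Gamma_eq_zero_iff δ).1 h0
      have hs : Real.sin (Real.pi * δ) = 0 := by
        rw [hm, mul_neg, Real.sin_neg, mul_comm, Real.sin_nat_mul_pi, neg_zero]
      rw [hs, mul_zero, zero_div]
      refine tendsto_const_nhds.congr' ?_
      filter_upwards [eventually_ge_atTop m] with n hn
      rw [singCoeff_nat hδ, Finset.prod_eq_zero (Finset.mem_range.2 (show m < n + 1 by omega))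
        (by rw [hm]; ring), zero_div, mul_zero, mul_zero]
    · have h1 := ((Real.GammaSeq_tendsto_Gamma (1 - δ)).const_mul (singCoeff δ 0)).mul
        ((Real.GammaSeq_tendsto_Gamma δ).inv₀ h0)
      have h2 : singCoeff δ 0 * Real.Gamma (1 - δ) * (Real.Gamma δ)⁻¹ =
          Real.Gamma (1 - 2 * δ) * Real.sin (Real.pi * δ) / Real.pi := by
        have hs : Real.sin (Real.pi * δ) ≠ 0 := by
          intro hs
          rw [hs, div_zero] at hrefl
          exact mul_ne_zero h0 hG hrefl
        rw [singCoeff_zero hδ]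
        rw [eq_div_iff hs] at hrefl
        field_simp
        rw [mul_comm δ Real.pi]
        linear_combination (-Real.Gamma (1 - 2 * δ)) * hrefl
      rw [h2] at h1
      exact h1.congr' hprod
  rw [← tendsto_add_atTop_iff_nat 1]
  have hratio : Tendsto (fun n : ℕ => (((n + 1 : ℕ) : ℝ) / n) ^ (1 - 2 * δ)) atTop (𝓝 1) := by
    have h1 : Tendsto (fun n : ℕ => ((n + 1 : ℕ) : ℝ) / n) atTop (𝓝 1) := by
      have := (tendsto_natCast_div_add_atTop (𝕜 := ℝ) 1).inv₀ one_ne_zero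
      simpa using this
    simpa using h1.rpow_const (p := 1 - 2 * δ) (Or.inl one_ne_zero)
  have := hratio.mul hlim
  rw [one_mul] at this
  refine this.congr' ?_
  filter_upwards [eventually_gt_atTop 0] with n hn
  have hn' : (0 : ℝ) < n := by exact_mod_cast hn
  rw [Real.div_rpow (Nat.cast_nonneg _) hn'.le, ← mul_assoc, div_mul_cancel₀]
  exact (Real.rpow_pos_of_pos hn' _).ne'

theorem exists_abs_singCoeff_le (hδ : δ < 1 / 2) :
    ∃ C : ℝ, ∀ k : ℤ, |singCoeff δ k| ≤ C * (1 + |(k : ℝ)|) ^ (2 * δ - 1) := by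
  obtain ⟨B, hB⟩ := (tendsto_singCoeff hδ).norm.bddAbove_range
  have hexp : (0 : ℝ) ≤ 1 - 2 * δ := by linarith
  set C := max |singCoeff δ 0| (2 ^ (1 - 2 * δ) * B) with hC
  have hnat : ∀ n : ℕ, |singCoeff δ n| ≤ C * (1 + (n : ℝ)) ^ (2 * δ - 1) := by
    intro n
    rcases Nat.eq_zero_or_pos n with rfl | hn
    · simp only [Nat.cast_zero, add_zero, Real.one_rpow, mul_one]
      exact le_max_left _ _
    · have hn' : (1 : ℝ) ≤ n := by exact_mod_cast hn
      have hp : (0 : ℝ) < (n : ℝ) ^ (1 - 2 * δ) := Real.rpow_pos_of_pos (by linarith) _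
      have h1 : (n : ℝ) ^ (1 - 2 * δ) * |singCoeff δ n| ≤ B := by
        have := hB ⟨n, rfl⟩
        simp only [norm_mul, Real.norm_eq_abs, abs_of_pos hp] at this
        exact this
      have h2 : (1 + (n : ℝ)) ^ (1 - 2 * δ) ≤ 2 ^ (1 - 2 * δ) * (n : ℝ) ^ (1 - 2 * δ) := by
        rw [← Real.mul_rpow zero_le_two (by linarith)]
        exact Real.rpow_le_rpow (by linarith) (by linarith) hexp
      have h3 : (0 : ℝ) < (1 + (n : ℝ)) ^ (1 - 2 * δ) := Real.rpow_pos_of_pos (by linarith) _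
      rw [show 2 * δ - 1 = -(1 - 2 * δ) by ring, Real.rpow_neg (by linarith), ← div_eq_mul_inv,
        le_div_iff₀ h3]
      calc |singCoeff δ n| * (1 + (n : ℝ)) ^ (1 - 2 * δ)
          ≤ |singCoeff δ n| * (2 ^ (1 - 2 * δ) * (n : ℝ) ^ (1 - 2 * δ)) :=
            mul_le_mul_of_nonneg_left h2 (abs_nonneg _)
        _ = 2 ^ (1 - 2 * δ) * ((n : ℝ) ^ (1 - 2 * δ) * |singCoeff δ n|) := by ring
        _ ≤ 2 ^ (1 - 2 * δ) * B := mul_le_mul_of_nonneg_left h1 (by positivity)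
        _ ≤ C := le_max_right _ _
  refine ⟨C, fun k => ?_⟩
  obtain ⟨n, rfl | rfl⟩ := k.eq_nat_or_neg
  · simpa using hnat n
  · rw [singCoeff_neg]
    simpa using hnat n

theorem cf_norm_one_sub_zed_rpow (hδ : δ < 1 / 2) (h : ℤ) :
    cf (fun x => ((‖1 - zed x‖ ^ (-2 * δ) : ℝ) : ℂ)) h = singCoeff δ h := by
  have hπ := Real.pi_pos
  set f : ℝ → ℂ := fun x =>
    Complex.exp (Complex.I * h * x) * ((|2 * Real.sin (x / 2)| ^ (-2 * δ) : ℝ) : ℂ) with hf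
  have hw : IntervalIntegrable (fun x => |2 * Real.sin (x / 2)| ^ (-2 * δ)) volume
      (-Real.pi) Real.pi := by
    have h := integrable_norm_one_sub_zed_rpow one_pos (p := -2 * δ) (by linarith)
    rw [integrable_haarC_iff h.1] at h
    rw [intervalIntegrable_iff_integrableOn_Ioc_of_le (by linarith)]
    simpa only [norm_one_sub_zed_pow_coe, Nat.cast_one, mul_one] using h
  have hfi : IntervalIntegrable f volume (-Real.pi) Real.pi := by
    have : IntervalIntegrable (fun x => ((|2 * Real.sin (x / 2)| ^ (-2 * δ) : ℝ) : ℂ)) volume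
        (-Real.pi) Real.pi := ⟨hw.1.ofReal, hw.2.ofReal⟩
    exact this.continuousOn_mul (by fun_prop)
  have hf1 : IntervalIntegrable f volume (-Real.pi) 0 := hfi.mono_set (by
    rw [Set.uIcc_of_le (by linarith), Set.uIcc_of_le (by linarith)]
    exact Set.Icc_subset_Icc_right hπ.le)
  have hf2 : IntervalIntegrable f volume 0 Real.pi := hfi.mono_set (by
    rw [Set.uIcc_of_le hπ.le, Set.uIcc_of_le (by linarith)]
    exact Set.Icc_subset_Icc_left (by linarith))
  have hneg : ∫ x in (-Real.pi)..0, f x = ∫ x in (0 : ℝ)..Real.pi, f (-x) := by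
    rw [intervalIntegral.integral_comp_neg, neg_zero]
  have hf3 : IntervalIntegrable (fun x => f (-x)) volume 0 Real.pi := by
    simpa using ((IntervalIntegrable.iff_comp_neg (by simp)).1 hf1).symm
  rw [cf, integral_haarC]
  have h1 : ∫ x in (-Real.pi)..Real.pi, fourier h (x : Circ) *
      ((‖1 - zed (x : Circ)‖ ^ (-2 * δ) : ℝ) : ℂ) = ∫ x in (-Real.pi)..Real.pi, f x := by
    refine intervalIntegral.integral_congr fun x _ => ?_
    have := norm_one_sub_zed_pow_coe 1 x
    rw [pow_one, Nat.cast_one, mul_one] at this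
    simp only [hf, fourier_coe_exp, this]
  have h2 : ∫ x in (0 : ℝ)..Real.pi, (f (-x) + f x) = ∫ x in (0 : ℝ)..Real.pi,
      ((2 * (Real.cos (h * x) * (2 * Real.sin (x / 2)) ^ (-2 * δ)) : ℝ) : ℂ) := by
    refine intervalIntegral.integral_congr fun x hx => ?_
    rw [Set.uIcc_of_le hπ.le] at hx
    have h3 : Complex.I * h * (-x : ℝ) = -(h * x) * Complex.I := by push_cast; ring
    have h4 : Complex.I * h * x = h * x * Complex.I := by ring
    simp only [hf]
    rw [neg_div, Real.sin_neg, mul_neg, abs_neg, abs_of_nonneg (sin_half_nonneg hx), h3, h4,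
      ← add_mul]
    push_cast
    rw [Complex.cos]
    ring
  rw [h1, ← intervalIntegral.integral_add_adjacent_intervals hf1 hf2, hneg,
    ← intervalIntegral.integral_add hf3 hf2, h2, intervalIntegral.integral_ofReal,
    intervalIntegral.integral_const_mul, singCoeff]
  have : (Real.pi : ℂ) ≠ 0 := by exact_mod_cast hπ.ne'
  push_cast
  field_simp

end Singularity

/-! ### Functions with weighted absolutely convergent Fourier expansions -/

section WeightedSeries

/-- `F` is the sum of a trigonometric series `∑ i, c_i e^{i n_i x}` with
`∑ i, (1 + |n_i|) |c_i| < ∞`. The frequencies `n_i` may repeat, so that products of such series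
need no regrouping. -/
def IsWeightedSeries (F : Circ → ℂ) : Prop :=
  ∃ (ι : Type) (_ : Countable ι) (c : ι → ℂ) (n : ι → ℤ),
    Summable (fun i => (1 + |(n i : ℝ)|) * ‖c i‖) ∧ ∀ x, HasSum (fun i => c i * fourier (n i) x) (F x)

namespace IsWeightedSeries

variable {F G : Circ → ℂ}

theorem congr (hF : IsWeightedSeries F) (h : ∀ x, F x = G x) : IsWeightedSeries G := by
  rwa [← funext h]

theorem continuous (hF : IsWeightedSeries F) : Continuous F := by
  obtain ⟨ι, _, c, n, hc, hF⟩ := hF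
  rw [show F = fun x => ∑' i, c i * fourier (n i) x from funext fun x => (hF x).tsum_eq.symm]
  refine continuous_tsum (fun i => continuous_const.mul (fourier (n i)).continuous) hc fun i x => ?_
  rw [norm_mul, norm_fourier_apply, mul_one]
  exact le_mul_of_one_le_left (norm_nonneg _) (le_add_of_nonneg_right (abs_nonneg _))

theorem mul (hF : IsWeightedSeries F) (hG : IsWeightedSeries G) :
    IsWeightedSeries fun x => F x * G x := by
  obtain ⟨ι, _, c, n, hc, hF⟩ := hF
  obtain ⟨κ, _, c', n', hc', hG⟩ := hG
  have hsum := hc.mul_of_nonneg hc' (fun i => by positivity) (fun i => by positivity)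
  refine ⟨ι × κ, inferInstance, fun p => c p.1 * c' p.2, fun p => n p.1 + n' p.2, ?_, fun x => ?_⟩
  · refine hsum.of_nonneg_of_le (fun p => by positivity) fun p => ?_
    rw [norm_mul]
    have h : 1 + |((n p.1 + n' p.2 : ℤ) : ℝ)| ≤ (1 + |(n p.1 : ℝ)|) * (1 + |(n' p.2 : ℝ)|) := by
      push_cast
      nlinarith [abs_add_le (n p.1 : ℝ) (n' p.2 : ℝ), abs_nonneg (n p.1 : ℝ),
        abs_nonneg (n' p.2 : ℝ), mul_nonneg (abs_nonneg (n p.1 : ℝ)) (abs_nonneg (n' p.2 : ℝ))]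
    calc _ ≤ (1 + |(n p.1 : ℝ)|) * (1 + |(n' p.2 : ℝ)|) * (‖c p.1‖ * ‖c' p.2‖) :=
          mul_le_mul_of_nonneg_right h (by positivity)
      _ = _ := by ring
  · have hs : Summable fun p : ι × κ =>
        (c p.1 * fourier (n p.1) x) * (c' p.2 * fourier (n' p.2) x) := by
      refine Summable.of_norm_bounded hsum fun p => ?_
      rw [norm_mul, norm_mul, norm_mul, norm_fourier_apply, norm_fourier_apply, mul_one, mul_one]
      have h1 : (1 : ℝ) ≤ 1 + |(n p.1 : ℝ)| := le_add_of_nonneg_right (abs_nonneg _)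
      have h2 : (1 : ℝ) ≤ 1 + |(n' p.2 : ℝ)| := le_add_of_nonneg_right (abs_nonneg _)
      exact mul_le_mul (le_mul_of_one_le_left (norm_nonneg _) h1)
        (le_mul_of_one_le_left (norm_nonneg _) h2) (norm_nonneg _) (by positivity)
    refine (HasSum.mul (hF x) (hG x) hs).congr_fun fun p => ?_
    rw [fourier_add]
    ring

theorem starRingEnd (hF : IsWeightedSeries F) :
    IsWeightedSeries fun x => (_root_.starRingEnd ℂ) (F x) := by
  obtain ⟨ι, _, c, n, hc, hF⟩ := hF
  refine ⟨ι, inferInstance, fun i => (_root_.starRingEnd ℂ) (c i), fun i => -n i, by simpa using hc, fun x => ?_⟩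
  refine (Complex.hasSum_conj'.2 (hF x)).congr_fun fun i => ?_
  rw [map_mul, fourier_neg]

theorem comp_add_right (hF : IsWeightedSeries F) (θ : Circ) :
    IsWeightedSeries fun x => F (x + θ) := by
  obtain ⟨ι, _, c, n, hc, hF⟩ := hF
  refine ⟨ι, inferInstance, fun i => c i * fourier (n i) θ, n,
    by simpa only [norm_mul, norm_fourier_apply, mul_one] using hc, fun x => ?_⟩
  refine (hF (x + θ)).congr_fun fun i => ?_
  have : (fourier (n i) (x + θ) : ℂ) = fourier (n i) x * fourier (n i) θ := by
    rw [fourier_apply, fourier_apply, fourier_apply, smul_add, AddCircle.toCircle_add,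
      Circle.coe_mul]
  rw [this]
  ring

theorem polynomial (p : Polynomial ℂ) : IsWeightedSeries fun x => p.eval (zed x) := by
  refine ⟨ℕ, inferInstance, p.coeff, fun k => -(k : ℤ), ?_, fun x => ?_⟩
  · refine summable_of_ne_finset_zero (s := p.support) fun k hk => ?_
    rw [Polynomial.notMem_support_iff.1 hk, norm_zero, mul_zero]
  · simp only [← zed_pow]
    rw [Polynomial.eval_eq_sum]
    refine hasSum_sum_of_ne_finset_zero fun k hk => ?_
    rw [Polynomial.notMem_support_iff.1 hk, zero_mul]

theorem const (a : ℂ) : IsWeightedSeries fun _ => a :=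
  (polynomial (Polynomial.C a)).congr fun _ => Polynomial.eval_C

theorem prod {ι : Type*} {T : Finset ι} {F : ι → Circ → ℂ} (h : ∀ i ∈ T, IsWeightedSeries (F i)) :
    IsWeightedSeries fun x => ∏ i ∈ T, F i x := by
  classical
  induction T using Finset.induction_on with
  | empty => simpa using const 1
  | insert i T hi ih =>
    refine ((h i (Finset.mem_insert_self i T)).mul
      (ih fun j hj => h j (Finset.mem_insert_of_mem hj))).congr fun x => ?_
    rw [Finset.prod_insert hi]

theorem summable_weight_geometric {q : ℝ} (h0 : 0 ≤ q) (h1 : q < 1) :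
    Summable fun k : ℕ => (1 + ((k : ℝ) + 1)) * q ^ k := by
  have h2 := summable_pow_mul_geometric_of_norm_lt_one (R := ℝ) 1 (r := q)
    (by rwa [Real.norm_of_nonneg h0])
  refine (h2.add ((summable_geometric_of_lt_one h0 h1).mul_left 2)).congr fun k => ?_
  ring

/-- The geometric series in `z` or in `z⁻¹`, according to the position of the pole. -/
theorem inv_sub {r : ℂ} (hr : ‖r‖ ≠ 1) : IsWeightedSeries fun x => (zed x - r)⁻¹ := by
  rcases hr.lt_or_gt with hr | hr
  · refine ⟨ℕ, inferInstance, fun k => r ^ k, fun k => (k : ℤ) + 1, ?_, fun x => ?_⟩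
    · refine (summable_weight_geometric (norm_nonneg r) hr).congr fun k => ?_
      rw [norm_pow]
      push_cast
      rw [abs_of_nonneg (by positivity)]
    · have hz : zed x ≠ 0 := norm_ne_zero_iff.1 (by rw [norm_zed]; exact one_ne_zero)
      have hz1 : zed x * fourier 1 x = 1 := by
        rw [zed, ← fourier_add, neg_add_cancel, fourier_zero]
      have h := (hasSum_geometric_of_norm_lt_one (ξ := r * fourier 1 x)
        (by rwa [norm_mul, norm_fourier_apply, mul_one])).mul_left (fourier 1 x)
      have e : (fourier 1 x : ℂ) * (1 - r * fourier 1 x)⁻¹ = (zed x - r)⁻¹ := by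
        rw [eq_inv_of_mul_eq_one_right hz1, inv_eq_one_div (zed x), ← one_div, ← one_div,
          div_mul_div_comm, one_mul]
        congr 1
        field_simp
      rw [e] at h
      refine h.congr_fun fun k => ?_
      have : (fourier ((k : ℤ) + 1) x : ℂ) = fourier 1 x ^ k * fourier 1 x := by
        rw [fourier_add]
        congr 1
        induction k with
        | zero => simp
        | succ k ih => rw [pow_succ, ← ih, ← fourier_add]; push_cast; rfl
      rw [this, mul_pow]
      ring
  · have hr0 : r ≠ 0 := norm_pos_iff.1 (by linarith)
    have hr1 : ‖r⁻¹‖ < 1 := by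
      rw [norm_inv]
      exact inv_lt_one_of_one_lt₀ hr
    refine ⟨ℕ, inferInstance, fun k => -r⁻¹ * r⁻¹ ^ k, fun k => -(k : ℤ), ?_, fun x => ?_⟩
    · refine ((summable_weight_geometric (norm_nonneg r⁻¹) hr1).mul_left ‖r⁻¹‖).of_nonneg_of_le
        (fun k => by positivity) fun k => ?_
      rw [norm_mul, norm_neg, norm_pow]
      push_cast
      rw [abs_neg, Nat.abs_cast, mul_left_comm]
      refine mul_le_mul_of_nonneg_left (mul_le_mul_of_nonneg_right (by linarith) (by positivity))
        (norm_nonneg _)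
    · have h := (hasSum_geometric_of_norm_lt_one (ξ := r⁻¹ * zed x)
        (by rwa [norm_mul, norm_zed, mul_one])).mul_left (-r⁻¹)
      have e : -r⁻¹ * (1 - r⁻¹ * zed x)⁻¹ = (zed x - r)⁻¹ := by
        rw [← inv_neg, ← mul_inv]
        congr 1
        field_simp
        ring
      rw [e] at h
      refine h.congr_fun fun k => ?_
      rw [← zed_pow, mul_pow]
      ring

theorem inv_polynomial (p : Polynomial ℂ) (hp : ∀ z : ℂ, ‖z‖ = 1 → p.eval z ≠ 0) :
    IsWeightedSeries fun x => (p.eval (zed x))⁻¹ := by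
  induction hn : p.natDegree generalizing p with
  | zero =>
    rw [Polynomial.eq_C_of_natDegree_eq_zero hn]
    simpa using const _
  | succ n ih =>
    have hdeg : p.degree ≠ 0 := by
      intro h
      rw [Polynomial.natDegree_eq_of_degree_eq_some (n := 0) (by simpa using h)] at hn
      omega
    obtain ⟨r, hr⟩ := IsAlgClosed.exists_root p hdeg
    obtain ⟨q, rfl⟩ := Polynomial.dvd_iff_isRoot.2 hr
    have hr1 : ‖r‖ ≠ 1 := fun h => hp r h hr
    have hq : q ≠ 0 := by rintro rfl; simp at hn
    refine ((inv_sub hr1).mul (ih q (fun z hz h => hp z hz ?_) ?_)).congr fun x => ?_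
    · rw [Polynomial.eval_mul, h, mul_zero]
    · rw [Polynomial.natDegree_mul (Polynomial.X_sub_C_ne_zero r) hq,
        Polynomial.natDegree_X_sub_C] at hn
      omega
    · rw [Polynomial.eval_mul, mul_inv, Polynomial.eval_sub, Polynomial.eval_X, Polynomial.eval_C]

/-- A power of order greater than one of the distance to a point of the circle has a weighted
absolutely convergent Fourier series. -/
theorem norm_one_sub_zed_rpow {δ : ℝ} (hδ : δ < -(1 / 2)) :
    IsWeightedSeries fun x => ((‖1 - zed x‖ ^ (-2 * δ) : ℝ) : ℂ) := by
  obtain ⟨C, hC⟩ := exists_abs_singCoeff_le (δ := δ) (by linarith)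
  have hw : Summable fun k : ℤ => (1 + |(k : ℝ)|) * |singCoeff δ k| := by
    have h1 : Summable fun k : ℤ => C * (1 + |(k : ℝ)|) ^ (2 * δ) := by
      refine Summable.mul_left _ ?_
      have h2 := (Real.summable_one_div_int_add_rpow (1 / 2) (-(2 * δ))).2 (by linarith)
      refine h2.of_nonneg_of_le (fun k => by positivity) fun k => ?_
      have h3 : ((k : ℝ) + 1 / 2) ≠ 0 := by
        intro h
        have : (2 * k + 1 : ℤ) = 0 := by exact_mod_cast (by linarith : 2 * (k : ℝ) + 1 = 0)
        omega
      rw [Real.rpow_neg (abs_nonneg _), one_div, inv_inv]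
      refine Real.rpow_le_rpow_of_nonpos (abs_pos.2 h3) ?_ (by linarith)
      refine (abs_add_le _ _).trans ?_
      rw [abs_of_pos (by norm_num : (0 : ℝ) < 1 / 2)]
      linarith
    refine h1.of_nonneg_of_le (fun k => by positivity) fun k => ?_
    have h2 : 0 < 1 + |(k : ℝ)| := by positivity
    calc (1 + |(k : ℝ)|) * |singCoeff δ k| ≤ (1 + |(k : ℝ)|) * (C * (1 + |(k : ℝ)|) ^ (2 * δ - 1)) :=
          mul_le_mul_of_nonneg_left (hC k) h2.le
      _ = C * ((1 + |(k : ℝ)|) ^ (2 * δ - 1) * (1 + |(k : ℝ)|)) := by ring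
      _ = C * (1 + |(k : ℝ)|) ^ (2 * δ) := by
        rw [← Real.rpow_add_one h2.ne', sub_add_cancel]
  let f : C(Circ, ℂ) := ⟨fun x => ((‖1 - zed x‖ ^ (-2 * δ) : ℝ) : ℂ),
    Complex.continuous_ofReal.comp ((continuous_const.sub continuous_zed).norm.rpow_const
      fun x => Or.inr (by linarith))⟩
  have hf : ∀ k, fourierCoeff f k = singCoeff δ k := fun k => by
    have h := cf_norm_one_sub_zed_rpow (δ := δ) (by linarith) (-k)
    rwa [cf_eq_fourierCoeff, neg_neg, singCoeff_neg] at h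
  have hs : Summable (fourierCoeff f) := by
    refine Summable.of_norm_bounded hw fun k => ?_
    rw [hf, Complex.norm_real, Real.norm_eq_abs]
    exact le_mul_of_one_le_left (abs_nonneg _) (by linarith [abs_nonneg (k : ℝ)])
  refine ⟨ℤ, inferInstance, fun k => singCoeff δ k, fun k => k, ?_, fun x => ?_⟩
  · simpa only [Complex.norm_real, Real.norm_eq_abs] using hw
  · have := has_pointwise_sum_fourier_series_of_summable hs x
    simp only [hf, smul_eq_mul] at this
    exact this

end IsWeightedSeries

end WeightedSeries

/-! ### Fourier coefficients of a function with finitely many power singularities -/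

section Asymptotics

variable {δ a : ℝ}

theorem fourier_add_arg (n : ℤ) (x y : Circ) :
    (fourier n (x + y) : ℂ) = fourier n x * fourier n y := by
  rw [fourier_apply, fourier_apply, fourier_apply, smul_add, AddCircle.toCircle_add, Circle.coe_mul]

theorem integrable_singularity (hδ : δ < 1 / 2) :
    Integrable (fun x => ((‖1 - zed x‖ ^ (-2 * δ) : ℝ) : ℂ)) haarC := by
  have := integrable_norm_one_sub_zed_rpow one_pos (p := -2 * δ) (by linarith)
  simp only [pow_one] at this
  exact this.ofReal

/-- Multiplication by a trigonometric series acts on Fourier coefficients by convolution. -/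
theorem hasSum_cf_mul {ι : Type} [Countable ι] {c : ι → ℂ} {n : ι → ℤ} {F u : Circ → ℂ}
    (hc : Summable fun i => ‖c i‖) (hF : ∀ x, HasSum (fun i => c i * fourier (n i) x) (F x))
    (hu : Integrable u haarC) (h : ℤ) :
    HasSum (fun i => c i * cf u (h + n i)) (cf (fun x => F x * u x) h) := by
  have hint : ∀ i, Integrable (fun x => c i * (fourier (h + n i) x * u x)) haarC := fun i =>
    (hu.bdd_mul (c := 1) (measurable_fourier _).aestronglyMeasurable
      (Eventually.of_forall fun x => (norm_fourier_apply _ x).le)).const_mul _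
  have hnorm : ∀ i, ∫ x, ‖c i * (fourier (h + n i) x * u x)‖ ∂haarC =
      ‖c i‖ * ∫ x, ‖u x‖ ∂haarC := fun i => by
    simp only [norm_mul, norm_fourier_apply, one_mul, integral_const_mul]
  have hs := hasSum_integral_of_summable_integral_norm hint
    ((hc.mul_right (∫ x, ‖u x‖ ∂haarC)).congr fun i => (hnorm i).symm)
  simp only [integral_const_mul] at hs
  have e : (fun x => ∑' i, c i * (fourier (h + n i) x * u x)) = fun x =>
      fourier h x * (F x * u x) := by
    funext x
    refine HasSum.tsum_eq ?_
    refine (((hF x).mul_right (u x)).mul_left (fourier h x)).congr_fun fun i => ?_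
    rw [fourier_add]
    ring
  rwa [e] at hs

/-- If the Fourier coefficients of `u` behave like `K n ^ (-b)`, those of `F u` behave like
`F(0) K n ^ (-b)`, by dominated convergence in the convolution sum. -/
theorem IsWeightedSeries.tendsto_cf_mul {F u : Circ → ℂ} (hF : IsWeightedSeries F)
    (hu : Integrable u haarC) {b : ℝ} (hb0 : 0 ≤ b) (hb1 : b ≤ 1) {C : ℝ} (hC0 : 0 ≤ C)
    (hC : ∀ k : ℤ, ‖cf u k‖ ≤ C * (1 + |(k : ℝ)|) ^ (-b)) {K : ℂ}
    (hK : Tendsto (fun n : ℕ => (((n : ℝ) ^ b : ℝ) : ℂ) * cf u n) atTop (𝓝 K)) :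
    Tendsto (fun n : ℕ => (((n : ℝ) ^ b : ℝ) : ℂ) * cf (fun x => F x * u x) n) atTop
      (𝓝 (F 0 * K)) := by
  obtain ⟨ι, _, c, n, hc, hF⟩ := hF
  have hc' : Summable fun i => ‖c i‖ := hc.of_nonneg_of_le (fun i => norm_nonneg _) fun i =>
    le_mul_of_one_le_left (norm_nonneg _) (le_add_of_nonneg_right (abs_nonneg _))
  have hF0 : HasSum (fun i => c i * K) (F 0 * K) := by
    have := (hF 0).mul_right K
    simpa only [fourier_eval_zero, mul_one] using this
  have hKZ : Tendsto (fun k : ℤ => (((k : ℝ) ^ b : ℝ) : ℂ) * cf u k) atTop (𝓝 K) := by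
    rw [← Nat.map_cast_int_atTop, tendsto_map'_iff]
    simpa [Function.comp_def] using hK
  have hterm : ∀ m : ℤ, Tendsto (fun h : ℕ => (((h : ℝ) ^ b : ℝ) : ℂ) * cf u (h + m)) atTop
      (𝓝 K) := by
    intro m
    have hshift : Tendsto (fun h : ℕ => (h : ℤ) + m) atTop atTop :=
      tendsto_atTop_add_const_right _ _ tendsto_natCast_atTop_atTop
    have hratio : Tendsto (fun h : ℕ => ((((h : ℝ) / ((h : ℝ) + m)) ^ b : ℝ) : ℂ)) atTop (𝓝 1) := by
      have h1 : Tendsto (fun h : ℕ => (h : ℝ) / ((h : ℝ) + m)) atTop (𝓝 1) :=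
        tendsto_natCast_div_add_atTop (m : ℝ)
      have h2 := h1.rpow_const (p := b) (Or.inl one_ne_zero)
      rw [Real.one_rpow] at h2
      exact_mod_cast (Complex.continuous_ofReal.tendsto 1).comp h2
    have h3 := hratio.mul (hKZ.comp hshift)
    rw [one_mul] at h3
    refine h3.congr' ?_
    filter_upwards [hshift.eventually_gt_atTop 0] with h hh
    have hh' : (0 : ℝ) < (h : ℝ) + m := by exact_mod_cast hh
    simp only [Function.comp_apply]
    rw [← mul_assoc, ← Complex.ofReal_mul]
    congr 2
    push_cast
    rw [Real.div_rpow (Nat.cast_nonneg _) hh'.le, div_mul_cancel₀]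
    exact (Real.rpow_pos_of_pos hh' _).ne'
  have hmain : Tendsto (fun h : ℕ => ∑' i, c i * ((((h : ℝ) ^ b : ℝ) : ℂ) * cf u (h + n i))) atTop
      (𝓝 (∑' i, c i * K)) := by
    refine tendsto_tsum_of_dominated_convergence
      (bound := fun i => C * ((1 + |(n i : ℝ)|) * ‖c i‖)) (hc.mul_left C)
      (fun i => (hterm (n i)).const_mul _) (Eventually.of_forall fun h i => ?_)
    have hp : (0 : ℝ) ≤ (h : ℝ) ^ b := Real.rpow_nonneg (Nat.cast_nonneg _) _
    have hpos : 0 < 1 + |(((h : ℤ) + n i : ℤ) : ℝ)| := by positivity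
    have hle : (h : ℝ) ≤ (1 + |(n i : ℝ)|) * (1 + |(((h : ℤ) + n i : ℤ) : ℝ)|) := by
      have h1 : (h : ℝ) ≤ |(n i : ℝ)| + |(((h : ℤ) + n i : ℤ) : ℝ)| := by
        push_cast
        linarith [neg_le_abs (n i : ℝ), le_abs_self ((h : ℝ) + n i)]
      nlinarith [mul_nonneg (abs_nonneg (n i : ℝ)) (abs_nonneg (((h : ℤ) + n i : ℤ) : ℝ))]
    have hone : 1 ≤ 1 + |(n i : ℝ)| := le_add_of_nonneg_right (abs_nonneg _)
    have hrp : (h : ℝ) ^ b * (1 + |(((h : ℤ) + n i : ℤ) : ℝ)|) ^ (-b) ≤ 1 + |(n i : ℝ)| := by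
      rw [Real.rpow_neg hpos.le, ← div_eq_mul_inv, div_le_iff₀ (Real.rpow_pos_of_pos hpos _)]
      calc (h : ℝ) ^ b ≤ ((1 + |(n i : ℝ)|) * (1 + |(((h : ℤ) + n i : ℤ) : ℝ)|)) ^ b :=
            Real.rpow_le_rpow (Nat.cast_nonneg _) hle hb0
        _ = (1 + |(n i : ℝ)|) ^ b * (1 + |(((h : ℤ) + n i : ℤ) : ℝ)|) ^ b :=
            Real.mul_rpow (by positivity) hpos.le
        _ ≤ (1 + |(n i : ℝ)|) * (1 + |(((h : ℤ) + n i : ℤ) : ℝ)|) ^ b := by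
            refine mul_le_mul_of_nonneg_right ?_ (Real.rpow_nonneg hpos.le _)
            simpa using Real.rpow_le_rpow_of_exponent_le hone hb1
    rw [norm_mul, norm_mul, Complex.norm_real, Real.norm_of_nonneg hp]
    calc ‖c i‖ * ((h : ℝ) ^ b * ‖cf u (h + n i)‖)
        ≤ ‖c i‖ * ((h : ℝ) ^ b * (C * (1 + |(((h : ℤ) + n i : ℤ) : ℝ)|) ^ (-b))) :=
          mul_le_mul_of_nonneg_left (mul_le_mul_of_nonneg_left (hC _) hp) (norm_nonneg _)
      _ = C * (‖c i‖ * ((h : ℝ) ^ b * (1 + |(((h : ℤ) + n i : ℤ) : ℝ)|) ^ (-b))) := by ring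
      _ ≤ C * (‖c i‖ * (1 + |(n i : ℝ)|)) :=
          mul_le_mul_of_nonneg_left (mul_le_mul_of_nonneg_left hrp (norm_nonneg _)) hC0
      _ = _ := by ring
  rw [hF0.tsum_eq] at hmain
  refine hmain.congr fun h => ?_
  rw [← (hasSum_cf_mul hc' hF hu h).tsum_eq, ← tsum_mul_left]
  refine tsum_congr fun i => ?_
  ring

/-- The constant in the asymptotic law of the Fourier coefficients of a power singularity. -/
noncomputable def singConst (δ : ℝ) : ℝ :=
  Real.Gamma (1 - 2 * δ) * Real.sin (Real.pi * δ) / Real.pi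

theorem tendsto_rpow_mul_rpow_of_lt (hδ : δ < a) :
    Tendsto (fun n : ℕ => (n : ℝ) ^ (1 - 2 * a) * (n : ℝ) ^ (2 * δ - 1)) atTop (𝓝 0) := by
  have h := (tendsto_rpow_neg_atTop (y := 2 * (a - δ)) (by linarith)).comp
    (tendsto_natCast_atTop_atTop (R := ℝ))
  refine h.congr' ?_
  filter_upwards [eventually_gt_atTop 0] with n hn
  have hn' : (0 : ℝ) < n := by exact_mod_cast hn
  rw [Function.comp_apply, ← Real.rpow_add hn']
  congr 1
  ring

/-- At the scale of the dominant singularity, the Fourier coefficients of a weaker singularity can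
be replaced by their asymptotic equivalent as well. -/
theorem tendsto_cf_singularity_sub {F : Circ → ℂ} (hF : IsWeightedSeries F) (hδ : δ ≤ a)
    (ha0 : 0 ≤ a) (ha : a < 1 / 2) :
    Tendsto (fun n : ℕ => (((n : ℝ) ^ (1 - 2 * a) : ℝ) : ℂ) *
      (cf (fun x => F x * ((‖1 - zed x‖ ^ (-2 * δ) : ℝ) : ℂ)) n -
        ((singConst δ * (n : ℝ) ^ (2 * δ - 1) : ℝ) : ℂ) * F 0)) atTop (𝓝 0) := by
  have hδ' : δ < 1 / 2 := by linarith
  obtain ⟨C, hC⟩ := exists_abs_singCoeff_le hδ'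
  have hC0 : 0 ≤ C := by
    have := (abs_nonneg _).trans (hC 0)
    simpa using this
  have hcf := cf_norm_one_sub_zed_rpow hδ'
  set K : ℝ := if δ = a then singConst δ else 0 with hK
  have hKlim : Tendsto (fun n : ℕ => (n : ℝ) ^ (1 - 2 * a) * (singConst δ * (n : ℝ) ^ (2 * δ - 1)))
      atTop (𝓝 K) := by
    rw [hK]
    split_ifs with h
    · refine tendsto_const_nhds.congr' ?_
      filter_upwards [eventually_gt_atTop 0] with n hn
      have hn' : (0 : ℝ) < n := by exact_mod_cast hn
      rw [mul_left_comm, ← Real.rpow_add hn', h, show 1 - 2 * a + (2 * a - 1) = 0 by ring,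
        Real.rpow_zero, mul_one]
    · have := (tendsto_rpow_mul_rpow_of_lt (lt_of_le_of_ne hδ h)).const_mul (singConst δ)
      rw [mul_zero] at this
      exact this.congr fun n => by ring
  have hcoeff : Tendsto (fun n : ℕ => (n : ℝ) ^ (1 - 2 * a) * singCoeff δ n) atTop (𝓝 K) := by
    rw [hK]
    have h0 := tendsto_singCoeff hδ'
    split_ifs with h
    · rw [← h]
      exact h0
    · have := (tendsto_rpow_mul_rpow_of_lt (lt_of_le_of_ne hδ h)).mul h0
      rw [zero_mul] at this
      refine this.congr' ?_
      filter_upwards [eventually_gt_atTop 0] with n hn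
      have hn' : (0 : ℝ) < n := by exact_mod_cast hn
      rw [mul_assoc, ← mul_assoc ((n : ℝ) ^ (2 * δ - 1)), ← Real.rpow_add hn',
        show 2 * δ - 1 + (1 - 2 * δ) = 0 by ring, Real.rpow_zero, one_mul]
  have h1 := hF.tendsto_cf_mul (integrable_singularity hδ') (b := 1 - 2 * a) (by linarith)
    (by linarith) hC0 (fun k => by
      rw [hcf, Complex.norm_real, Real.norm_eq_abs]
      refine (hC k).trans (mul_le_mul_of_nonneg_left ?_ hC0)
      exact Real.rpow_le_rpow_of_exponent_le (le_add_of_nonneg_right (abs_nonneg _))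
        (by linarith)) (K := K) (by
      have := (Complex.continuous_ofReal.tendsto K).comp hcoeff
      refine this.congr fun n => ?_
      rw [hcf, Function.comp_apply, Complex.ofReal_mul])
  have h2 := ((Complex.continuous_ofReal.tendsto K).comp hKlim).mul_const (F 0)
  have h3 := h1.sub h2
  rw [mul_comm (F 0), sub_self] at h3
  refine h3.congr fun n => ?_
  simp only [Function.comp_apply]
  push_cast
  ring

theorem norm_zed_sub_zed_eq (x θ : Circ) : ‖zed x - zed θ‖ = ‖1 - zed (x - θ)‖ := by
  have h : zed (x - θ) * zed θ = zed x := by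
    rw [zed, zed, ← fourier_add_arg, sub_add_cancel, zed]
  rw [← h, ← sub_one_mul, norm_mul, norm_zed, mul_one, norm_sub_rev]

theorem cf_translate (f : Circ → ℂ) (θ : Circ) (h : ℤ) :
    cf f h = fourier h θ * cf (fun x => f (x + θ)) h := by
  rw [cf, cf, ← integral_const_mul, ← integral_add_right_eq_self _ θ]
  refine integral_congr_ae (Eventually.of_forall fun x => ?_)
  simp only [fourier_add_arg]
  ring

theorem tendsto_cf_singularity_at_sub {F : Circ → ℂ} (hF : IsWeightedSeries F) (θ : Circ)
    (hδ : δ ≤ a) (ha0 : 0 ≤ a) (ha : a < 1 / 2) :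
    Tendsto (fun n : ℕ => (((n : ℝ) ^ (1 - 2 * a) : ℝ) : ℂ) *
      (cf (fun x => F x * ((‖zed x - zed θ‖ ^ (-2 * δ) : ℝ) : ℂ)) n -
        ((singConst δ * (n : ℝ) ^ (2 * δ - 1) : ℝ) : ℂ) * (fourier n θ * F θ))) atTop (𝓝 0) := by
  have h := tendsto_cf_singularity_sub (hF.comp_add_right θ) hδ ha0 ha
  rw [tendsto_zero_iff_norm_tendsto_zero] at h ⊢
  refine h.congr fun n => ?_
  rw [cf_translate (fun x => F x * ((‖zed x - zed θ‖ ^ (-2 * δ) : ℝ) : ℂ)) θ]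
  simp only [norm_zed_sub_zed_eq, add_sub_cancel_right, zero_add]
  rw [norm_mul, norm_mul, mul_left_comm _ (fourier n θ : ℂ), ← mul_sub, norm_mul (fourier n θ : ℂ),
    norm_fourier_apply, one_mul]

/-- The square of `z - ζ` restores the decay of the Fourier coefficients. -/
theorem isWeightedSeries_sq_mul_singularity (hδ : δ < 1 / 2) (θ : Circ) :
    IsWeightedSeries fun x => (zed x - zed θ) ^ 2 * ((‖zed x - zed θ‖ ^ (-2 * δ) : ℝ) : ℂ) := by
  have h1 := (IsWeightedSeries.norm_one_sub_zed_rpow (δ := δ - 1) (by linarith)).comp_add_right (-θ)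
  have h2 := (IsWeightedSeries.polynomial (Polynomial.C (-zed θ) * Polynomial.X)).mul h1
  refine h2.congr fun x => ?_
  rw [← sub_eq_add_neg, ← norm_zed_sub_zed_eq, Polynomial.eval_mul, Polynomial.eval_C,
    Polynomial.eval_X]
  rcases eq_or_ne (zed x) (zed θ) with h | h
  · rw [h, sub_self, norm_zero, Real.zero_rpow (by linarith)]
    simp
  · have hpos : 0 < ‖zed x - zed θ‖ := norm_pos_iff.2 (sub_ne_zero.2 h)
    rw [show -2 * (δ - 1) = (2 : ℕ) + -2 * δ by push_cast; ring, Real.rpow_add hpos,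
      Real.rpow_natCast, Complex.ofReal_mul, ← mul_assoc]
    congr 1
    have hx : zed x * (starRingEnd ℂ) (zed x) = 1 := by
      rw [Complex.mul_conj, Complex.normSq_eq_norm_sq, norm_zed]; simp
    have hθ : zed θ * (starRingEnd ℂ) (zed θ) = 1 := by
      rw [Complex.mul_conj, Complex.normSq_eq_norm_sq, norm_zed]; simp
    rw [← Complex.normSq_eq_norm_sq, Complex.normSq_eq_conj_mul_self, map_sub]
    linear_combination (zed θ * (zed θ - zed x)) * hx + (zed x * (zed x - zed θ)) * hθ

/-- The Fourier coefficients of a function with finitely many power singularities on the circle are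
asymptotically the sum of the contributions of the single singularities. A partition of unity
`1 = ∑ i, A_i(z) ∏ j ≠ i, (z - ζ_j)²`, which exists because the `z - ζ_j` are pairwise coprime
polynomials, isolates the singularities. -/
theorem tendsto_cf_prod_singularity_sub {ι : Type*} [DecidableEq ι] {T : Finset ι}
    (hT : T.Nonempty) {θ : ι → Circ} (hθ : Set.InjOn (fun i => zed (θ i)) T) {δ : ι → ℝ}
    (hδ : ∀ i ∈ T, δ i ≤ a) (ha0 : 0 ≤ a) (ha : a < 1 / 2) {G : Circ → ℂ}
    (hG : IsWeightedSeries G) :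
    Tendsto (fun n : ℕ => (((n : ℝ) ^ (1 - 2 * a) : ℝ) : ℂ) *
      (cf (fun x => G x * ((∏ i ∈ T, ‖zed x - zed (θ i)‖ ^ (-2 * δ i) : ℝ) : ℂ)) n -
        ∑ i ∈ T, ((singConst (δ i) * (n : ℝ) ^ (2 * δ i - 1) : ℝ) : ℂ) * (fourier n (θ i) *
          (G (θ i) * ((∏ j ∈ T.erase i, ‖zed (θ i) - zed (θ j)‖ ^ (-2 * δ j) : ℝ) : ℂ))))) atTop
      (𝓝 0) := by
  set ρ : ι → Polynomial ℂ := fun i => (Polynomial.X - Polynomial.C (zed (θ i))) ^ 2 with hρ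
  have hev : ∀ i x, (ρ i).eval (zed x) = (zed x - zed (θ i)) ^ 2 := fun i x => by simp [hρ]
  have hcop : Pairwise (Function.onFun IsCoprime fun i : T => ρ i) := by
    intro i j hij
    refine IsCoprime.pow (Polynomial.isCoprime_X_sub_C_of_isUnit_sub ?_)
    exact (sub_ne_zero.2 fun h => hij (Subtype.ext (hθ i.2 j.2 h))).isUnit
  obtain ⟨A, hA⟩ := (exists_sum_eq_one_iff_pairwise_coprime hT).2 hcop
  have hA1 : ∀ x : Circ, ∑ i ∈ T, (A i).eval (zed x) *
      ∏ j ∈ T.erase i, (zed x - zed (θ j)) ^ 2 = 1 := by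
    intro x
    have := congrArg (Polynomial.eval (zed x)) hA
    simpa only [Polynomial.eval_finsetSum, Polynomial.eval_mul, Polynomial.eval_prod, hev,
      Polynomial.eval_one, Finset.sdiff_singleton_eq_erase] using this
  have hA2 : ∀ i ∈ T, (A i).eval (zed (θ i)) *
      ∏ j ∈ T.erase i, (zed (θ i) - zed (θ j)) ^ 2 = 1 := by
    intro i hi
    rw [← hA1 (θ i), eq_comm]
    refine Finset.sum_eq_single_of_mem i hi fun j hj hji => ?_
    rw [Finset.prod_eq_zero (Finset.mem_erase.2 ⟨hji.symm, hi⟩) (by rw [sub_self]; simp), mul_zero]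
  -- the factor multiplying the singularity at `θ i`
  set q : ι → Circ → ℂ := fun i x => G x * ((A i).eval (zed x) * ∏ j ∈ T.erase i,
    ((zed x - zed (θ j)) ^ 2 * ((‖zed x - zed (θ j)‖ ^ (-2 * δ j) : ℝ) : ℂ))) with hq
  have hqw : ∀ i, IsWeightedSeries (q i) := fun i =>
    hG.mul ((IsWeightedSeries.polynomial (A i)).mul (IsWeightedSeries.prod fun j hj =>
      isWeightedSeries_sq_mul_singularity
        ((hδ j (Finset.mem_of_mem_erase hj)).trans_lt ha) (θ j)))
  have hsplit : ∀ x, G x * ((∏ i ∈ T, ‖zed x - zed (θ i)‖ ^ (-2 * δ i) : ℝ) : ℂ) =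
      ∑ i ∈ T, q i x * ((‖zed x - zed (θ i)‖ ^ (-2 * δ i) : ℝ) : ℂ) := by
    intro x
    rw [← mul_one (G x * _), ← hA1 x, Finset.mul_sum]
    refine Finset.sum_congr rfl fun i hi => ?_
    rw [← Finset.mul_prod_erase T _ hi]
    simp only [hq, Finset.prod_mul_distrib]
    push_cast
    ring
  have hint : ∀ i ∈ T, Integrable (fun x => q i x * ((‖zed x - zed (θ i)‖ ^ (-2 * δ i) : ℝ) : ℂ))
      haarC := by
    intro i hi
    obtain ⟨B, hB⟩ := exists_norm_le_of_continuous (hqw i).continuous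
    have hu := (integrable_singularity ((hδ i hi).trans_lt ha)).comp_add_right (-θ i)
    simp only [← sub_eq_add_neg, ← norm_zed_sub_zed_eq] at hu
    exact hu.bdd_mul (hqw i).continuous.aestronglyMeasurable (Eventually.of_forall hB)
  have hqθ : ∀ i ∈ T, q i (θ i) =
      G (θ i) * ((∏ j ∈ T.erase i, ‖zed (θ i) - zed (θ j)‖ ^ (-2 * δ j) : ℝ) : ℂ) := by
    intro i hi
    simp only [hq, Finset.prod_mul_distrib]
    rw [← mul_assoc ((A i).eval _), hA2 i hi, one_mul]
    push_cast
    rfl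
  have hsum := tendsto_finsetSum T fun i hi =>
    tendsto_cf_singularity_at_sub (hqw i) (θ i) (hδ i hi) ha0 ha
  rw [Finset.sum_const_zero] at hsum
  refine hsum.congr fun n => ?_
  rw [← Finset.mul_sum, Finset.sum_sub_distrib]
  congr 2
  · simp only [hsplit, cf, Finset.mul_sum]
    rw [integral_finsetSum]
    intro i hi
    exact (hint i hi).bdd_mul (c := 1) (measurable_fourier _).aestronglyMeasurable
      (Eventually.of_forall fun x => (norm_fourier_apply _ x).le)
  · refine Finset.sum_congr rfl fun i hi => ?_
    rw [hqθ i hi]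

end Asymptotics

/-! ### The singularities of the spectral density -/

section Frequencies

variable {s : Fin 2 → ℕ} {d : Fin 2 → ℝ}

theorem mem_Icc_of_mem_seasonalFreqs (hs : ∀ i, 0 < s i) {μ : ℝ} (hμ : μ ∈ seasonalFreqs s) :
    μ ∈ Set.Icc 0 Real.pi := by
  obtain ⟨i, hi⟩ := mem_seasonalFreqs.1 hμ
  obtain ⟨j, hj, rfl⟩ := mem_periodFreqs.1 hi
  have hsi : (0 : ℝ) < s i := by exact_mod_cast hs i
  have hj2 : (2 : ℝ) * j ≤ s i := by
    have : 2 * j ≤ s i := by omega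
    exact_mod_cast this
  refine ⟨by rw [freq]; positivity, ?_⟩
  rw [freq, div_le_iff₀ hsi]
  nlinarith [Real.pi_pos]

/-- The seasonal frequencies in `(-π, π]`. -/
noncomputable def signedFreqs (s : Fin 2 → ℕ) : Finset ℝ :=
  seasonalFreqs s ∪ ((seasonalFreqs s).filter fun μ => ¬(μ = 0 ∨ μ = Real.pi)).image Neg.neg

theorem mem_signedFreqs {θ : ℝ} : θ ∈ signedFreqs s ↔ θ ∈ seasonalFreqs s ∨
    ∃ μ ∈ seasonalFreqs s, ¬(μ = 0 ∨ μ = Real.pi) ∧ -μ = θ := by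
  simp [signedFreqs, and_assoc]

theorem mem_Ioc_of_mem_signedFreqs (hs : ∀ i, 0 < s i) {θ : ℝ} (hθ : θ ∈ signedFreqs s) :
    θ ∈ Set.Ioc (-Real.pi) Real.pi := by
  have hπ := Real.pi_pos
  rcases mem_signedFreqs.1 hθ with h | ⟨μ, h, hμ, rfl⟩
  · have := mem_Icc_of_mem_seasonalFreqs hs h
    exact ⟨by linarith [this.1], this.2⟩
  · have := mem_Icc_of_mem_seasonalFreqs hs h
    rw [not_or] at hμ
    exact ⟨neg_lt_neg (lt_of_le_of_ne this.2 hμ.2), by linarith [this.1]⟩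

@[to_additive]
theorem prod_signedFreqs {M : Type*} [CommMonoid M] (hs : ∀ i, 0 < s i) (a : ℝ → M) :
    ∏ θ ∈ signedFreqs s, a θ =
      ∏ μ ∈ seasonalFreqs s, if μ = 0 ∨ μ = Real.pi then a μ else a μ * a (-μ) := by
  rw [signedFreqs, Finset.prod_union, Finset.prod_image (fun x _ y _ h => neg_injective h),
    Finset.prod_filter, ← Finset.prod_mul_distrib]
  · refine Finset.prod_congr rfl fun μ _ => ?_
    split_ifs <;> simp_all
  · rw [Finset.disjoint_left]
    intro θ hθ h
    obtain ⟨μ, hμ, rfl⟩ := Finset.mem_image.1 h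
    obtain ⟨hμ, hne⟩ := Finset.mem_filter.1 hμ
    have h1 := mem_Icc_of_mem_seasonalFreqs hs hμ
    have h2 := mem_Icc_of_mem_seasonalFreqs hs hθ
    exact hne (Or.inl (le_antisymm (by linarith [h2.1]) h1.1))

theorem injOn_zed_signedFreqs (hs : ∀ i, 0 < s i) :
    Set.InjOn (fun θ : ℝ => zed (θ : Circ)) (signedFreqs s) := by
  intro x hx y hy h
  have hx := mem_Ioc_of_mem_signedFreqs hs hx
  have hy := mem_Ioc_of_mem_signedFreqs hs hy
  have h1 := norm_zed_sub_zed x y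
  simp only at h
  rw [h, sub_self, norm_zero, eq_comm, abs_eq_zero] at h1
  have h2 : Real.sin ((x - y) / 2) = 0 := by linarith
  have h3 := (Real.sin_eq_zero_iff_of_lt_of_lt (by linarith [hx.1, hy.2])
    (by linarith [hx.2, hy.1])).1 h2
  linarith

theorem zed_neg_eq_of_endpoint {μ : ℝ} (hμ : μ = 0 ∨ μ = Real.pi) :
    zed ((-μ : ℝ) : Circ) = zed (μ : Circ) := by
  rw [zed_coe, zed_coe]
  rcases hμ with rfl | rfl
  · simp
  · rw [Complex.ofReal_neg, mul_neg, neg_neg, Complex.exp_neg, mul_comm, Complex.exp_pi_mul_I]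
    norm_num

theorem rpow_mul_self {t : ℝ} (ht : 0 ≤ t) (r : ℝ) : (t * t) ^ r = t ^ (2 * r) := by
  rw [← sq, ← Real.rpow_natCast, ← Real.rpow_mul ht]
  norm_num

theorem pairFactor_rpow (μ x : ℝ) :
    pairFactor μ x ^ (-2 * memoryParam s d μ) = if μ = 0 ∨ μ = Real.pi then
      ‖zed (x : Circ) - zed (μ : Circ)‖ ^ (-2 * memoryOrder s d μ) else
      ‖zed (x : Circ) - zed (μ : Circ)‖ ^ (-2 * memoryOrder s d μ) *
        ‖zed (x : Circ) - zed ((-μ : ℝ) : Circ)‖ ^ (-2 * memoryOrder s d μ) := by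
  rw [pairFactor_eq_norm, memoryParam]
  split_ifs with h
  · rw [zed_neg_eq_of_endpoint h, rpow_mul_self (norm_nonneg _)]
    congr 1
    ring
  · rw [Real.mul_rpow (norm_nonneg _) (norm_nonneg _)]

theorem abs_eq_of_mem_seasonalFreqs (hs : ∀ i, 0 < s i) {μ : ℝ} (hμ : μ ∈ seasonalFreqs s) :
    |μ| = μ := abs_of_nonneg (mem_Icc_of_mem_seasonalFreqs hs hμ).1

/-- The spectral factor as a product over the singularities. -/
theorem sineFactor_eq_prod_signedFreqs (hs : ∀ i, 0 < s i) (he : ∀ i, Even (s i)) {x : ℝ}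
    (hx : ∀ i, Real.sin (x * s i / 2) ≠ 0) :
    sineFactor s d x = ∏ θ ∈ signedFreqs s,
      ‖zed (x : Circ) - zed (θ : Circ)‖ ^ (-2 * memoryOrder s d |θ|) := by
  rw [sineFactor_eq_prod hs he hx, prod_signedFreqs hs]
  refine Finset.prod_congr rfl fun μ hμ => ?_
  rw [pairFactor_rpow, abs_neg, abs_eq_of_mem_seasonalFreqs hs hμ]

theorem norm_seasonalTransfer_neg_sq_eq_prod (hs : ∀ i, 0 < s i) (he : ∀ i, Even (s i)) {x : Circ}
    (hx : ∀ i, zed x ^ s i ≠ 1) :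
    ‖seasonalTransfer s (-d) x‖ ^ 2 = ∏ θ ∈ signedFreqs s,
      ‖zed x - zed (θ : Circ)‖ ^ (-2 * memoryOrder s d |θ|) := by
  obtain ⟨x, rfl⟩ := QuotientAddGroup.mk_surjective x
  refine (norm_seasonalTransfer_neg_sq s d x).trans (sineFactor_eq_prod_signedFreqs hs he
    fun i h => hx i ?_)
  have := norm_one_sub_zed_pow_coe (s i) x
  rw [h, mul_zero, abs_zero, norm_eq_zero, sub_eq_zero] at this
  exact this.symm

theorem pairFactor_eq_abs_cos_sub (κ x : ℝ) :
    pairFactor κ x = |2 * (Real.cos x - Real.cos κ)| := by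
  rw [pairFactor, Real.cos_sub_cos, ← abs_neg]
  congr 1
  ring

/-- The constant `D_μ²` is the value at `±μ` of the spectral factor stripped of its singular
factor there. -/
theorem prod_erase_signedFreqs (hs : ∀ i, 0 < s i) {θ : ℝ} (hθ : θ ∈ signedFreqs s) :
    ∏ κ ∈ (signedFreqs s).erase θ,
      ‖zed (θ : Circ) - zed (κ : Circ)‖ ^ (-2 * memoryOrder s d |κ|) = asympD s d |θ| ^ 2 := by
  set a : ℝ → ℝ := fun κ => ‖zed (θ : Circ) - zed (κ : Circ)‖ ^ (-2 * memoryOrder s d |κ|) with ha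
  have hμ : |θ| ∈ seasonalFreqs s := by
    rcases mem_signedFreqs.1 hθ with h | ⟨μ, h, -, rfl⟩
    · rwa [abs_eq_of_mem_seasonalFreqs hs h]
    · rwa [abs_neg, abs_eq_of_mem_seasonalFreqs hs h]
  have h1 : ∏ κ ∈ (signedFreqs s).erase θ, a κ =
      ∏ κ ∈ signedFreqs s, if κ = θ then 1 else a κ := by
    rw [← Finset.mul_prod_erase _ _ hθ, if_pos rfl, one_mul]
    exact Finset.prod_congr rfl fun κ hκ => (if_neg (Finset.ne_of_mem_erase hκ)).symm
  rw [h1, prod_signedFreqs hs, ← Finset.mul_prod_erase _ _ hμ, asympD, mul_pow,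
    ← Finset.prod_pow]
  congr 1
  · by_cases hend : |θ| = 0 ∨ |θ| = Real.pi
    · have hpos : 0 ≤ θ := by
        by_contra hneg
        have h2 := mem_Ioc_of_mem_signedFreqs hs hθ
        rw [abs_of_neg (not_le.1 hneg)] at hend
        rcases hend with h | h <;> linarith [h2.1, not_le.1 hneg]
      rw [if_pos hend, if_pos hend, abs_of_nonneg hpos, if_pos rfl, one_pow]
    · have h0 : θ ≠ 0 := fun h => hend (Or.inl (by rw [h, abs_zero]))
      have hsin : ‖zed (θ : Circ) - zed ((-θ : ℝ) : Circ)‖ = |2 * Real.sin (|θ|)| := by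
        rw [norm_zed_sub_zed, sub_neg_eq_add, add_self_div_two]
        rcases abs_choice θ with h | h <;> rw [h]
        rw [Real.sin_neg, mul_neg, abs_neg]
      have hsq : (|2 * Real.sin (|θ|)| ^ (-memoryParam s d |θ|)) ^ 2 = a (-θ) := by
        rw [ha]
        simp only
        rw [hsin, abs_neg, ← Real.rpow_natCast, ← Real.rpow_mul (abs_nonneg _), memoryParam,
          if_neg hend]
        congr 1
        push_cast
        ring
      rw [if_neg hend, if_neg hend, hsq]
      rcases abs_choice θ with h | h
      · rw [h, if_pos rfl, one_mul, if_neg]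
        intro h'
        exact h0 (by linarith)
      · rw [h, neg_neg, if_pos rfl, mul_one, if_neg]
        intro h'
        exact h0 (by linarith)
  · refine Finset.prod_congr rfl fun κ hκ => ?_
    obtain ⟨hne, hκ⟩ := Finset.mem_erase.1 hκ
    have hκ0 := abs_eq_of_mem_seasonalFreqs hs hκ
    have h2 : κ ≠ θ := fun h => hne (by rw [← h, hκ0])
    have h3 : -κ ≠ θ := fun h => hne (by rw [← h, abs_neg, hκ0])
    rw [if_neg h2, if_neg h3, Real.cos_abs, ← pairFactor_eq_abs_cos_sub, ← Real.rpow_natCast,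
      ← Real.rpow_mul (pairFactor_nonneg _ _),
      show -memoryParam s d κ * ((2 : ℕ) : ℝ) = -2 * memoryParam s d κ by push_cast; ring,
      pairFactor_rpow]
    simp only [ha, abs_neg, hκ0]

theorem asympD_ne_zero (hs : ∀ i, 0 < s i) {μ : ℝ} (hμ : μ ∈ seasonalFreqs s) :
    asympD s d μ ≠ 0 := by
  have h := prod_erase_signedFreqs (d := d) hs (Finset.mem_union_left _ hμ : μ ∈ signedFreqs s)
  rw [abs_eq_of_mem_seasonalFreqs hs hμ] at h
  refine pow_ne_zero_iff two_ne_zero |>.1 (h ▸ Finset.prod_ne_zero_iff.2 fun κ hκ => ?_)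
  obtain ⟨hne, hκ⟩ := Finset.mem_erase.1 hκ
  refine (Real.rpow_pos_of_pos (norm_pos_iff.2 (sub_ne_zero.2 fun h => hne ?_)) _).ne'
  exact (injOn_zed_signedFreqs hs (Finset.mem_union_left _ hμ) hκ h).symm

/-- Integrability of the spectral factor bounds the memory orders. -/
theorem memoryOrder_lt_half (hs : ∀ i, 0 < s i) (he : ∀ i, Even (s i))
    (hint : IntegrableOn (sineFactor s d) (Set.Ioc (-Real.pi) Real.pi)) {μ : ℝ}
    (hμ : μ ∈ seasonalFreqs s) : memoryOrder s d μ < 1 / 2 := by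
  by_contra! hge
  have hπ := Real.pi_pos
  have hμS : μ ∈ signedFreqs s := Finset.mem_union_left _ hμ
  obtain ⟨hμ0, hμπ⟩ := mem_Icc_of_mem_seasonalFreqs hs hμ
  set R : ℝ → ℝ := fun x => ∏ κ ∈ (signedFreqs s).erase μ,
    ‖zed (x : Circ) - zed (κ : Circ)‖ ^ (-2 * memoryOrder s d |κ|) with hR
  have hcz : Continuous fun x : ℝ => zed (x : Circ) :=
    continuous_zed.comp (AddCircle.continuous_mk' _)
  have hne : ∀ κ ∈ (signedFreqs s).erase μ, ‖zed (μ : Circ) - zed (κ : Circ)‖ ≠ 0 := by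
    intro κ hκ
    obtain ⟨hne, hκ⟩ := Finset.mem_erase.1 hκ
    exact norm_ne_zero_iff.2 (sub_ne_zero.2 fun h =>
      hne (injOn_zed_signedFreqs hs hμS hκ h).symm)
  have hRc : ContinuousAt R μ := tendsto_finsetProd _ fun κ hκ =>
    ((hcz.sub continuous_const).norm.continuousAt).rpow_const (Or.inl (hne κ hκ))
  have hR0 : 0 < R μ := Finset.prod_pos fun κ hκ =>
    Real.rpow_pos_of_pos (lt_of_le_of_ne (norm_nonneg _) (hne κ hκ).symm) _
  obtain ⟨η, hη, hball⟩ := Metric.eventually_nhds_iff.1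
    (hRc.eventually (lt_mem_nhds (half_lt_self hR0)))
  set ε := min η 1 with hε
  have hε0 : 0 < ε := lt_min hη one_pos
  have hsub : Set.Ioc (μ - ε) μ ⊆ Set.Ioc (-Real.pi) Real.pi := fun x hx =>
    ⟨by linarith [hx.1, min_le_right η 1, Real.pi_gt_three], hx.2.trans hμπ⟩
  have hdom : IntegrableOn (fun x => (x - μ)⁻¹) (Set.Ioc (μ - ε) μ) := by
    refine Integrable.mono ((hint.mono_set hsub).const_mul (2 / R μ))
      (by fun_prop) ?_
    have hae := ae_mono (Measure.restrict_mono_set volume hsub) (ae_sin_ne_zero hs)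
    filter_upwards [hae, ae_restrict_mem measurableSet_Ioc,
      ae_mono Measure.restrict_le_self (Measure.ae_ne volume μ)] with x hx hxI hxμ
    have hdist : |x - μ| < η := by
      rw [abs_lt]
      constructor <;> linarith [hxI.1, hxI.2, min_le_left η 1]
    have h1 : |x - μ| ≤ 1 := by
      rw [abs_le]
      constructor <;> linarith [hxI.1, hxI.2, min_le_right η 1]
    have hpos : 0 < |x - μ| := abs_pos.2 (sub_ne_zero.2 hxμ)
    have hRx : R μ / 2 < R x := hball hdist
    have hsin : ‖zed (x : Circ) - zed (μ : Circ)‖ ≤ |x - μ| := by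
      rw [norm_zed_sub_zed, abs_mul, abs_two]
      have := Real.abs_sin_le_abs (x := (x - μ) / 2)
      rw [abs_div, abs_two] at this
      linarith
    have hnpos : 0 < ‖zed (x : Circ) - zed (μ : Circ)‖ := by
      refine lt_of_le_of_ne (norm_nonneg _) fun h => ?_
      have h2 := pairFactor_pos hs hx hμ
      rw [pairFactor_eq_norm, ← h, zero_mul] at h2
      exact lt_irrefl _ h2
    have hpow : |x - μ|⁻¹ ≤ ‖zed (x : Circ) - zed (μ : Circ)‖ ^ (-2 * memoryOrder s d |μ|) := by
      rw [abs_of_nonneg hμ0]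
      calc |x - μ|⁻¹ = |x - μ| ^ (-1 : ℝ) := (Real.rpow_neg_one _).symm
        _ ≤ |x - μ| ^ (-2 * memoryOrder s d μ) :=
          Real.rpow_le_rpow_of_exponent_ge hpos h1 (by linarith)
        _ ≤ _ := Real.rpow_le_rpow_of_nonpos hnpos hsin (by linarith)
    have hval : sineFactor s d x =
        ‖zed (x : Circ) - zed (μ : Circ)‖ ^ (-2 * memoryOrder s d |μ|) * R x := by
      rw [sineFactor_eq_prod_signedFreqs hs he hx, ← Finset.mul_prod_erase _ _ hμS]
    rw [norm_inv, Real.norm_eq_abs, Real.norm_eq_abs]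
    refine le_trans ?_ (le_abs_self _)
    rw [hval]
    calc |x - μ|⁻¹ = 2 / R μ * (|x - μ|⁻¹ * (R μ / 2)) := by field_simp
      _ ≤ _ := mul_le_mul_of_nonneg_left
        (mul_le_mul hpow hRx.le (by linarith) ((inv_nonneg.2 hpos.le).trans hpow)) (by positivity)
  have hii : IntervalIntegrable (fun x => (x - μ)⁻¹) volume (μ - ε) μ :=
    (intervalIntegrable_iff_integrableOn_Ioc_of_le (by linarith)).2 hdom
  rcases intervalIntegrable_sub_inv_iff.1 hii with h | h
  · linarith
  · exact h Set.right_mem_uIcc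

end Frequencies

/-! ### The asymptotic autocovariance -/

section Autocovariance

variable {Ω : Type*} [MeasurableSpace Ω] {P : Measure Ω} {v : NNReal} {e ν X : ℤ → Ω → ℝ}
  {U : Lp ℂ 2 haarC →L[ℂ] Lp ℂ 2 P} {Φ Θ : Polynomial ℝ} {s : Fin 2 → ℕ} {d : Fin 2 → ℝ}
  {a : ℝ}

theorem isWeightedSeries_norm_armaTransfer_sq
    (hΦ : ∀ z : ℂ, ‖z‖ = 1 → Polynomial.aeval z Φ ≠ 0) :
    IsWeightedSeries fun x => ((‖armaTransfer Φ Θ x‖ ^ 2 : ℝ) : ℂ) := by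
  have hg : IsWeightedSeries (armaTransfer Φ Θ) := by
    refine ((IsWeightedSeries.polynomial (Θ.map Complex.ofRealHom)).mul
      (IsWeightedSeries.inv_polynomial (Φ.map Complex.ofRealHom) fun z hz => ?_)).congr fun x => ?_
    · rw [eval_map_ofRealHom]
      exact hΦ z hz
    · rw [eval_map_ofRealHom, eval_map_ofRealHom, armaTransfer, div_eq_mul_inv]
  refine (hg.mul hg.starRingEnd).congr fun x => ?_
  rw [Complex.mul_conj, Complex.normSq_eq_norm_sq]

theorem armaGain_neg (Φ Θ : Polynomial ℝ) (x : ℝ) : armaGain Φ Θ (-x) = armaGain Φ Θ x := by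
  have h : Complex.exp (-(Complex.I * ((-x : ℝ) : ℂ))) =
      (starRingEnd ℂ) (Complex.exp (-(Complex.I * x))) := by
    rw [← Complex.exp_conj]
    simp
  rw [armaGain, h, Polynomial.aeval_conj, Polynomial.aeval_conj, ← map_div₀, Complex.norm_conj,
    armaGain]

theorem armaGain_abs (Φ Θ : Polynomial ℝ) (x : ℝ) : armaGain Φ Θ |x| = armaGain Φ Θ x := by
  rcases abs_choice x with h | h <;> rw [h]
  exact armaGain_neg Φ Θ x

theorem fourier_coe_add_neg (n : ℕ) (x : ℝ) :
    (fourier (n : ℤ) (x : Circ) : ℂ) + fourier (n : ℤ) ((-x : ℝ) : Circ) =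
      2 * Real.cos (n * x) := by
  rw [fourier_coe_exp, fourier_coe_exp]
  push_cast
  rw [Complex.cos]
  ring_nf

theorem fourier_coe_of_endpoint (n : ℕ) {x : ℝ} (hx : x = 0 ∨ x = Real.pi) :
    (fourier (n : ℤ) (x : Circ) : ℂ) = Real.cos (n * x) := by
  have hs : Real.sin (n * x) = 0 := by
    rcases hx with rfl | rfl
    · simp
    · exact Real.sin_nat_mul_pi n
  rw [fourier_coe_exp, show Complex.I * ((n : ℤ) : ℂ) * x = ((n * x : ℝ) : ℂ) * Complex.I by
    push_cast; ring, Complex.exp_mul_I, ← Complex.ofReal_cos, ← Complex.ofReal_sin, hs]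
  simp

/-- The contributions of the singularities at `±μ` combine to the term of the frequency `μ`. -/
theorem sum_signedFreqs_eq (hs : ∀ i, 0 < s i) (n : ℕ) :
    (v : ℂ) * ∑ θ ∈ signedFreqs s,
      ((singConst (memoryOrder s d |θ|) * (n : ℝ) ^ (2 * memoryOrder s d |θ| - 1) : ℝ) : ℂ) *
        (fourier (n : ℤ) (θ : Circ) * (((‖armaTransfer Φ Θ (θ : Circ)‖ ^ 2 : ℝ) : ℂ) *
          ((∏ κ ∈ (signedFreqs s).erase θ, ‖zed (θ : Circ) - zed (κ : Circ)‖ ^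
            (-2 * memoryOrder s d |κ|) : ℝ) : ℂ))) =
    ((∑ μ ∈ seasonalFreqs s, asympCoeff s d Φ Θ v μ * (n : ℝ) ^ (2 * memoryOrder s d μ - 1) *
      Real.cos (n * μ) : ℝ) : ℂ) := by
  set A : ℝ → ℝ := fun μ => singConst (memoryOrder s d μ) * (n : ℝ) ^ (2 * memoryOrder s d μ - 1) *
    (armaGain Φ Θ μ * asympD s d μ ^ 2) with hA
  have h1 : ∀ θ ∈ signedFreqs s,
      ((singConst (memoryOrder s d |θ|) * (n : ℝ) ^ (2 * memoryOrder s d |θ| - 1) : ℝ) : ℂ) *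
        (fourier (n : ℤ) (θ : Circ) * (((‖armaTransfer Φ Θ (θ : Circ)‖ ^ 2 : ℝ) : ℂ) *
          ((∏ κ ∈ (signedFreqs s).erase θ, ‖zed (θ : Circ) - zed (κ : Circ)‖ ^
            (-2 * memoryOrder s d |κ|) : ℝ) : ℂ))) = (A |θ| : ℂ) * fourier (n : ℤ) (θ : Circ) := by
    intro θ hθ
    rw [prod_erase_signedFreqs hs hθ, ← armaGain_eq, ← armaGain_abs]
    simp only [hA]
    push_cast
    ring
  rw [Finset.sum_congr rfl h1, sum_signedFreqs hs, Finset.mul_sum, Complex.ofReal_sum]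
  refine Finset.sum_congr rfl fun μ hμ => ?_
  rw [abs_neg, abs_eq_of_mem_seasonalFreqs hs hμ, ← mul_add, fourier_coe_add_neg]
  by_cases hend : μ = 0 ∨ μ = Real.pi
  · rw [if_pos hend, fourier_coe_of_endpoint n hend, asympCoeff, if_pos hend]
    simp only [hA, singConst, mul_comm Real.pi]
    push_cast
    ring
  · rw [if_neg hend, asympCoeff, if_neg hend]
    simp only [hA, singConst, mul_comm Real.pi]
    push_cast
    ring

theorem tendsto_autocovariance_sub (hs : ∀ i, 0 < s i) (he : ∀ i, Even (s i))
    (hΦ : ∀ z : ℂ, ‖z‖ = 1 → Polynomial.aeval z Φ ≠ 0) (hU : IsSpectralIsometry P v e U)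
    (hX : HasTransfer P U X fun x => seasonalTransfer s (-d) x * armaTransfer Φ Θ x)
    (hΛ : (seasonalFreqs s).Nonempty) (hda : ∀ μ ∈ seasonalFreqs s, memoryOrder s d μ ≤ a)
    (ha0 : 0 ≤ a) (ha : a < 1 / 2) :
    Tendsto (fun n : ℕ => (n : ℝ) ^ (1 - 2 * a) * (∫ ω, X n ω * X 0 ω ∂P -
      ∑ μ ∈ seasonalFreqs s, asympCoeff s d Φ Θ v μ * (n : ℝ) ^ (2 * memoryOrder s d μ - 1) *
        Real.cos (n * μ))) atTop (𝓝 0) := by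
  have hS : ∀ θ ∈ signedFreqs s, memoryOrder s d |θ| ≤ a := by
    intro θ hθ
    rcases mem_signedFreqs.1 hθ with h | ⟨μ, h, -, rfl⟩
    · rw [abs_eq_of_mem_seasonalFreqs hs h]
      exact hda θ h
    · rw [abs_neg, abs_eq_of_mem_seasonalFreqs hs h]
      exact hda μ h
  have hmain := (tendsto_cf_prod_singularity_sub (T := signedFreqs s) (hΛ.mono
    Finset.subset_union_left) (θ := fun θ : ℝ => (θ : Circ)) (injOn_zed_signedFreqs hs)
    (δ := fun θ => memoryOrder s d |θ|) hS ha0 ha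
    (isWeightedSeries_norm_armaTransfer_sq (Θ := Θ) hΦ)).const_mul (v : ℂ)
  rw [mul_zero] at hmain
  have hre := (Complex.continuous_re.tendsto 0).comp hmain
  rw [Complex.zero_re] at hre
  refine hre.congr fun n => ?_
  have hcov : ((∫ ω, X n ω * X 0 ω ∂P : ℝ) : ℂ) = v * cf (fun x =>
      ((‖armaTransfer Φ Θ x‖ ^ 2 : ℝ) : ℂ) * ((∏ θ ∈ signedFreqs s,
        ‖zed x - zed (θ : Circ)‖ ^ (-2 * memoryOrder s d |θ|) : ℝ) : ℂ)) n := by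
    rw [hX.integral_mul hU n 0, sub_zero]
    congr 1
    refine integral_congr_ae ?_
    filter_upwards [ae_all_iff.2 fun i => ae_zed_pow_ne_one (hs i)] with x hx
    rw [norm_mul, mul_pow, norm_seasonalTransfer_neg_sq_eq_prod hs he hx, mul_comm (∏ _ ∈ _, _),
      Complex.ofReal_mul]
  rw [Function.comp_apply, mul_left_comm, mul_sub, ← hcov, sum_signedFreqs_eq hs,
    ← Complex.ofReal_sub, ← Complex.ofReal_mul, Complex.ofReal_re]

theorem asympCoeff_ne_zero (hs : ∀ i, 0 < s i) (hv : v ≠ 0)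
    (hΦ : ∀ z : ℂ, ‖z‖ = 1 → Polynomial.aeval z Φ ≠ 0)
    (hΘ : ∀ z : ℂ, ‖z‖ = 1 → Polynomial.aeval z Θ ≠ 0) {μ : ℝ} (hμ : μ ∈ seasonalFreqs s)
    (h0 : 0 < memoryOrder s d μ) (h1 : memoryOrder s d μ < 1 / 2) :
    asympCoeff s d Φ Θ v μ ≠ 0 := by
  have hπ := Real.pi_pos
  have hsin : 0 < Real.sin (memoryOrder s d μ * Real.pi) :=
    Real.sin_pos_of_pos_of_lt_pi (by positivity) (by nlinarith)
  have hΓ : Real.Gamma (1 - 2 * memoryOrder s d μ) ≠ 0 :=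
    (Real.Gamma_pos_of_pos (by linarith)).ne'
  have hgain : armaGain Φ Θ μ ≠ 0 := by
    rw [armaGain_eq, armaTransfer]
    exact pow_ne_zero 2 (norm_ne_zero_iff.2
      (div_ne_zero (hΘ _ (norm_zed _)) (hΦ _ (norm_zed _))))
  have hv' : (v : ℝ) / Real.pi ≠ 0 := div_ne_zero (by exact_mod_cast hv) hπ.ne'
  rw [asympCoeff]
  refine mul_ne_zero (by split_ifs <;> norm_num) (mul_ne_zero (mul_ne_zero (mul_ne_zero
    (mul_ne_zero hgain hv') hΓ) hsin.ne') (pow_ne_zero 2 (asympD_ne_zero hs hμ)))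

theorem integrableOn_sineFactor
    (hΦ : ∀ z : ℂ, ‖z‖ = 1 → Polynomial.aeval z Φ ≠ 0)
    (hΘ : ∀ z : ℂ, ‖z‖ = 1 → Polynomial.aeval z Θ ≠ 0)
    (hX : HasTransfer P U X fun x => seasonalTransfer s (-d) x * armaTransfer Φ Θ x) :
    IntegrableOn (sineFactor s d) (Set.Ioc (-Real.pi) Real.pi) := by
  -- the gain of the ARMA filter is bounded away from zero
  obtain ⟨C, hC⟩ := exists_norm_le_of_continuous (continuous_armaTransfer (Φ := Θ) (Θ := Φ) hΘ)
  have hm : MemLp (seasonalTransfer s (-d)) 2 haarC := by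
    refine (memLp_of_bounded_mul hX.memLp_transfer
      (continuous_armaTransfer (Φ := Θ) (Θ := Φ) hΘ).aestronglyMeasurable hC).ae_eq
      (Eventually.of_forall fun x => ?_)
    have h1 := hΦ _ (norm_zed x)
    have h2 := hΘ _ (norm_zed x)
    simp only [armaTransfer]
    field_simp
  have hi := hm.integrable_norm_pow two_ne_zero
  rw [integrable_haarC_iff hi.1] at hi
  refine hi.congr_fun (fun x _ => ?_) measurableSet_Ioc
  exact norm_seasonalTransfer_neg_sq s d x

/-- The autocovariance asymptotics. All frequencies may be charged with the same remainder, since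
the remainder is negligible against the term of a frequency of maximal memory order. -/
theorem exists_autocovariance_remainder [IsProbabilityMeasure P] (hs : ∀ i, 0 < s i)
    (hse : ∀ i, Even (s i)) (hΦ : ∀ z : ℂ, ‖z‖ = 1 → Polynomial.aeval z Φ ≠ 0)
    (hΘ : ∀ z : ℂ, ‖z‖ = 1 → Polynomial.aeval z Θ ≠ 0)
    (hpos : ∃ μ ∈ seasonalFreqs s, 0 < memoryParam s d μ)
    (hν : HasTransfer P U ν (armaTransfer Φ Θ)) (hU : IsSpectralIsometry P v e U)
    (hX : IsFilterOutput P (nablaSeries s (-d)) ν X) :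
    ∃ r : ℝ → ℕ → ℝ, (∀ μ ∈ seasonalFreqs s, Tendsto (r μ) atTop (𝓝 0)) ∧
      ∀ᶠ h : ℕ in atTop, ∫ ω, X h ω * X 0 ω ∂P = ∑ μ ∈ seasonalFreqs s,
        asympCoeff s d Φ Θ v μ * (h : ℝ) ^ (2 * memoryOrder s d μ - 1) *
          (Real.cos (h * μ) + r μ h) := by
  rcases eq_or_ne v 0 with rfl | hv
  · refine ⟨fun _ _ => 0, fun _ _ => tendsto_const_nhds, Eventually.of_forall fun h => ?_⟩
    have h0 := hX.ae_eq_zero (hν.ae_eq_zero hU) 0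
    have h1 : ∫ ω, X h ω * X 0 ω ∂P = 0 := by
      refine integral_eq_zero_of_ae ?_
      filter_upwards [h0] with ω hω
      rw [hω, Pi.zero_apply, mul_zero]
    rw [h1]
    refine (Finset.sum_eq_zero fun μ _ => ?_).symm
    simp [asympCoeff]
  obtain ⟨μ₀, hμ₀, hpos⟩ := hpos
  have htr := hX.hasTransfer_seasonal hs hΦ hν hU hv
  obtain ⟨μ', hμ', hmax⟩ := (seasonalFreqs s).exists_max_image (memoryOrder s d) ⟨μ₀, hμ₀⟩
  have ha := memoryOrder_lt_half hs hse (integrableOn_sineFactor hΦ hΘ htr) hμ'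
  have ha0 : 0 < memoryOrder s d μ' := by
    refine lt_of_lt_of_le ?_ (hmax μ₀ hμ₀)
    rw [memoryParam] at hpos
    split_ifs at hpos <;> linarith
  have hc := asympCoeff_ne_zero hs hv hΦ hΘ hμ' ha0 ha
  have hlim := tendsto_autocovariance_sub hs hse hΦ hU htr ⟨μ₀, hμ₀⟩ hmax ha0.le ha
  set E : ℕ → ℝ := fun n => ∫ ω, X n ω * X 0 ω ∂P - ∑ μ ∈ seasonalFreqs s,
    asympCoeff s d Φ Θ v μ * (n : ℝ) ^ (2 * memoryOrder s d μ - 1) * Real.cos (n * μ) with hE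
  refine ⟨fun μ n => if μ = μ' then
    (n : ℝ) ^ (1 - 2 * memoryOrder s d μ') * E n / asympCoeff s d Φ Θ v μ' else 0,
    fun μ _ => ?_, ?_⟩
  · by_cases h : μ = μ'
    · simpa only [if_pos h, zero_div] using hlim.div_const (asympCoeff s d Φ Θ v μ')
    · simpa only [if_neg h] using tendsto_const_nhds
  · filter_upwards [eventually_gt_atTop 0] with n hn
    have hn' : (0 : ℝ) < n := by exact_mod_cast hn
    have h1 : (n : ℝ) ^ (2 * memoryOrder s d μ' - 1) * (n : ℝ) ^ (1 - 2 * memoryOrder s d μ') = 1 := by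
      rw [← Real.rpow_add hn', show 2 * memoryOrder s d μ' - 1 + (1 - 2 * memoryOrder s d μ') = 0 by
        ring, Real.rpow_zero]
    simp only [mul_add, Finset.sum_add_distrib]
    simp only [mul_ite, mul_zero]
    rw [Finset.sum_ite_eq' _ μ', if_pos hμ']
    have h2 : asympCoeff s d Φ Θ v μ' * (n : ℝ) ^ (2 * memoryOrder s d μ' - 1) *
        ((n : ℝ) ^ (1 - 2 * memoryOrder s d μ') * E n / asympCoeff s d Φ Θ v μ') = E n := by
      rw [mul_div_assoc', div_eq_iff hc]
      linear_combination (asympCoeff s d Φ Θ v μ' * E n) * h1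
    rw [h2, hE]
    ring

end Autocovariance

end SeasonalFractional

theorem proposition1 {Ω : Type*} [MeasurableSpace Ω] (P : Measure Ω) [IsProbabilityMeasure P]
    (s : Fin 2 → ℕ) (hs_pos : ∀ i, 0 < s i) (hs_even : ∀ i, Even (s i))
    (d : Fin 2 → ℝ) (Φ Θ : Polynomial ℝ) (v : NNReal) (e ν : ℤ → Ω → ℝ)
    (he : IsGaussianNoise P v e) (hν : IsStationaryARMA P Φ Θ e ν) :
    -- (a) the defining series converges; its sum is stationary and invertible
    ((|d 0 + d 1| < 1 / 2 ∧ ∀ i, |d i| < 1 / 2) →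
      (∃ X : ℤ → Ω → ℝ, IsFilterOutput P (nablaSeries s (-d)) ν X) ∧
      ∀ X : ℤ → Ω → ℝ, IsFilterOutput P (nablaSeries s (-d)) ν X →
        IsCovStationary P X ∧ IsStrictlyStationary P X ∧
        IsFilterOutput P (nablaSeries s d) X ν ∧
        ((∀ z : ℂ, ‖z‖ ≤ 1 → Polynomial.aeval z Θ ≠ 0) →
          IsFilterOutput P ((Φ : PowerSeries ℝ) * (Θ : PowerSeries ℝ)⁻¹ * nablaSeries s d) X e)) ∧
    -- (b) the spectral density
    (IsSpectralDensity P ν (fun x => v / (2 * Real.pi) * armaGain Φ Θ x) ∧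
      ∀ X : ℤ → Ω → ℝ, IsFilterOutput P (nablaSeries s (-d)) ν X →
        ∀ fν : ℝ → ℝ, IsSpectralDensity P ν fν →
          IsSpectralDensity P X (fun x => fν x * sineFactor s d x) ∧
          ∀ D : Fin 2 → ℕ → ℝ, IsMemoryArray s d D →
            IsSpectralDensity P X (fun x => fν x * freqFactor s D x) ∧
            ∀ x : ℝ, (∀ i, Real.sin (x * s i / 2) ≠ 0) →
              fν x * freqFactor s D x = fν x * sineFactor s d x) ∧
    -- (c) the asymptotic autocovariance
    ((∀ z : ℂ, ‖z‖ = 1 → Polynomial.aeval z Θ ≠ 0) →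
      (∃ μ ∈ seasonalFreqs s, 0 < memoryParam s d μ) →
      ∀ X : ℤ → Ω → ℝ, IsFilterOutput P (nablaSeries s (-d)) ν X →
        ∃ r : ℝ → ℕ → ℝ, (∀ μ ∈ seasonalFreqs s, Tendsto (r μ) atTop (𝓝 0)) ∧
          ∀ᶠ h : ℕ in atTop,
            ∫ ω, X h ω * X 0 ω ∂P =
              ∑ μ ∈ seasonalFreqs s,
                asympCoeff s d Φ Θ v μ * (h : ℝ) ^ (2 * memoryOrder s d μ - 1) *
                  (Real.cos (h * μ) + r μ h)) := by
  obtain ⟨U, hU⟩ := he.exists_isSpectralIsometry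
  have hΦ := hν.ar_ne_zero
  have hνg := hν.hasTransfer hU
  have hg := continuous_armaTransfer (Θ := Θ) hΦ
  have hden : IsSpectralDensity P ν (fun x => v / (2 * Real.pi) * armaGain Φ Θ x) := by
    simpa only [armaGain_eq] using hνg.isSpectralDensity hU he
  refine ⟨fun ⟨h₁₂, hd⟩ => ?_, ⟨hden, fun X hX fν hfν => ?_⟩, fun hΘ hpos X hX => ?_⟩
  · have hH : MemLp (fun x => seasonalTransfer s (-d) x * armaTransfer Φ Θ x) 2 haarC := by
      obtain ⟨C, hC⟩ := exists_norm_le_of_continuous hg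
      simpa only [mul_comm] using memLp_of_bounded_mul (memLp_seasonalTransfer hs_pos h₁₂ hd)
        hg.aestronglyMeasurable hC
    have hlim := tendsto_partialEval_nabla_neg hs_pos h₁₂ hd hg
    refine ⟨exists_hasTransfer hνg hU hH hlim, fun X hX => ?_⟩
    have hXH := hX.hasTransfer hνg hU hH hlim
    refine ⟨hXH.isCovStationary hU he, hXH.isStrictlyStationary hU he,
      hνg.isFilterOutput hXH hU (tendsto_partialEval_nabla_inverse hs_pos h₁₂ hd hg), fun hΘ => ?_⟩
    exact hU.hasTransfer_noise.isFilterOutput hXH hU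
      (tendsto_partialEval_arma_inverse hs_pos h₁₂ hd hΦ hΘ)
  · have h1 := (hX.isSpectralDensity hs_pos hΦ hνg he hU).congr
      (g := fun x => fν x * sineFactor s d x) (by
        filter_upwards [hden.ae_eq hfν] with x hx
        rw [← hx])
    refine ⟨h1, fun D hD => ⟨h1.congr ?_, fun x hx => ?_⟩⟩
    · filter_upwards [ae_sin_ne_zero hs_pos] with x hx
      rw [freqFactor_eq_sineFactor hs_pos hs_even hD hx]
    · rw [freqFactor_eq_sineFactor hs_pos hs_even hD hx]
  · exact exists_autocovariance_remainder hs_pos hs_even hΦ hΘ hpos hνg hU hX
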